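/- Let $\Lambda\subset\mathbb C$ be the lattice generated by $\omega_1=2\sqrt3\,e^{-\pi i/6}$ and $\omega_2=2\sqrt3\,e^{\pi i/6}$, let $\Sigma_0=\mathbb C/\Lambda$ be the corresponding flat torus, let $R$ be the rotation of $\Sigma_0$ induced by $z\mapsto e^{2\pi i/3}z$, and let $\Sigma=\Sigma_0/\langle R\rangle$ be the quotient by the group $\mathbb Z_3$ generated by $R$, with the quotient flat metric and projection $\pi:\mathbb C\to\Sigma$. Then: (a) $\Sigma$ has area $2\sqrt3$; the three points $\pi(0),\pi(2),\pi(2e^{\pi i/3})$ are distinct, each has a neighbourhood isometric to a ball about the vertex of a Euclidean cone of cone angle $2\pi/3$, and $\Sigma$ is flat near every other point. (b) There is a homeomorphism $\Phi:\Sigma\to\mathbb S^2$, with $\Phi\circ\pi$ smooth away from the points lying over the three cone points, such that for every $\delta>0$ there is a smooth Riemannian metric $g$ on $\mathbb S^2$ with the following properties: - under $\Phi$, $g$ agrees with the flat metric of $\Sigma$ at all points at distance at least $\delta$ from the cone points; - the Gauss curvature $K_g$ is non-negative; - $\lambda_1(-\Delta_g+K_g)>0$, where $\lambda_1$ is the first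 eigenvalue, i.e. the infimum of $\int(|\nabla f|_g^2+K_gf^2)\,dA_g\big/\int f^2\,dA_g$ over smooth functions $f\not\equiv0$; - $\operatorname{area}(\mathbb S^2,g)\le 2\sqrt3+\delta$; - $(\mathbb S^2,g)$ has a shortest nontrivial (i.e. nonconstant) closed geodesic, and its length $\ell(g)$ satisfies $\ell(g)\ge 2\sqrt3-\delta$. -/

import Mathlib

open Set MeasureTheory
open scoped Manifold ContDiff

namespace Croke

/-! ### The flat torus, its rotation, and the quotient sphere -/

/-- The first generator of the lattice, `2√3 e^{-πi/6}`. -/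
noncomputable def omega₁ : ℂ := 2 * (Real.sqrt 3 : ℂ) * Complex.exp (-(Real.pi * Complex.I / 6))

/-- The second generator of the lattice, `2√3 e^{πi/6}`. -/
noncomputable def omega₂ : ℂ := 2 * (Real.sqrt 3 : ℂ) * Complex.exp (Real.pi * Complex.I / 6)

/-- The hexagonal lattice generated by `omega₁` and `omega₂`. -/
noncomputable def lattice : AddSubgroup ℂ := AddSubgroup.closure {omega₁, omega₂}

/-- The flat torus `ℂ / lattice`. -/
abbrev Torus : Type := ℂ ⧸ lattice

/-- The primitive cube root of unity `e^{2πi/3}`. -/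
noncomputable def zeta : ℂ := Complex.exp (2 * Real.pi * Complex.I / 3)

/-- The rotation `z ↦ e^{2πi/3} z` of the plane. -/
noncomputable def planeRotation : ℂ ≃+ ℂ where
  toFun z := zeta * z
  invFun z := zeta⁻¹ * z
  left_inv z := inv_mul_cancel_left₀ (Complex.exp_ne_zero _) z
  right_inv z := mul_inv_cancel_left₀ (Complex.exp_ne_zero _) z
  map_add' z w := mul_add zeta z w

theorem planeRotation_apply (z : ℂ) : planeRotation z = zeta * z := rfl

theorem zeta_eq : zeta = -(1 / 2) + (Real.sqrt 3 / 2 : ℂ) * Complex.I := by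
  have h : (2 * Real.pi * Complex.I / 3 : ℂ) = ((2 * Real.pi / 3 : ℝ) : ℂ) * Complex.I := by
    push_cast; ring
  have h2 : (2 * Real.pi / 3 : ℝ) = Real.pi - Real.pi / 3 := by ring
  rw [zeta, h, Complex.exp_mul_I, ← Complex.ofReal_cos, ← Complex.ofReal_sin, h2,
    Real.cos_pi_sub, Real.sin_pi_sub, Real.cos_pi_div_three, Real.sin_pi_div_three]
  push_cast; ring

theorem sqrt_three_mul_self : (Real.sqrt 3 : ℂ) * (Real.sqrt 3 : ℂ) = 3 := by
  rw [← Complex.ofReal_mul, Real.mul_self_sqrt (by norm_num)]; norm_num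

theorem omega₂_eq : omega₂ = 3 + (Real.sqrt 3 : ℂ) * Complex.I := by
  have h : (Real.pi * Complex.I / 6 : ℂ) = ((Real.pi / 6 : ℝ) : ℂ) * Complex.I := by
    push_cast; ring
  rw [omega₂, h, Complex.exp_mul_I, ← Complex.ofReal_cos, ← Complex.ofReal_sin,
    Real.cos_pi_div_six, Real.sin_pi_div_six]
  push_cast
  linear_combination sqrt_three_mul_self

theorem omega₁_eq : omega₁ = 3 - (Real.sqrt 3 : ℂ) * Complex.I := by
  have h : (-(Real.pi * Complex.I / 6) : ℂ) = ((-(Real.pi / 6) : ℝ) : ℂ) * Complex.I := by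
    push_cast; ring
  rw [omega₁, h, Complex.exp_mul_I, ← Complex.ofReal_cos, ← Complex.ofReal_sin,
    Real.cos_neg, Real.sin_neg, Real.cos_pi_div_six, Real.sin_pi_div_six]
  push_cast
  linear_combination sqrt_three_mul_self

theorem zeta_mul_omega₁ : zeta * omega₁ = omega₂ - omega₁ := by
  rw [zeta_eq, omega₁_eq, omega₂_eq]
  linear_combination (-(1 / 2 : ℂ) * Complex.I ^ 2) * sqrt_three_mul_self
    - (3 / 2 : ℂ) * Complex.I_sq

theorem zeta_mul_omega₂ : zeta * omega₂ = -omega₁ := by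
  rw [zeta_eq, omega₁_eq, omega₂_eq]
  linear_combination ((1 / 2 : ℂ) * Complex.I ^ 2) * sqrt_three_mul_self
    + (3 / 2 : ℂ) * Complex.I_sq

/-- The rotation preserves the lattice. -/
theorem map_lattice : lattice.map (planeRotation : ℂ →+ ℂ) = lattice := by
  have m₁ : omega₁ ∈ lattice := AddSubgroup.subset_closure (by simp)
  have m₂ : omega₂ ∈ lattice := AddSubgroup.subset_closure (by simp)
  apply le_antisymm
  · rw [AddSubgroup.map_le_iff_le_comap]
    refine (AddSubgroup.closure_le _).2 ?_
    rintro z (rfl | rfl)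
    · change zeta * omega₁ ∈ lattice
      rw [zeta_mul_omega₁]; exact lattice.sub_mem m₂ m₁
    · change zeta * omega₂ ∈ lattice
      rw [zeta_mul_omega₂]; exact lattice.neg_mem m₁
  · refine (AddSubgroup.closure_le _).2 ?_
    rintro z (rfl | rfl)
    · refine ⟨-omega₂, lattice.neg_mem m₂, ?_⟩
      change zeta * -omega₂ = omega₁
      rw [mul_neg, zeta_mul_omega₂, neg_neg]
    · refine ⟨omega₁ - omega₂, lattice.sub_mem m₁ m₂, ?_⟩
      change zeta * (omega₁ - omega₂) = omega₂
      rw [mul_sub, zeta_mul_omega₁, zeta_mul_omega₂]; ring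

/-- The rotation of the torus induced by `z ↦ e^{2πi/3} z`. -/
noncomputable def torusRotation : Equiv.Perm Torus :=
  (QuotientAddGroup.congr lattice lattice planeRotation map_lattice).toEquiv

/-- The group `ℤ₃` of symmetries of the torus generated by the rotation. -/
noncomputable abbrev rotationGroup : Subgroup (Equiv.Perm Torus) := Subgroup.zpowers torusRotation

/-- The quotient of the flat torus by the rotation group, with the quotient topology. -/
abbrev CrokeSphere : Type := MulAction.orbitRel.Quotient rotationGroup Torus

/-- The projection from the plane onto the quotient. -/
noncomputable def proj (z : ℂ) : CrokeSphere := Quotient.mk _ (z : Torus)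

/-- The images of `0`, `2` and `2 e^{πi/3}`. -/
noncomputable def conePoint : Fin 3 → CrokeSphere :=
  ![proj 0, proj 2, proj (2 * Complex.exp (Real.pi * Complex.I / 3))]

/-- The points of the plane lying over the three points `conePoint i`. -/
def coneSet : Set ℂ := proj ⁻¹' range conePoint

/-- The quotient distance: the least distance between representatives in the plane. -/
noncomputable def crokeDist (p q : CrokeSphere) : ℝ :=
  sInf {d | ∃ z w : ℂ, proj z = p ∧ proj w = q ∧ d = dist z w}

/-- The distance, in polar coordinates (distance to the vertex, angle modulo `θ`), on the
Euclidean cone of cone angle `θ`. -/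
noncomputable def coneDist (θ ρ s ρ' t : ℝ) : ℝ :=
  Real.sqrt (ρ ^ 2 + ρ' ^ 2 - 2 * ρ * ρ' * Real.cos (min Real.pi ‖((s - t : ℝ) : AddCircle θ)‖))

/-- Some ball about `p` in the quotient is isometric to the ball of the same radius about the
vertex of the Euclidean cone of angle `θ`; `P` gives the polar coordinates about `p`.
For `θ = 2π` this says that the quotient is flat near `p`. -/
def HasConeAngle (p : CrokeSphere) (θ : ℝ) : Prop :=
  ∃ r > 0, ∃ P : ℝ → ℝ → CrokeSphere,
    (∀ s, P 0 s = p) ∧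
    (∀ ρ ∈ Ico 0 r, ∀ ρ' ∈ Ico 0 r, ∀ s t,
      crokeDist (P ρ s) (P ρ' t) = coneDist θ ρ s ρ' t) ∧
    (∀ q, crokeDist p q < r → ∃ ρ ∈ Ico 0 r, ∃ s, P ρ s = q)

/-- The flat area of the quotient is `a`: there are measurable sets containing exactly one
representative in the plane of each point, and all of them have Lebesgue measure `a`. -/
def HasArea (a : ℝ) : Prop :=
  (∃ D : Set ℂ, MeasurableSet D ∧ BijOn proj D univ) ∧
    ∀ D : Set ℂ, MeasurableSet D → BijOn proj D univ → volume D = ENNReal.ofReal a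

/-! ### Riemannian metrics on the two-sphere -/

/-- The model plane. -/
abbrev E2 : Type := EuclideanSpace ℝ (Fin 2)

/-- The smooth two-sphere. -/
abbrev S2 : Type := Metric.sphere (0 : EuclideanSpace ℝ (Fin 3)) 1

/-- Smooth Riemannian metrics on the two-sphere. -/
abbrev SphereMetric : Type :=
  Bundle.ContMDiffRiemannianMetric (𝓡 2) ∞ E2 (fun x : S2 => TangentSpace (𝓡 2) x)

/-- The `i`-th partial derivative of a function on the model plane. -/
noncomputable def pd (i : Fin 2) (f : E2 → ℝ) (u : E2) : ℝ :=
  fderiv ℝ f u (EuclideanSpace.single i 1)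

/-- The Christoffel symbols `Γᵏᵢⱼ` of the metric with coefficients `G`. -/
noncomputable def christoffel (G : E2 → Matrix (Fin 2) (Fin 2) ℝ) (k i j : Fin 2) (u : E2) : ℝ :=
  (1 / 2) * ∑ l, (G u)⁻¹ k l *
    (pd i (fun x => G x j l) u + pd j (fun x => G x i l) u - pd l (fun x => G x i j) u)

/-- The coefficient of `∂ₗ` in `R(∂ᵢ, ∂ⱼ)∂ₖ = ∇ᵢ∇ⱼ∂ₖ - ∇ⱼ∇ᵢ∂ₖ`. -/
noncomputable def riemann (G : E2 → Matrix (Fin 2) (Fin 2) ℝ) (l i j k : Fin 2) (u : E2) : ℝ :=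
  pd i (christoffel G l j k) u - pd j (christoffel G l i k) u
    + ∑ m, (christoffel G l i m u * christoffel G m j k u
      - christoffel G l j m u * christoffel G m i k u)

/-- The Gauss curvature `⟨R(∂₀, ∂₁)∂₁, ∂₀⟩ / det G` of the metric with coefficients `G`. -/
noncomputable def coordCurvature (G : E2 → Matrix (Fin 2) (Fin 2) ℝ) (u : E2) : ℝ :=
  (∑ l, riemann G l 0 1 1 u * G u l 0) / (G u).det

/-- The coefficients `gᵢⱼ` of the metric in the chart centred at `p`, whose target is the whole
model plane. -/
noncomputable def coeff (g : SphereMetric) (p : S2) (u : E2) : Matrix (Fin 2) (Fin 2) ℝ :=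
  Matrix.of fun i j =>
    g.inner ((extChartAt (𝓡 2) p).symm u)
      (mfderiv 𝓘(ℝ, E2) (𝓡 2) (extChartAt (𝓡 2) p).symm u (EuclideanSpace.single i (1 : ℝ)))
      (mfderiv 𝓘(ℝ, E2) (𝓡 2) (extChartAt (𝓡 2) p).symm u (EuclideanSpace.single j (1 : ℝ)))

/-- The Gauss curvature of a metric at a point. -/
noncomputable def gaussCurvature (g : SphereMetric) (p : S2) : ℝ :=
  coordCurvature (coeff g p) (extChartAt (𝓡 2) p p)

/-- The point at which the chart used for integration is centred. -/
noncomputable def basePoint : S2 := ⟨EuclideanSpace.single 0 1, by simp⟩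

theorem extChartAt_target_eq (p : S2) : (extChartAt (𝓡 2) p).target = univ := by
  have := Fact.mk (@finrank_euclideanSpace_fin ℝ _ (2 + 1))
  have h : (chartAt (EuclideanSpace ℝ (Fin 2)) p).target = univ :=
    stereographic'_target (n := 2) (-p)
  simp [extChartAt, h]

theorem continuous_chart_symm (p : S2) : Continuous (extChartAt (𝓡 2) p).symm := by
  rw [← continuousOn_univ, ← extChartAt_target_eq p]
  exact continuousOn_extChartAt_symm p

/-- The area measure of a metric: the push-forward of `√(det gᵢⱼ) du` under the inverse
stereographic projection, whose image is the complement of a single point. -/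
noncomputable def areaMeasure (g : SphereMetric) : Measure S2 :=
  Measure.map (extChartAt (𝓡 2) basePoint).symm
    (volume.withDensity fun u => ENNReal.ofReal (Real.sqrt (coeff g basePoint u).det))

/-- The area of the sphere. -/
noncomputable def area (g : SphereMetric) : ENNReal := areaMeasure g univ

/-- The squared length of the gradient of `f` with respect to `g`. -/
noncomputable def gradSq (g : SphereMetric) (f : S2 → ℝ) (p : S2) : ℝ :=
  ∑ i, ∑ j, (coeff g p (extChartAt (𝓡 2) p p))⁻¹ i j *
    pd i (f ∘ (extChartAt (𝓡 2) p).symm) (extChartAt (𝓡 2) p p) *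
    pd j (f ∘ (extChartAt (𝓡 2) p).symm) (extChartAt (𝓡 2) p p)

/-- The first eigenvalue of `-Δ + K`, as the infimum of the Rayleigh quotients. -/
noncomputable def firstEigenvalue (g : SphereMetric) : ℝ :=
  sInf {q | ∃ f : S2 → ℝ, ContMDiff (𝓡 2) 𝓘(ℝ) ∞ f ∧ f ≠ 0 ∧
    q = (∫ p, (gradSq g f p + gaussCurvature g p * f p ^ 2) ∂(areaMeasure g)) /
      ∫ p, f p ^ 2 ∂(areaMeasure g)}

/-- The length of the velocity of a curve. -/
noncomputable def speed (g : SphereMetric) (γ : ℝ → S2) (t : ℝ) : ℝ :=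
  Real.sqrt (g.inner (γ t) (mfderiv 𝓘(ℝ) (𝓡 2) γ t (1 : ℝ)) (mfderiv 𝓘(ℝ) (𝓡 2) γ t (1 : ℝ)))

/-- A smooth curve solves the geodesic equation (at each time `t` written in the chart centred
at `γ t`). -/
def IsGeodesic (g : SphereMetric) (γ : ℝ → S2) : Prop :=
  ContMDiff 𝓘(ℝ) (𝓡 2) ∞ γ ∧
    ∀ t : ℝ, ∀ k : Fin 2,
      let u : ℝ → E2 := fun s => extChartAt (𝓡 2) (γ t) (γ s)
      deriv (deriv u) t k +
        ∑ i, ∑ j, christoffel (coeff g (γ t)) k i j (u t) * deriv u t i * deriv u t j = 0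

/-- The lengths of the nontrivial (that is, nonconstant) closed geodesics. -/
def closedGeodesicLengths (g : SphereMetric) : Set ℝ :=
  {L | ∃ (γ : ℝ → S2) (T : ℝ), 0 < T ∧ IsGeodesic g γ ∧ Function.Periodic γ T ∧
    (∃ s t, γ s ≠ γ t) ∧ L = ∫ t in (0 : ℝ)..T, speed g γ t}

/-- Under the identification `Φ`, the metric `g` agrees with the flat metric of the quotient
outside the `ε`-neighbourhoods of the three cone points: there, the pull-back of `g` to the plane
is the Euclidean metric. -/
def AgreesOutside (Φ : CrokeSphere ≃ₜ S2) (g : SphereMetric) (ε : ℝ) : Prop :=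
  ∀ z : ℂ, ε ≤ Metric.infDist z coneSet → ∀ v w : ℂ,
    g.inner (Φ (proj z))
      (mfderiv 𝓘(ℝ, ℂ) (𝓡 2) (fun x => Φ (proj x)) z v)
      (mfderiv 𝓘(ℝ, ℂ) (𝓡 2) (fun x => Φ (proj x)) z w) = inner ℝ v w

end Croke

/-!
The quotient is uniformized by an explicit function. For the hexagonal lattice the Weierstrass
function satisfies `℘(ζz) = ζ ℘(z)`, so `g₂ = 0` and `℘'` is invariant under the rotation; by
uniqueness for the equation `℘'' = 6 ℘²` it separates the points of the quotient
(`proj_eq_of_wp'_eq`). Hence `W = ℘' / ℘'(2)`, followed by inverse stereographic projection,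
induces a homeomorphism of the quotient onto the sphere (`devMap`, `exists_homeomorph_comp_proj`),
which sends the cone points to the points `∞, 1, -1` of the Riemann sphere, called poles. The area
and the cone angles of the quotient are computed in the plane, with the group generated by the
lattice and the rotation.

In the coordinate `W` the flat metric is a constant times `|W² - 1|^{-4/3} |dW|²`. Relative to the
round metric it is `e^{2u}` with `u = const - (1/3) ∑ log sᵢ`, where `sᵢ` is the squared chordal
distance to the `i`-th pole (`exp_flat_mul`, `hasDerivAt_dstereo_of_flat`). The smooth metric
(`cappedMetric`) arises by replacing `log` with a function `L` which is `log` from `ε` on and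
constant near `0` (`smoothLog`). The Laplacian on the sphere of `L(sᵢ)` is `(sᵢ (4 - sᵢ)
L'(sᵢ))'`, equal to `-1` where `L` is `log` and at least `-1` everywhere, since `s L'(s)` is an
increasing cutoff; so the curvature is nonnegative. Since `L` is at least `log`, the area does not
exceed that of the quotient.

The first eigenvalue is positive because the curvature is nonnegative and positive near a pole.
Quantitatively, in a chart which sends this pole to infinity the Dirichlet integral is that of the
plane, and `∫ |∇F|² ≥ ∫ (div X - |X|²) F²` for compactly supported fields `X`; a small multiple of
the position field, cut off where the curvature is positive, gives a lower bound
(`integral_field_le`, `exists_improved_potential`).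

A geodesic of a conformal metric on the sphere solves a second order equation in space, so unit
speed closed geodesics are periodic orbits of a smooth system
(`mem_closedGeodesicLengths_confMetric`), and a limit of such orbits is again one; so there is a
shortest one as soon as the lengths are bounded below by a positive number
(`exists_isLeast_closedGeodesicLengths`). For the bound, let `ρ` be small and let the metric be
flat outside the discs of radius `ρ` about the cone points. These discs lie in round caps of a
fixed size, on which the squared distance to the pole is convex along geodesics, whatever `ε` is
(`neg_two_inner_geoField_ge`); so a closed geodesic leaves them. Outside the discs it lifts to a
straight segment in the plane, and if this does not close up by itself, it runs between the discs
about two different points over cone points (`IsClosedOrbit.exists_excursion`). Such points have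
distance at least `2`, and at least `2√3` if they lie over the same cone point. In the latter case
the length is at least `2√3 - 2ρ`. In the former case the geodesic has to come back from one cap
to another, hence makes a second excursion, and its length is at least `4 - 4ρ`
(`IsClosedOrbit.le_length`). Finally there is a closed geodesic of length `2√3`, the image of a
line which avoids the discs.
-/

namespace Croke

/-! ### The charts of the sphere -/

/-- The Euclidean space which contains the sphere. -/
abbrev E3 : Type := EuclideanSpace ℝ (Fin 3)

/-- The isometric embedding of the model plane onto the plane orthogonal to `p` used by the
chart centred at `p`. -/
noncomputable def tangentEmb (p : S2) : E2 →ₗᵢ[ℝ] E3 :=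
  have := Fact.mk (@finrank_euclideanSpace_fin ℝ _ (2 + 1))
  (Submodule.subtypeₗᵢ (ℝ ∙ ((-p : S2) : E3))ᗮ).comp
    (OrthonormalBasis.fromOrthogonalSpanSingleton (𝕜 := ℝ) 2
      (ne_zero_of_mem_unit_sphere (-p))).repr.symm.toLinearIsometry

theorem inner_tangentEmb_self (p : S2) (u : E2) : inner ℝ (p : E3) (tangentEmb p u) = 0 := by
  have := Fact.mk (@finrank_euclideanSpace_fin ℝ _ (2 + 1))
  have h : tangentEmb p u ∈ (ℝ ∙ ((-p : S2) : E3))ᗮ := Subtype.prop _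
  rw [Submodule.mem_orthogonal_singleton_iff_inner_right] at h
  simpa using h

theorem coe_extChartAt_symm (p : S2) (u : E2) :
    (((extChartAt (𝓡 2) p).symm u : S2) : E3) =
      (‖u‖ ^ 2 + 4)⁻¹ • ((4 : ℝ) • tangentEmb p u + (4 - ‖u‖ ^ 2) • (p : E3)) := by
  have := Fact.mk (@finrank_euclideanSpace_fin ℝ _ (2 + 1))
  have h := stereographic'_symm_apply (n := 2) (-p) u
  have h2 : ((extChartAt (𝓡 2) p).symm u : S2) = (stereographic' 2 (-p)).symm u := by
    simp [extChartAt]; rfl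
  rw [h2, h]
  simp only [tangentEmb]
  simp only [LinearIsometry.coe_comp, LinearIsometryEquiv.coe_toLinearIsometry,
    Function.comp_apply, Submodule.coe_subtypeₗᵢ, Submodule.coe_subtype]
  rw [← Submodule.coe_norm, LinearIsometryEquiv.norm_map]
  simp only [coe_neg_sphere, smul_add, smul_neg]
  module

theorem extChartAt_self (p : S2) : extChartAt (𝓡 2) p p = 0 := by
  have h := (extChartAt (𝓡 2) p).right_inv (x := 0) (by rw [extChartAt_target_eq]; trivial)
  have h0 : (extChartAt (𝓡 2) p).symm 0 = p := by
    apply Subtype.ext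
    rw [coe_extChartAt_symm]
    simp
  rwa [h0] at h

theorem extChartAt_symm_zero (p : S2) : (extChartAt (𝓡 2) p).symm 0 = p := by
  apply Subtype.ext
  rw [coe_extChartAt_symm]
  simp

/-- The inverse stereographic projection centred at `p`, as a map into space. -/
noncomputable def chartInv (p : S2) (u : E2) : E3 :=
  (‖u‖ ^ 2 + 4)⁻¹ • ((4 : ℝ) • tangentEmb p u + (4 - ‖u‖ ^ 2) • (p : E3))

/-- The differential of `chartInv p` at `u`. -/
noncomputable def chartInvDeriv (p : S2) (u : E2) : E2 →L[ℝ] E3 :=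
  (‖u‖ ^ 2 + 4)⁻¹ • ((4 : ℝ) • (tangentEmb p).toContinuousLinearMap
    - ((2 : ℝ) • innerSL ℝ u).smulRight (p : E3))
  - ((‖u‖ ^ 2 + 4)⁻¹ ^ 2 • (2 : ℝ) • innerSL ℝ u).smulRight
      ((4 : ℝ) • tangentEmb p u + (4 - ‖u‖ ^ 2) • (p : E3))

theorem contDiff_chartInv (p : S2) : ContDiff ℝ ∞ (chartInv p) := by
  unfold chartInv
  have h : ∀ u : E2, ‖u‖ ^ 2 + 4 ≠ 0 := fun u => by positivity
  have h2 : ContDiff ℝ ∞ (tangentEmb p) := (tangentEmb p).contDiff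
  have h3 : ContDiff ℝ ∞ fun u : E2 => ‖u‖ ^ 2 := contDiff_norm_sq ℝ
  have h4 : ContDiff ℝ ∞ fun u : E2 => (‖u‖ ^ 2 + 4)⁻¹ := (h3.add contDiff_const).inv h
  fun_prop

theorem hasFDerivAt_chartInv (p : S2) (u : E2) :
    HasFDerivAt (chartInv p) (chartInvDeriv p u) u := by
  have h : ‖u‖ ^ 2 + 4 ≠ 0 := by positivity
  have h3 : HasFDerivAt (fun u : E2 => ‖u‖ ^ 2) ((2 : ℝ) • innerSL ℝ u) u := by
    refine (hasStrictFDerivAt_norm_sq u).hasFDerivAt.congr_fderiv ?_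
    ext1 w
    simp
  have h4 := ((hasDerivAt_inv h).comp_hasFDerivAt u (h3.add_const 4))
  have h5 := (((tangentEmb p).toContinuousLinearMap.hasFDerivAt (x := u)).const_smul (4 : ℝ)).add
    ((h3.const_sub 4).smul_const (p : E3))
  refine (h4.smul h5).congr_fderiv ?_
  ext1 w
  simp [chartInvDeriv]
  module

/-- The inverse chart is conformal; its factor is the one of stereographic projection. -/
theorem inner_chartInvDeriv (p : S2) (u w w' : E2) :
    inner ℝ (chartInvDeriv p u w) (chartInvDeriv p u w') =
      16 * (‖u‖ ^ 2 + 4)⁻¹ ^ 2 * inner ℝ w w' := by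
  have h1 := inner_tangentEmb_self p
  have h2 : ∀ w, inner ℝ (tangentEmb p w) (p : E3) = 0 := fun w => by rw [real_inner_comm, h1]
  have h3 : inner ℝ (p : E3) (p : E3) = (1 : ℝ) := by simp
  have h4 : inner ℝ u u = ‖u‖ ^ 2 := real_inner_self_eq_norm_sq u
  have h : ‖u‖ ^ 2 + 4 ≠ 0 := by positivity
  simp only [chartInvDeriv, sub_apply, smul_apply,
    ContinuousLinearMap.smulRight_apply, inner_sub_left, inner_sub_right, inner_smul_left,
    inner_smul_right, inner_add_left, inner_add_right, LinearIsometry.coe_toContinuousLinearMap,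
    LinearIsometry.inner_map_map, h1, h2, h3, h4, innerSL_apply_apply, real_inner_comm w u,
    real_inner_comm w' u, smul_eq_mul, conj_trivial]
  rw [real_inner_comm u w]
  field_simp
  ring

/-- The differential of the inclusion of the sphere into space. -/
noncomputable def dcoe (p : S2) : E2 →L[ℝ] E3 := mfderiv (𝓡 2) 𝓘(ℝ, E3) (fun x : S2 => (x : E3)) p

theorem contMDiff_coe : ContMDiff (𝓡 2) 𝓘(ℝ, E3) ∞ (fun x : S2 => (x : E3)) := by
  have := Fact.mk (@finrank_euclideanSpace_fin ℝ _ (2 + 1))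
  exact contMDiff_coe_sphere (n := 2)

theorem coe_comp_extChartAt_symm (p : S2) :
    (fun x : S2 => (x : E3)) ∘ (extChartAt (𝓡 2) p).symm = chartInv p :=
  funext fun u => coe_extChartAt_symm p u

theorem chartInvDeriv_zero (p : S2) :
    chartInvDeriv p 0 = (tangentEmb p).toContinuousLinearMap := by
  ext1 w
  simp [chartInvDeriv]

theorem dcoe_eq (p : S2) : dcoe p = (tangentEmb p).toContinuousLinearMap := by
  have h : MDifferentiableAt (𝓡 2) 𝓘(ℝ, E3) (fun x : S2 => (x : E3)) p :=
    contMDiff_coe.mdifferentiable (by simp) p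
  rw [dcoe, h.mfderiv]
  have h2 : writtenInExtChartAt (𝓡 2) 𝓘(ℝ, E3) p (fun x : S2 => (x : E3)) = chartInv p := by
    rw [← coe_comp_extChartAt_symm]
    rfl
  rw [h2, extChartAt_self]
  simp only [modelWithCornersSelf_coe, range_id, fderivWithin_univ]
  rw [(hasFDerivAt_chartInv p 0).fderiv, chartInvDeriv_zero]

theorem contMDiff_extChartAt_symm (p : S2) :
    ContMDiff 𝓘(ℝ, E2) (𝓡 2) ∞ (extChartAt (𝓡 2) p).symm := by
  rw [← contMDiffOn_univ, ← extChartAt_target_eq p]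
  exact contMDiffOn_extChartAt_symm p

theorem dcoe_mfderiv_extChartAt_symm (p : S2) (u w : E2) :
    dcoe ((extChartAt (𝓡 2) p).symm u)
      (mfderiv 𝓘(ℝ, E2) (𝓡 2) (extChartAt (𝓡 2) p).symm u w) = chartInvDeriv p u w := by
  have h1 : MDifferentiableAt 𝓘(ℝ, E2) (𝓡 2) (extChartAt (𝓡 2) p).symm u :=
    (contMDiff_extChartAt_symm p).mdifferentiable (by simp) u
  have h2 : MDifferentiableAt (𝓡 2) 𝓘(ℝ, E3) (fun x : S2 => (x : E3))
      ((extChartAt (𝓡 2) p).symm u) := contMDiff_coe.mdifferentiable (by simp) _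
  have h3 := mfderiv_comp u h2 h1
  rw [coe_comp_extChartAt_symm, mfderiv_eq_fderiv, (hasFDerivAt_chartInv p u).fderiv] at h3
  rw [h3]
  rfl

theorem inner_dcoe (p : S2) (x y : E2) : inner ℝ (dcoe p x) (dcoe p y) = inner ℝ x y := by
  rw [dcoe_eq]
  exact (tangentEmb p).inner_map_map x y

/-! ### Metrics conformal to the round metric -/

/-- The inner product of space as a continuous bilinear form. -/
noncomputable def dotForm : E3 →L[ℝ] E3 →L[ℝ] ℝ := innerSL ℝ

/-- In a local trivialization of the tangent bundle the form is the pull-back of the inner product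
of space under the differential of the inclusion, which depends smoothly on the point. -/
theorem contMDiff_roundForm (v : E3 → ℝ) (hv : ContDiff ℝ ∞ v) :
    ContMDiff (𝓡 2) ((𝓡 2).prod 𝓘(ℝ, E2 →L[ℝ] E2 →L[ℝ] ℝ)) ∞
      (fun p : S2 ↦ Bundle.TotalSpace.mk' (E2 →L[ℝ] E2 →L[ℝ] ℝ)
        (E := fun x : S2 => TangentSpace (𝓡 2) x →L[ℝ] TangentSpace (𝓡 2) x →L[ℝ] ℝ) p
        (Real.exp (2 * v p) • (dotForm.bilinearComp (dcoe p) (dcoe p)))) := by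
  intro p0
  rw [contMDiffAt_hom_bundle]
  refine ⟨contMDiffAt_id, ?_⟩
  have h1 := (contMDiff_coe p0).mfderiv_const (m := ∞) (by simp)
  have hexp : ContMDiffAt (𝓡 2) 𝓘(ℝ) ∞ (fun p : S2 => Real.exp (2 * v p)) p0 :=
    ((contDiff_const.mul hv).exp.contMDiff.comp contMDiff_coe) p0
  set A := inTangentCoordinates (𝓡 2) 𝓘(ℝ, E3) id (fun x : S2 => (x : E3))
    (mfderiv (𝓡 2) 𝓘(ℝ, E3) (fun x : S2 => (x : E3))) p0 with hA
  have h2 : ContMDiffAt (𝓡 2) 𝓘(ℝ, E2 →L[ℝ] E2 →L[ℝ] ℝ) ∞ (fun p : S2 =>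
      Real.exp (2 * v p) • (((ContinuousLinearMap.compL ℝ E2 E3 ℝ).flip (A p)).comp
        (dotForm.comp (A p)))) p0 := by
    refine hexp.smul (ContMDiffAt.clm_comp ?_ (contMDiffAt_const.clm_comp h1))
    exact contMDiffAt_const.clm_apply h1
  refine h2.congr_of_eventuallyEq ?_
  filter_upwards [(trivializationAt E2 (TangentSpace (𝓡 2)) p0).open_baseSet.mem_nhds
    (mem_baseSet_trivializationAt E2 (TangentSpace (𝓡 2)) p0)] with p hp
  ext a b
  have hA2 : ∀ w : E2, A p w =
      dcoe p ((trivializationAt E2 (TangentSpace (𝓡 2)) p0).symm p w) := by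
    intro w
    simp only [hA, inTangentCoordinates, ContinuousLinearMap.inCoordinates,
      TangentBundle.continuousLinearMapAt_model_space]
    change dcoe p ((trivializationAt E2 (TangentSpace (𝓡 2)) p0).symmL ℝ p w) = _
    rw [Bundle.Trivialization.symmL_apply _ hp]
  refine (inCoordinates_apply_eq₂ (F₁ := E2) (E₁ := fun x : S2 => TangentSpace (𝓡 2) x)
    (F₂ := E2) (E₂ := fun x : S2 => TangentSpace (𝓡 2) x) (F₃ := ℝ) (E₃ := fun _ : S2 => ℝ)
    hp hp (mem_univ _)).trans ?_
  have hA3 : (Real.exp (2 * v p) • (((ContinuousLinearMap.compL ℝ E2 E3 ℝ).flip (A p)).comp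
      (dotForm.comp (A p)))) a b = Real.exp (2 * v p) * dotForm (A p a) (A p b) := rfl
  rw [hA3, hA2, hA2]
  have htriv : ∀ r : ℝ,
      (trivializationAt ℝ (fun _ : S2 => ℝ) p0).linearMapAt ℝ p r = r := fun r => by simp
  exact htriv _

/-- The metric `e^{2v}` times the round metric of the sphere. -/
noncomputable def confMetric (v : E3 → ℝ) (hv : ContDiff ℝ ∞ v) : SphereMetric where
  inner p := Real.exp (2 * v p) • (dotForm.bilinearComp (dcoe p) (dcoe p))
  symm p x y := by
    change Real.exp _ * inner ℝ (dcoe p x) (dcoe p y) = Real.exp _ * inner ℝ (dcoe p y) (dcoe p x)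
    rw [real_inner_comm]
  pos p x hx := by
    change 0 < Real.exp _ * inner ℝ (dcoe p x) (dcoe p x)
    have h := inner_dcoe p x x
    erw [h]
    exact mul_pos (Real.exp_pos _) (real_inner_self_pos.2 hx)
  isVonNBounded p := by
    change Bornology.IsVonNBounded ℝ {x : E2 | Real.exp _ * inner ℝ (dcoe p x) (dcoe p x) < 1}
    simp only [inner_dcoe]
    rw [NormedSpace.isVonNBounded_iff, Metric.isBounded_iff_subset_closedBall 0]
    refine ⟨Real.exp (-v p), fun x hx => ?_⟩
    rw [mem_closedBall_zero_iff]
    simp only [mem_ofPred_eq, real_inner_self_eq_norm_sq] at hx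
    refine le_of_lt (lt_of_pow_lt_pow_left₀ 2 (Real.exp_pos _).le ?_)
    have h : Real.exp (2 * v p) * Real.exp (-v p) ^ 2 = 1 := by
      rw [← Real.exp_nat_mul, ← Real.exp_add]
      simp
    by_contra! hc
    have := mul_le_mul_of_nonneg_left hc (Real.exp_pos (2 * v p)).le
    linarith
  contMDiff := contMDiff_roundForm v hv

theorem confMetric_inner (v : E3 → ℝ) (hv : ContDiff ℝ ∞ v) (p : S2) (x y : E2) :
    (confMetric v hv).inner p x y = Real.exp (2 * v p) * inner ℝ (dcoe p x) (dcoe p y) := rfl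

/-- The logarithm of the conformal factor of `confMetric v` in the chart centred at `p`. -/
noncomputable def chartPotential (v : E3 → ℝ) (p : S2) (u : E2) : ℝ :=
  v (chartInv p u) + Real.log (4 * (‖u‖ ^ 2 + 4)⁻¹)

theorem coeff_confMetric (v : E3 → ℝ) (hv : ContDiff ℝ ∞ v) (p : S2) (u : E2) :
    coeff (confMetric v hv) p u = Real.exp (2 * chartPotential v p u) • (1 : Matrix _ _ ℝ) := by
  ext i j
  have h0 : (0 : ℝ) < 4 * (‖u‖ ^ 2 + 4)⁻¹ := by positivity
  have h1 : Real.exp (2 * chartPotential v p u) =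
      Real.exp (2 * v (chartInv p u)) * (16 * (‖u‖ ^ 2 + 4)⁻¹ ^ 2) := by
    rw [chartPotential, mul_add, Real.exp_add, two_mul (Real.log _), Real.exp_add, Real.exp_log h0]
    ring
  simp only [coeff, Matrix.of_apply]
  erw [confMetric_inner, dcoe_mfderiv_extChartAt_symm, dcoe_mfderiv_extChartAt_symm]
  rw [inner_chartInvDeriv, coe_extChartAt_symm, ← chartInv, h1]
  simp [Matrix.one_apply, EuclideanSpace.inner_single_left]

theorem contDiff_chartPotential {v : E3 → ℝ} (hv : ContDiff ℝ ∞ v) (p : S2) :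
    ContDiff ℝ ∞ (chartPotential v p) := by
  have h : ∀ u : E2, ‖u‖ ^ 2 + 4 ≠ 0 := fun u => by positivity
  have h3 : ContDiff ℝ ∞ fun u : E2 => ‖u‖ ^ 2 := contDiff_norm_sq ℝ
  have h4 : ContDiff ℝ ∞ fun u : E2 => (‖u‖ ^ 2 + 4)⁻¹ := (h3.add contDiff_const).inv h
  refine (hv.comp (contDiff_chartInv p)).add (ContDiff.log (contDiff_const.mul h4) ?_)
  intro u
  have := h u
  positivity

theorem contDiff_pd {f : E2 → ℝ} (hf : ContDiff ℝ ∞ f) (i : Fin 2) : ContDiff ℝ ∞ (pd i f) :=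
  (hf.fderiv_right (m := ∞) (by simp)).clm_apply contDiff_const

/-! ### Curvature of conformal metrics -/

section Conformal

variable {ψ : E2 → ℝ} {G : E2 → Matrix (Fin 2) (Fin 2) ℝ}

theorem pd_coeff_conformal (hψ : ContDiff ℝ ∞ ψ)
    (hG : ∀ u, G u = Real.exp (2 * ψ u) • (1 : Matrix _ _ ℝ)) (i j l : Fin 2) (u : E2) :
    pd i (fun x => G x j l) u = 2 * Real.exp (2 * ψ u) * pd i ψ u * (if j = l then 1 else 0) := by
  have h : HasFDerivAt (fun x => G x j l)
      ((if j = l then (1 : ℝ) else 0) • (Real.exp (2 * ψ u) • ((2 : ℝ) • fderiv ℝ ψ u))) u := by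
    have h1 := ((hψ.differentiable (by simp)) u).hasFDerivAt
    have h2 := ((h1.const_mul 2).exp).const_mul (if j = l then (1 : ℝ) else 0)
    refine h2.congr_of_eventuallyEq (Filter.Eventually.of_forall fun x => ?_)
    simp [hG, Matrix.one_apply]
  rw [pd, h.fderiv]
  split_ifs <;> simp [pd]
  ring

/-- The Christoffel symbols of `e^{2ψ} (du₀² + du₁²)`. -/
theorem christoffel_conformal (hψ : ContDiff ℝ ∞ ψ)
    (hG : ∀ u, G u = Real.exp (2 * ψ u) • (1 : Matrix _ _ ℝ)) (k i j : Fin 2) (u : E2) :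
    christoffel G k i j u =
      (if k = i then 1 else 0) * pd j ψ u + (if k = j then 1 else 0) * pd i ψ u
      - (if i = j then 1 else 0) * pd k ψ u := by
  have hinv : (G u)⁻¹ = (Real.exp (2 * ψ u))⁻¹ • (1 : Matrix _ _ ℝ) := by
    apply Matrix.inv_eq_right_inv
    rw [hG, smul_mul_smul_comm, mul_inv_cancel₀ (Real.exp_pos _).ne']
    simp
  have h0 := (Real.exp_pos (2 * ψ u)).ne'
  simp only [christoffel, pd_coeff_conformal hψ hG, hinv]
  fin_cases k <;> fin_cases i <;> fin_cases j <;> simp <;> field_simp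

/-- The curvature `-e^{-2ψ} Δψ` of `e^{2ψ} (du₀² + du₁²)`. -/
theorem coordCurvature_conformal (hψ : ContDiff ℝ ∞ ψ)
    (hG : ∀ u, G u = Real.exp (2 * ψ u) • (1 : Matrix _ _ ℝ)) (u : E2) :
    coordCurvature G u =
      - Real.exp (-(2 * ψ u)) * (pd 0 (pd 0 ψ) u + pd 1 (pd 1 ψ) u) := by
  have hc : ∀ k i j, christoffel G k i j = fun u => (if k = i then 1 else 0) * pd j ψ u
      + (if k = j then 1 else 0) * pd i ψ u - (if i = j then 1 else 0) * pd k ψ u :=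
    fun k i j => funext fun u => christoffel_conformal hψ hG k i j u
  have hd : ∀ i, DifferentiableAt ℝ (pd i ψ) u :=
    fun i => ((contDiff_pd hψ i).differentiable (by simp)) u
  have hpn : ∀ i j, pd i (fun u => -pd j ψ u) u = - pd i (pd j ψ) u := by
    intro i j
    simp only [pd, fderiv_fun_neg]
    rfl
  have h0 := (Real.exp_pos (2 * ψ u)).ne'
  rw [Real.exp_neg]
  simp only [coordCurvature, riemann, hc, hG]
  simp [hpn]
  field_simp
  ring

end Conformal

theorem pd_pd_eq_deriv {f : E2 → ℝ} (hf : ContDiff ℝ ∞ f) (i : Fin 2) (u : E2) :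
    pd i (pd i f) u =
      deriv (deriv fun t : ℝ => f (u + t • EuclideanSpace.single i (1 : ℝ))) 0 := by
  have h : ∀ {f : E2 → ℝ}, ContDiff ℝ ∞ f → ∀ t : ℝ,
      HasDerivAt (fun t : ℝ => f (u + t • EuclideanSpace.single i (1 : ℝ)))
        (pd i f (u + t • EuclideanSpace.single i (1 : ℝ))) t := by
    intro f hf t
    have h1 := ((hf.differentiable (by simp)) (u + t • EuclideanSpace.single i (1 : ℝ))).hasFDerivAt
    have h2 : HasDerivAt (fun t : ℝ => u + t • EuclideanSpace.single i (1 : ℝ))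
        (EuclideanSpace.single i (1 : ℝ)) t := by
      simpa using ((hasDerivAt_id t).smul_const (EuclideanSpace.single i (1 : ℝ))).const_add u
    exact h1.comp_hasDerivAt t h2
  rw [funext fun t => (h hf t).deriv, (h (contDiff_pd hf i) 0).deriv]
  simp

/-- Expansion of a vector in the orthonormal basis consisting of `p` and the image of the
standard basis under `tangentEmb p`. -/
theorem eq_sum_tangentEmb (p : S2) (x : E3) :
    x = inner ℝ (p : E3) x • (p : E3)
      + ∑ i, inner ℝ (tangentEmb p (EuclideanSpace.single i 1)) x •
          tangentEmb p (EuclideanSpace.single i (1 : ℝ)) := by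
  set w : Fin 3 → E3 := ![(p : E3), tangentEmb p (EuclideanSpace.single 0 1),
    tangentEmb p (EuclideanSpace.single 1 1)] with hw
  have ho : Orthonormal ℝ w := by
    rw [orthonormal_iff_ite]
    intro i j
    have h2 : ∀ w, inner ℝ (tangentEmb p w) (p : E3) = 0 := fun w => by
      rw [real_inner_comm, inner_tangentEmb_self]
    fin_cases i <;> fin_cases j <;>
      simp [hw, inner_tangentEmb_self, h2, EuclideanSpace.inner_single_left]
  have hs := (basisOfOrthonormalOfCardEqFinrank ho (by simp)).span_eq
  rw [coe_basisOfOrthonormalOfCardEqFinrank] at hs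
  have h := ((OrthonormalBasis.mk ho hs.ge).sum_repr' x).symm
  rw [OrthonormalBasis.coe_mk] at h
  simpa [Fin.sum_univ_three, hw, add_assoc] using h

theorem sum_inner_tangentEmb_sq (p : S2) (x : E3) :
    ∑ i, inner ℝ (tangentEmb p (EuclideanSpace.single i 1)) x ^ 2 =
      ‖x‖ ^ 2 - inner ℝ (p : E3) x ^ 2 := by
  have h := congrArg (fun y => inner ℝ y x) (eq_sum_tangentEmb p x)
  simp only [inner_add_left, inner_smul_left, Fin.sum_univ_two, conj_trivial,
    real_inner_self_eq_norm_sq] at h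
  rw [Fin.sum_univ_two]
  linarith

/-- The Laplacian of `v` along the unit sphere, at the point `p`. -/
noncomputable def sphereLaplacian (v : E3 → ℝ) (p : S2) : ℝ :=
  ∑ i, deriv (deriv fun t : ℝ => v (chartInv p (t • EuclideanSpace.single i (1 : ℝ)))) 0

/-- The curvature of a conformal change of the round metric, whose own curvature is `1`. -/
theorem gaussCurvature_confMetric (v : E3 → ℝ) (hv : ContDiff ℝ ∞ v) (p : S2) :
    gaussCurvature (confMetric v hv) p =
      Real.exp (-(2 * v p)) * (1 - sphereLaplacian v p) := by
  have h0 : chartInv p 0 = (p : E3) := by simp [chartInv]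
  have hc : ∀ i, pd i (pd i (chartPotential v p)) 0 =
      deriv (deriv fun t : ℝ => v (chartInv p (t • EuclideanSpace.single i (1 : ℝ)))) 0
        - 1 / 2 := by
    intro i
    rw [pd_pd_eq_deriv (contDiff_chartPotential hv p)]
    have hf : ContDiff ℝ ∞ fun t : ℝ => v (chartInv p (t • EuclideanSpace.single i (1 : ℝ))) :=
      hv.comp ((contDiff_chartInv p).comp (contDiff_id.smul contDiff_const))
    have hlog : ∀ t : ℝ, HasDerivAt (fun t : ℝ => Real.log (4 * (t ^ 2 + 4)⁻¹))
        (-(2 * t) / (t ^ 2 + 4)) t := by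
      intro t
      have h1 : t ^ 2 + 4 ≠ 0 := by positivity
      have h2 := ((((hasDerivAt_pow 2 t).add_const 4).fun_inv h1).const_mul 4).log
        (by positivity)
      refine h2.congr_deriv ?_
      field_simp
      simp [mul_comm]
    have hfun : (fun t : ℝ => chartPotential v p (0 + t • EuclideanSpace.single i (1 : ℝ))) =
        fun t => v (chartInv p (t • EuclideanSpace.single i (1 : ℝ)))
          + Real.log (4 * (t ^ 2 + 4)⁻¹) := by
      funext t
      simp [chartPotential, norm_smul]
    have hd : deriv (fun t : ℝ => v (chartInv p (t • EuclideanSpace.single i (1 : ℝ)))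
          + Real.log (4 * (t ^ 2 + 4)⁻¹)) =
        fun t => deriv (fun t => v (chartInv p (t • EuclideanSpace.single i (1 : ℝ)))) t
          + -(2 * t) / (t ^ 2 + 4) := by
      funext t
      exact (((hf.differentiable (by simp)) t).hasDerivAt.add (hlog t)).deriv
    rw [hfun, hd]
    have hf' : DifferentiableAt ℝ
        (deriv fun t : ℝ => v (chartInv p (t • EuclideanSpace.single i (1 : ℝ)))) 0 :=
      (((contDiff_infty_iff_deriv.1 hf).2).differentiable (by simp)) 0
    have hq : HasDerivAt (fun t : ℝ => -(2 * t) / (t ^ 2 + 4)) (-(1 / 2)) 0 := by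
      have h1 : (0 : ℝ) ^ 2 + 4 ≠ 0 := by norm_num
      refine (((((hasDerivAt_id (0 : ℝ)).const_mul 2).neg).div
        ((hasDerivAt_pow 2 (0 : ℝ)).add_const 4) h1)).congr_deriv ?_
      norm_num
    rw [(hf'.hasDerivAt.fun_add hq).deriv]
    ring
  rw [gaussCurvature, coordCurvature_conformal (contDiff_chartPotential hv p)
    (coeff_confMetric v hv p), extChartAt_self, hc, hc, sphereLaplacian, Fin.sum_univ_two,
    chartPotential, h0]
  norm_num
  ring

theorem inner_chartInv (p : S2) (u : E2) (x : E3) :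
    inner ℝ (chartInv p u) x = (‖u‖ ^ 2 + 4)⁻¹ *
      (4 * inner ℝ (tangentEmb p u) x + (4 - ‖u‖ ^ 2) * inner ℝ (p : E3) x) := by
  simp [chartInv, inner_smul_left, inner_add_left]
  ring

/-- The second derivative, along a coordinate line of the chart, of a function of the squared
distance `2 - 2⟨x, q⟩` to the point `q`. -/
theorem deriv_deriv_chordal {L : ℝ → ℝ} (hL : ContDiff ℝ ∞ L) (p : S2) (q : E3) (i : Fin 2) :
    deriv (deriv fun t : ℝ =>
        L (2 - 2 * inner ℝ (chartInv p (t • EuclideanSpace.single i (1 : ℝ))) q)) 0 =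
      deriv (deriv L) (2 - 2 * inner ℝ (p : E3) q) *
          (4 * inner ℝ (tangentEmb p (EuclideanSpace.single i 1)) q ^ 2)
        + deriv L (2 - 2 * inner ℝ (p : E3) q) * (2 * inner ℝ (p : E3) q) := by
  set β := inner ℝ (tangentEmb p (EuclideanSpace.single i 1)) q with hβ
  set c := inner ℝ (p : E3) q with hc
  have hs : ∀ t : ℝ, 2 - 2 * inner ℝ (chartInv p (t • EuclideanSpace.single i (1 : ℝ))) q =
      2 - 2 * ((4 * (t * β) + (4 - t ^ 2) * c) / (t ^ 2 + 4)) := by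
    intro t
    rw [inner_chartInv, map_smul, inner_smul_left, norm_smul]
    simp [← hβ, ← hc]
    ring
  set σ : ℝ → ℝ := fun t => 2 - 2 * ((4 * (t * β) + (4 - t ^ 2) * c) / (t ^ 2 + 4)) with hσ
  have hσ' : ∀ t, HasDerivAt σ ((8 * β * t ^ 2 + 32 * c * t - 32 * β) / (t ^ 2 + 4) ^ 2) t := by
    intro t
    have h1 : t ^ 2 + 4 ≠ 0 := by positivity
    have h2 : HasDerivAt (fun t : ℝ => 4 * (t * β) + (4 - t ^ 2) * c) (4 * β - 2 * t * c) t := by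
      refine ((((hasDerivAt_id t).mul_const β).const_mul 4).fun_add
        (((hasDerivAt_pow 2 t).const_sub 4).mul_const c)).congr_deriv ?_
      simp
      ring
    refine (((h2.fun_div ((hasDerivAt_pow 2 t).add_const 4) h1).const_mul 2).const_sub
      2).congr_deriv ?_
    field_simp
    simp
    ring
  have hd : deriv (fun t => L (σ t)) = fun t =>
      deriv L (σ t) * ((8 * β * t ^ 2 + 32 * c * t - 32 * β) / (t ^ 2 + 4) ^ 2) := by
    funext t
    exact (((hL.differentiable (by simp)) (σ t)).hasDerivAt.comp t (hσ' t)).deriv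
  have h3 : HasDerivAt (fun t : ℝ => (8 * β * t ^ 2 + 32 * c * t - 32 * β) / (t ^ 2 + 4) ^ 2)
      (2 * c) 0 := by
    have h1 : ((0 : ℝ) ^ 2 + 4) ^ 2 ≠ 0 := by norm_num
    refine (((((hasDerivAt_pow 2 (0 : ℝ)).const_mul (8 * β)).fun_add
      ((hasDerivAt_id (0 : ℝ)).const_mul (32 * c))).sub_const (32 * β)).fun_div
      (((hasDerivAt_pow 2 (0 : ℝ)).add_const 4).fun_pow 2) h1).congr_deriv ?_
    simp
    ring
  have h4 : HasDerivAt (fun t => deriv L (σ t))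
      (deriv (deriv L) (σ 0) * ((8 * β * 0 ^ 2 + 32 * c * 0 - 32 * β) / (0 ^ 2 + 4) ^ 2)) 0 :=
    ((((contDiff_infty_iff_deriv.1 hL).2).differentiable (by simp)) (σ 0)).hasDerivAt.comp 0
      (hσ' 0)
  have h5 : σ 0 = 2 - 2 * c := by simp [hσ]
  simp only [hs]
  rw [hd, (h4.fun_mul h3).deriv, h5]
  ring

/-- The Laplacian along the unit sphere of a function `L` of the squared chordal distance `s` to a
point: it is `(s (4 - s) L')'`. For `L = log` this is the constant `-1`, which makes the
potentials below explicit. -/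
theorem sum_deriv_deriv_chordal {L : ℝ → ℝ} (hL : ContDiff ℝ ∞ L) (p : S2) (q : S2) :
    ∑ i, deriv (deriv fun t : ℝ =>
        L (2 - 2 * inner ℝ (chartInv p (t • EuclideanSpace.single i (1 : ℝ))) (q : E3))) 0 =
      deriv (fun s => s * (4 - s) * deriv L s) (2 - 2 * inner ℝ (p : E3) q) := by
  have h := sum_inner_tangentEmb_sq p (q : E3)
  simp only [deriv_deriv_chordal hL]
  rw [Fin.sum_univ_two] at h ⊢
  set c := inner ℝ (p : E3) (q : E3) with hc
  have h1 : HasDerivAt (fun s : ℝ => s * (4 - s) * deriv L s)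
      ((1 * (4 - (2 - 2 * c)) + (2 - 2 * c) * (-1)) * deriv L (2 - 2 * c) +
        (2 - 2 * c) * (4 - (2 - 2 * c)) * deriv (deriv L) (2 - 2 * c)) (2 - 2 * c) :=
    ((hasDerivAt_id (2 - 2 * c)).mul ((hasDerivAt_id (2 - 2 * c)).const_sub 4)).mul
      ((((contDiff_infty_iff_deriv.1 hL).2).differentiable (by simp)) _).hasDerivAt
  rw [h1.deriv]
  have h2 : ‖(q : E3)‖ = 1 := by simp
  rw [h2] at h
  linear_combination (4 * deriv (deriv L) (2 - 2 * c)) * h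

/-! ### Geodesics of conformal metrics -/

/-- The acceleration in space of a geodesic of `confMetric v` through `x` with velocity `y`. -/
noncomputable def geoField (v : E3 → ℝ) (x y : E3) : E3 :=
  -(‖y‖ ^ 2) • x - (2 * inner ℝ (gradient v x) y) • y
    + ‖y‖ ^ 2 • (gradient v x - inner ℝ (gradient v x) x • x)

theorem extChartAt_apply_of_mem {p x : S2} (hx : x ∈ (extChartAt (𝓡 2) p).source) (k : Fin 2) :
    extChartAt (𝓡 2) p x k =
      2 * inner ℝ (tangentEmb p (EuclideanSpace.single k 1)) (x : E3) /
        (1 + inner ℝ (p : E3) (x : E3)) := by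
  set u := extChartAt (𝓡 2) p x with hu
  have h : (x : E3) = chartInv p u := by
    rw [← coe_comp_extChartAt_symm, Function.comp_apply, hu, (extChartAt (𝓡 2) p).left_inv hx]
  have h1 : ‖u‖ ^ 2 + 4 ≠ 0 := by positivity
  have h2 : ∀ w, inner ℝ (tangentEmb p w) (p : E3) = 0 := fun w => by
    rw [real_inner_comm, inner_tangentEmb_self]
  rw [h, real_inner_comm, inner_chartInv, real_inner_comm (chartInv p u), inner_chartInv, h2,
    inner_tangentEmb_self,
    LinearIsometry.inner_map_map]
  simp [EuclideanSpace.inner_single_right]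
  field_simp
  ring

theorem contDiff_coe_comp {γ : ℝ → S2} :
    ContDiff ℝ ∞ (fun t => (γ t : E3)) ↔ ContMDiff 𝓘(ℝ) (𝓡 2) ∞ γ := by
  constructor
  · intro h
    have := Fact.mk (@finrank_euclideanSpace_fin ℝ _ (2 + 1))
    exact h.contMDiff.codRestrict_sphere (n := 2) (fun t => (γ t).2)
  · intro h
    exact (contMDiff_coe.comp h).contDiff

theorem hasDerivAt_euclidean_of_apply {f : ℝ → E2} {f' : E2} {s : ℝ}
    (h : ∀ i, HasDerivAt (fun s => f s i) (f' i) s) : HasDerivAt f f' s := by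
  rw [hasDerivAt_iff_hasFDerivAt, ← hasFDerivWithinAt_univ, hasFDerivWithinAt_euclidean]
  intro i
  rw [hasFDerivWithinAt_univ]
  refine (h i).hasFDerivAt.congr_fderiv ?_
  ext
  simp

section Curve

variable {γ : ℝ → S2}

theorem inner_deriv_self (hc : ContDiff ℝ ∞ (fun t => (γ t : E3))) (t : ℝ) :
    inner ℝ (γ t : E3) (deriv (fun t => (γ t : E3)) t) = 0 := by
  have h := ((hc.differentiable (by simp)) t).hasDerivAt
  have h2 := (h.inner ℝ h).deriv
  have h3 : (fun t => inner ℝ (γ t : E3) (γ t : E3)) = fun _ => (1 : ℝ) := by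
    funext t
    simp
  rw [h3, deriv_const, real_inner_comm] at h2
  rw [real_inner_comm]
  linarith

theorem inner_deriv_deriv_self (hc : ContDiff ℝ ∞ (fun t => (γ t : E3))) (t : ℝ) :
    inner ℝ (γ t : E3) (deriv (deriv (fun t => (γ t : E3))) t) =
      -‖deriv (fun t => (γ t : E3)) t‖ ^ 2 := by
  have h := ((hc.differentiable (by simp)) t).hasDerivAt
  have h' := ((((contDiff_infty_iff_deriv.1 hc).2).differentiable (by simp)) t).hasDerivAt
  have h2 := (h.inner ℝ h').deriv
  rw [funext (inner_deriv_self hc), deriv_const, real_inner_self_eq_norm_sq] at h2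
  linarith

/-- In the chart centred at the point `γ t`, the first two derivatives at time `t` of a curve on
the sphere are the tangential components of its derivatives in space: the chart agrees with the
orthogonal projection to second order. -/
theorem chart_curve_derivs (hc : ContDiff ℝ ∞ (fun t => (γ t : E3))) (t : ℝ) (k : Fin 2) :
    let u : ℝ → E2 := fun s => extChartAt (𝓡 2) (γ t) (γ s)
    deriv u t k = inner ℝ (tangentEmb (γ t) (EuclideanSpace.single k 1))
      (deriv (fun t => (γ t : E3)) t) ∧
    deriv (deriv u) t k = inner ℝ (tangentEmb (γ t) (EuclideanSpace.single k 1))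
      (deriv (deriv (fun t => (γ t : E3))) t) := by
  intro u
  set c := fun t => (γ t : E3) with hcdef
  have hcont : Continuous γ := (contDiff_coe_comp.1 hc).continuous
  set w : ℝ → E2 := fun s => WithLp.toLp 2 fun k =>
    2 * inner ℝ (tangentEmb (γ t) (EuclideanSpace.single k 1)) (c s) / (1 + inner ℝ (c t) (c s))
    with hw
  have huw : u =ᶠ[nhds t] w := by
    filter_upwards [hcont.continuousAt.preimage_mem_nhds
      (extChartAt_source_mem_nhds (I := 𝓡 2) (γ t))] with s hs
    ext i
    exact extChartAt_apply_of_mem hs i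
  have hd := hc.differentiable (by simp)
  have hd2 := ((contDiff_infty_iff_deriv.1 hc).2).differentiable (by simp)
  have hpos : ∀ᶠ s in nhds t, 1 + inner ℝ (c t) (c s) ≠ 0 := by
    have h1 : Continuous fun s => 1 + inner ℝ (c t) (c s) := by
      have := hc.continuous
      fun_prop
    refine h1.continuousAt.eventually_ne ?_
    simp [hcdef]
  set a : Fin 2 → ℝ → ℝ := fun k s => inner ℝ (tangentEmb (γ t) (EuclideanSpace.single k 1)) (c s)
  set b : ℝ → ℝ := fun s => inner ℝ (c t) (c s)
  have ha : ∀ k s, HasDerivAt (a k)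
      (inner ℝ (tangentEmb (γ t) (EuclideanSpace.single k 1)) (deriv c s)) s := fun k s => by
    simpa using (hasDerivAt_const s _).inner ℝ (hd s).hasDerivAt
  have hb : ∀ s, HasDerivAt b (inner ℝ (c t) (deriv c s)) s := fun s => by
    simpa using (hasDerivAt_const s _).inner ℝ (hd s).hasDerivAt
  have ha2 : ∀ k s, HasDerivAt (fun s => inner ℝ (tangentEmb (γ t) (EuclideanSpace.single k 1))
      (deriv c s)) (inner ℝ (tangentEmb (γ t) (EuclideanSpace.single k 1)) (deriv (deriv c) s)) s :=
    fun k s => by simpa using (hasDerivAt_const s _).inner ℝ (hd2 s).hasDerivAt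
  have hb2 : ∀ s, HasDerivAt (fun s => inner ℝ (c t) (deriv c s))
      (inner ℝ (c t) (deriv (deriv c) s)) s := fun s => by
    simpa using (hasDerivAt_const s _).inner ℝ (hd2 s).hasDerivAt
  set w' : ℝ → E2 := fun s => WithLp.toLp 2 fun k =>
    (2 * inner ℝ (tangentEmb (γ t) (EuclideanSpace.single k 1)) (deriv c s) * (1 + b s)
      - 2 * a k s * inner ℝ (c t) (deriv c s)) / (1 + b s) ^ 2 with hw'
  have hwd : ∀ᶠ s in nhds t, HasDerivAt w (w' s) s := by
    filter_upwards [hpos] with s hs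
    apply hasDerivAt_euclidean_of_apply
    intro i
    exact ((ha i s).const_mul 2).fun_div ((hb s).const_add 1) hs
  have hat : ∀ k, a k t = 0 := fun k => by
    change inner ℝ (tangentEmb (γ t) (EuclideanSpace.single k 1)) (γ t : E3) = 0
    rw [real_inner_comm, inner_tangentEmb_self]
  have hbt : b t = 1 := by
    change inner ℝ (γ t : E3) (γ t : E3) = (1 : ℝ)
    simp
  have hb't : inner ℝ (c t) (deriv c t) = 0 := inner_deriv_self hc t
  have hud : deriv u =ᶠ[nhds t] w' := by
    filter_upwards [huw.eventuallyEq_nhds, hwd] with s h1 h2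
    rw [h1.deriv_eq, h2.deriv]
  constructor
  · rw [hud.eq_of_nhds]
    simp [hw', hat, hbt]
    ring
  · rw [hud.deriv_eq]
    have h0 : (1 + b t) ^ 2 ≠ 0 := by rw [hbt]; norm_num
    have h3 : HasDerivAt w' (WithLp.toLp 2 fun k =>
        inner ℝ (tangentEmb (γ t) (EuclideanSpace.single k 1)) (deriv (deriv c) t)) t := by
      apply hasDerivAt_euclidean_of_apply
      intro i
      refine (((((ha2 i t).const_mul 2).fun_mul ((hb t).const_add 1)).fun_sub
        (((ha i t).const_mul 2).fun_mul (hb2 t))).fun_div (((hb t).const_add 1).fun_pow 2)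
          h0).congr_deriv ?_
      simp [hat, hbt, hb't]
      ring
    rw [h3.deriv]

theorem pd_chartPotential_zero {v : E3 → ℝ} (hv : ContDiff ℝ ∞ v) (p : S2) (i : Fin 2) :
    pd i (chartPotential v p) 0 =
      inner ℝ (gradient v p) (tangentEmb p (EuclideanSpace.single i 1)) := by
  have h0 : chartInv p 0 = (p : E3) := by simp [chartInv]
  have h1 : HasFDerivAt (fun u : E2 => v (chartInv p u))
      ((fderiv ℝ v p).comp (tangentEmb p).toContinuousLinearMap) 0 := by
    have h2 := hasFDerivAt_chartInv p 0
    rw [chartInvDeriv_zero] at h2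
    have h3 := ((hv.differentiable (by simp)) (chartInv p 0)).hasFDerivAt
    rw [h0] at h3
    exact HasFDerivAt.comp (0 : E2) (by rwa [h0]) h2
  have h2 : HasFDerivAt (fun u : E2 => Real.log (4 * (‖u‖ ^ 2 + 4)⁻¹)) (0 : E2 →L[ℝ] ℝ) 0 := by
    have h3 : HasFDerivAt (fun u : E2 => ‖u‖ ^ 2) (0 : E2 →L[ℝ] ℝ) 0 := by
      refine (hasStrictFDerivAt_norm_sq (0 : E2)).hasFDerivAt.congr_fderiv ?_
      simp
    have h4 : HasDerivAt (fun x : ℝ => Real.log (4 * (x + 4)⁻¹)) (-(1 / 4)) (‖(0 : E2)‖ ^ 2) := by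
      rw [norm_zero]
      refine ((((hasDerivAt_id ((0 : ℝ) ^ 2)).add_const 4).fun_inv (by norm_num)).const_mul 4).log
        (by norm_num) |>.congr_deriv ?_
      norm_num
    refine (h4.comp_hasFDerivAt (0 : E2) h3).congr_fderiv (smul_zero _)
  have h5 : fderiv ℝ (chartPotential v p) 0 = _ := (h1.add h2).fderiv
  rw [pd, h5, add_zero, ContinuousLinearMap.comp_apply, gradient,
    InnerProductSpace.toDual_symm_apply]
  rfl

/-- The geodesic equation in space. In the frame formed by `γ t` and an orthonormal basis of the
tangent plane, the tangential components are the equation in the chart, and the normal component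
holds because the curve lies on the sphere. -/
theorem isGeodesic_confMetric_iff {v : E3 → ℝ} (hv : ContDiff ℝ ∞ v) :
    IsGeodesic (confMetric v hv) γ ↔ ContDiff ℝ ∞ (fun t => (γ t : E3)) ∧
      ∀ t, deriv (deriv fun t => (γ t : E3)) t =
        geoField v (γ t) (deriv (fun t => (γ t : E3)) t) := by
  rw [IsGeodesic, ← contDiff_coe_comp]
  refine and_congr_right fun hc => forall_congr' fun t => ?_
  set c := fun t => (γ t : E3) with hcdef
  have h1 := fun k => (chart_curve_derivs hc t k).1
  have h2 := fun k => (chart_curve_derivs hc t k).2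
  simp only at h1 h2
  have h3 : ∀ k i j, christoffel (coeff (confMetric v hv) (γ t)) k i j
      0 = _ := fun k i j =>
    christoffel_conformal (contDiff_chartPotential hv (γ t)) (coeff_confMetric v hv (γ t)) k i j _
  simp only [h1, h2, extChartAt_self, h3, pd_chartPotential_zero hv]
  set ε : Fin 2 → E3 := fun k => tangentEmb (γ t) (EuclideanSpace.single k 1) with hε
  have hcc' : inner ℝ (γ t : E3) (deriv c t) = 0 := inner_deriv_self hc t
  have hcc'' : inner ℝ (γ t : E3) (deriv (deriv c) t) = -‖deriv c t‖ ^ 2 :=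
    inner_deriv_deriv_self hc t
  have hexp := eq_sum_tangentEmb (γ t) (deriv c t)
  have hnorm := sum_inner_tangentEmb_sq (γ t) (deriv c t)
  rw [hcc'] at hexp hnorm
  have hεc : ∀ k, inner ℝ (ε k) (γ t : E3) = 0 := fun k => by
    rw [real_inner_comm]; exact inner_tangentEmb_self _ _
  have hgy : inner ℝ (gradient v (γ t)) (deriv c t) =
      ∑ i, inner ℝ (ε i) (deriv c t) * inner ℝ (gradient v (γ t)) (ε i) := by
    conv_lhs => rw [hexp]
    simp [inner_add_right, inner_smul_right, hε]
  have key : ∀ k, inner ℝ (ε k) (deriv (deriv c) t - geoField v (γ t) (deriv c t)) =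
      inner ℝ (ε k) (deriv (deriv c) t)
        + 2 * inner ℝ (gradient v (γ t)) (deriv c t) * inner ℝ (ε k) (deriv c t)
        - ‖deriv c t‖ ^ 2 * inner ℝ (gradient v (γ t)) (ε k) := by
    intro k
    rw [real_inner_comm (ε k) (gradient v (γ t))]
    simp [geoField, inner_sub_right, inner_add_right, inner_smul_right, hεc]
    ring
  have hself : inner ℝ (γ t : E3) (deriv (deriv c) t - geoField v (γ t) (deriv c t)) = 0 := by
    have h1 : inner ℝ (γ t : E3) (γ t : E3) = (1 : ℝ) := by simp
    have h2 : inner ℝ (γ t : E3) (gradient v (γ t)) = inner ℝ (gradient v (γ t)) (γ t : E3) :=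
      real_inner_comm _ _
    simp only [geoField, inner_sub_right, inner_add_right, inner_smul_right, hcc'', h1, h2, hcc']
    ring
  rw [← sub_eq_zero (a := deriv (deriv c) t)]
  constructor
  · intro h
    rw [eq_sum_tangentEmb (γ t) (deriv (deriv c) t - geoField v (γ t) (deriv c t)), hself]
    have h4 : ∀ k, inner ℝ (ε k) (deriv (deriv c) t - geoField v (γ t) (deriv c t)) = 0 := by
      intro k
      rw [key, hgy]
      have := h k
      rw [Fin.sum_univ_two] at this hnorm ⊢
      fin_cases k <;> simp at this ⊢
      · linear_combination this + fderiv ℝ v (γ t) (ε 0) * hnorm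
      · linear_combination this + fderiv ℝ v (γ t) (ε 1) * hnorm
    rw [zero_smul, zero_add]
    exact Finset.sum_eq_zero fun k _ => (congrArg (· • ε k) (h4 k)).trans (zero_smul _ _)
  · intro h k
    have h4 := key k
    rw [h, inner_zero_right, hgy] at h4
    simp only [Fin.sum_univ_two] at h4 hnorm ⊢
    fin_cases k <;> simp at h4 ⊢
    · linear_combination -h4 - fderiv ℝ v (γ t) (ε 0) * hnorm
    · linear_combination -h4 - fderiv ℝ v (γ t) (ε 1) * hnorm

theorem speed_confMetric {v : E3 → ℝ} (hv : ContDiff ℝ ∞ v)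
    (hc : ContDiff ℝ ∞ (fun t => (γ t : E3))) (t : ℝ) :
    speed (confMetric v hv) γ t = Real.exp (v (γ t)) * ‖deriv (fun t => (γ t : E3)) t‖ := by
  have h1 : MDifferentiableAt 𝓘(ℝ) (𝓡 2) γ t := (contDiff_coe_comp.1 hc).mdifferentiable (by simp) t
  have h2 : MDifferentiableAt (𝓡 2) 𝓘(ℝ, E3) (fun x : S2 => (x : E3)) (γ t) :=
    contMDiff_coe.mdifferentiable (by simp) _
  have h3 := mfderiv_comp t h2 h1
  have h4 : dcoe (γ t) (mfderiv 𝓘(ℝ) (𝓡 2) γ t (1 : ℝ)) = deriv (fun t => (γ t : E3)) t := by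
    rw [← fderiv_apply_one_eq_deriv, ← mfderiv_eq_fderiv]
    exact (congrArg (fun f => f (1 : ℝ)) h3).symm
  rw [speed]
  erw [confMetric_inner, h4]
  rw [real_inner_self_eq_norm_sq, two_mul, Real.exp_add, ← sq, ← mul_pow, Real.sqrt_sq]
  positivity

end Curve

/-! ### The lattice -/

theorem sqrt_three_pos : 0 < Real.sqrt 3 := Real.sqrt_pos.2 (by norm_num)

theorem omega_linearIndependent : LinearIndependent ℝ ![omega₁, omega₂] := by
  rw [LinearIndependent.pair_iff]
  intro s t h
  have h3 := sqrt_three_pos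
  rw [omega₁_eq, omega₂_eq] at h
  have hre := congrArg Complex.re h
  have him := congrArg Complex.im h
  simp at hre him
  have h4 : (t - s) * Real.sqrt 3 = 0 := by linarith
  have h5 : t = s := by
    rcases mul_eq_zero.1 h4 with h | h
    · linarith
    · exact absurd h h3.ne'
  constructor <;> linarith

/-- The generators of the hexagonal lattice as a pair of periods. -/
noncomputable def hexPeriods : PeriodPair := ⟨omega₁, omega₂, omega_linearIndependent⟩

theorem mem_lattice_iff {z : ℂ} :
    z ∈ lattice ↔ ∃ m n : ℤ, z = (m : ℂ) * omega₁ + n * omega₂ := by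
  rw [lattice, AddSubgroup.mem_closure_pair]
  simp [eq_comm]

theorem mem_hexPeriods_lattice {z : ℂ} : z ∈ hexPeriods.lattice ↔ z ∈ lattice := by
  rw [PeriodPair.mem_lattice, mem_lattice_iff]
  simp [hexPeriods, eq_comm]

theorem zeta_pow_three : zeta ^ 3 = 1 := by
  rw [zeta, ← Complex.exp_nat_mul, ← Complex.exp_two_pi_mul_I]
  congr 1
  push_cast
  ring

theorem zeta_ne_zero : zeta ≠ 0 := Complex.exp_ne_zero _

theorem norm_zeta : ‖zeta‖ = 1 := by
  have h : (2 * Real.pi * Complex.I / 3 : ℂ) = ((2 * Real.pi / 3 : ℝ) : ℂ) * Complex.I := by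
    push_cast; ring
  rw [zeta, h, Complex.norm_exp_ofReal_mul_I]

theorem zeta_ne_one : zeta ≠ 1 := by
  intro h
  have := congrArg Complex.re h
  rw [zeta_eq] at this
  simp at this
  norm_num at this

theorem one_add_zeta_add_sq : 1 + zeta + zeta ^ 2 = 0 := by
  have h : (zeta - 1) * (1 + zeta + zeta ^ 2) = 0 := by
    linear_combination zeta_pow_three
  exact (mul_eq_zero.1 h).resolve_left (sub_ne_zero.2 zeta_ne_one)

theorem zeta_mul_mem_lattice {z : ℂ} : zeta * z ∈ lattice ↔ z ∈ lattice := by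
  conv_lhs => rw [← map_lattice]
  constructor
  · rintro ⟨w, hw, h⟩
    change zeta * w = zeta * z at h
    rwa [← mul_left_cancel₀ zeta_ne_zero h]
  · intro h
    exact ⟨z, h, rfl⟩

theorem zeta_pow_mul_mem_lattice (k : ℕ) {z : ℂ} : zeta ^ k * z ∈ lattice ↔ z ∈ lattice := by
  induction k with
  | zero => simp
  | succ k ih => rw [pow_succ', mul_assoc, zeta_mul_mem_lattice, ih]

theorem torusRotation_pow_coe (k : ℕ) (z : ℂ) :
    (torusRotation ^ k) (z : Torus) = ((zeta ^ k * z : ℂ) : Torus) := by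
  induction k with
  | zero => simp
  | succ k ih =>
    rw [pow_succ', Equiv.Perm.mul_apply, ih, pow_succ', mul_assoc]
    rfl

theorem torusRotation_pow_three : torusRotation ^ 3 = 1 := by
  ext z
  induction z using QuotientAddGroup.induction_on with
  | H z => rw [torusRotation_pow_coe, zeta_pow_three]; simp

/-- Two points of the plane have the same image if and only if they differ by a rotation about the
origin of order three followed by a translation of the lattice. -/
theorem proj_eq_iff {z w : ℂ} : proj z = proj w ↔ ∃ k : ℕ, k < 3 ∧ zeta ^ k * w - z ∈ lattice := by
  rw [proj, proj, Quotient.eq]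
  change (z : Torus) ∈ MulAction.orbit rotationGroup (w : Torus) ↔ _
  constructor
  · rintro ⟨⟨g, hg⟩, h⟩
    obtain ⟨n, rfl⟩ := Subgroup.mem_zpowers_iff.1 hg
    have hfin : IsOfFinOrder torusRotation :=
      isOfFinOrder_iff_pow_eq_one.2 ⟨3, by norm_num, torusRotation_pow_three⟩
    refine ⟨(n % 3).toNat, by omega, ?_⟩
    have h1 : torusRotation ^ n = torusRotation ^ (n % 3).toNat := by
      rw [← zpow_natCast, Int.toNat_of_nonneg (by omega)]
      conv_lhs => rw [← Int.emod_add_mul_ediv n 3, zpow_add, zpow_mul]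
      have : torusRotation ^ (3 : ℤ) = 1 := by exact_mod_cast torusRotation_pow_three
      rw [this, one_zpow, mul_one]
    change (torusRotation ^ n) (w : Torus) = (z : Torus) at h
    rw [h1, torusRotation_pow_coe, QuotientAddGroup.eq] at h
    rw [← neg_mem_iff]
    convert h using 1
    ring
  · rintro ⟨k, -, h⟩
    refine ⟨⟨torusRotation ^ k, k, by simp⟩, ?_⟩
    change (torusRotation ^ k) (w : Torus) = (z : Torus)
    rw [torusRotation_pow_coe, QuotientAddGroup.eq, ← neg_mem_iff]
    convert h using 1
    ring

theorem proj_add_mem {l : ℂ} (z : ℂ) (hl : l ∈ lattice) : proj (z + l) = proj z :=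
  proj_eq_iff.2 ⟨0, by norm_num, by simpa using hl⟩

theorem proj_zeta_mul (z : ℂ) : proj (zeta * z) = proj z :=
  proj_eq_iff.2 ⟨1, by norm_num, by simp [lattice.zero_mem]⟩

theorem proj_surjective : Function.Surjective proj := by
  intro p
  induction p using Quotient.inductionOn with
  | h t => induction t using QuotientAddGroup.induction_on with
    | H z => exact ⟨z, rfl⟩

theorem continuous_proj : Continuous proj :=
  continuous_quotient_mk'.comp continuous_quotient_mk'

/-! ### The Weierstrass functions of the hexagonal lattice -/

local notation "wp" => PeriodPair.weierstrassP hexPeriods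
local notation "wp'" => PeriodPair.derivWeierstrassP hexPeriods

/-- Multiplication by `ζ` as a permutation of the lattice. -/
noncomputable def latticeRotation : hexPeriods.lattice ≃ hexPeriods.lattice where
  toFun l := ⟨zeta * l, mem_hexPeriods_lattice.2
    (zeta_mul_mem_lattice.2 (mem_hexPeriods_lattice.1 l.2))⟩
  invFun l := ⟨zeta⁻¹ * l, mem_hexPeriods_lattice.2 (zeta_mul_mem_lattice.1 (by
    rw [mul_inv_cancel_left₀ zeta_ne_zero]; exact mem_hexPeriods_lattice.1 l.2))⟩
  left_inv l := by simp [inv_mul_cancel_left₀ zeta_ne_zero]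
  right_inv l := by simp [mul_inv_cancel_left₀ zeta_ne_zero]

/-- `℘` is homogeneous of degree `-2` under the rotation, which permutes the lattice. -/
theorem wp_zeta_mul (z : ℂ) : wp (zeta * z) = zeta * wp z := by
  rw [PeriodPair.weierstrassP, PeriodPair.weierstrassP, ← latticeRotation.tsum_eq, ← tsum_mul_left]
  congr 1
  funext l
  have h : (zeta ^ 2)⁻¹ = zeta := by
    refine inv_eq_of_mul_eq_one_right ?_
    rw [← zeta_pow_three]; ring
  simp only [latticeRotation, Equiv.coe_fn_mk, one_div]
  rw [← mul_sub, mul_pow, mul_pow, mul_inv, mul_inv, h]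
  ring

theorem wp'_zeta_mul (z : ℂ) : wp' (zeta * z) = wp' z := by
  rw [PeriodPair.derivWeierstrassP, PeriodPair.derivWeierstrassP, ← latticeRotation.tsum_eq]
  congr 2
  funext l
  simp only [latticeRotation, Equiv.coe_fn_mk]
  rw [← mul_sub, mul_pow, zeta_pow_three, one_mul]

/-- `g₂` is homogeneous of degree `-4` under the rotation, which permutes the lattice. -/
theorem g₂_hexPeriods : hexPeriods.g₂ = 0 := by
  have h : hexPeriods.G 4 = zeta ^ 2 * hexPeriods.G 4 := by
    conv_lhs => rw [PeriodPair.G, ← latticeRotation.tsum_eq]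
    rw [PeriodPair.G, ← tsum_mul_left]
    congr 1
    funext l
    have h : (zeta ^ 4)⁻¹ = zeta ^ 2 := by
      refine inv_eq_of_mul_eq_one_right ?_
      linear_combination (zeta_pow_three) * (zeta ^ 3 + 1)
    simp only [latticeRotation, Equiv.coe_fn_mk]
    rw [mul_pow, mul_inv, h]
  have h2 : (1 - zeta ^ 2) * hexPeriods.G 4 = 0 := by linear_combination h
  have h3 : (1 - zeta ^ 2) ≠ 0 := by
    intro h
    apply zeta_ne_one
    linear_combination zeta * h + zeta_pow_three
  rw [PeriodPair.g₂, (mul_eq_zero.1 h2).resolve_left h3, mul_zero]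

theorem wp'_sq {z : ℂ} (hz : z ∉ lattice) : wp' z ^ 2 = 4 * wp z ^ 3 - hexPeriods.g₃ := by
  have h := PeriodPair.derivWeierstrassP_sq hexPeriods z (fun h => hz (mem_hexPeriods_lattice.1 h))
  rw [g₂_hexPeriods] at h
  simpa using h

theorem isClosed_lattice : IsClosed (lattice : Set ℂ) := by
  have h : (lattice : Set ℂ) = hexPeriods.lattice := by
    ext z; exact mem_hexPeriods_lattice.symm
  rw [h]
  exact hexPeriods.isClosed_lattice

theorem countable_lattice : (lattice : Set ℂ).Countable := by
  have h : (lattice : Set ℂ) = range fun p : ℤ × ℤ => (p.1 : ℂ) * omega₁ + p.2 * omega₂ := by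
    ext z
    simp [mem_lattice_iff, eq_comm]
  rw [h]
  exact countable_range _

theorem analyticOnNhd_wp : AnalyticOnNhd ℂ wp (lattice : Set ℂ)ᶜ := fun z hz =>
  PeriodPair.analyticOnNhd_weierstrassP hexPeriods z (fun h => hz (mem_hexPeriods_lattice.1 h))

theorem analyticOnNhd_wp' : AnalyticOnNhd ℂ wp' (lattice : Set ℂ)ᶜ := fun z hz =>
  PeriodPair.analyticOnNhd_derivWeierstrassP hexPeriods z (fun h => hz (mem_hexPeriods_lattice.1 h))

theorem hasDerivAt_wp {z : ℂ} (hz : z ∉ lattice) : HasDerivAt wp (wp' z) z := by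
  rw [← PeriodPair.deriv_weierstrassP]
  exact (analyticOnNhd_wp z hz).differentiableAt.hasDerivAt

open Filter Topology in
theorem tendsto_wp {l : ℂ} (hl : l ∈ lattice) :
    Tendsto wp (𝓝[≠] l) (Bornology.cobounded ℂ) := by
  rw [tendsto_cobounded_iff_meromorphicOrderAt_neg (hexPeriods.meromorphic_weierstrassP l),
    PeriodPair.order_weierstrassP _ _ (mem_hexPeriods_lattice.2 hl)]
  decide

theorem isPreconnected_compl_of_countable {s : Set ℂ} (hs : s.Countable) : IsPreconnected sᶜ :=
  (hs.isPathConnected_compl_of_one_lt_rank (by simp)).isConnected.isPreconnected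

open Filter Topology in
theorem eventually_notMem_lattice (l : ℂ) : ∀ᶠ z in 𝓝[≠] l, z ∉ lattice := by
  filter_upwards [nhdsWithin_le_nhds (hexPeriods.compl_lattice_sdiff_singleton_mem_nhds l),
    self_mem_nhdsWithin] with z h1 h2 h3
  exact h1 ⟨mem_hexPeriods_lattice.2 h3, h2⟩

open Filter Topology in
theorem tendsto_wp' {l : ℂ} (hl : l ∈ lattice) :
    Tendsto wp' (𝓝[≠] l) (Bornology.cobounded ℂ) := by
  rw [← tendsto_norm_atTop_iff_cobounded]
  have h1 := tendsto_norm_atTop_iff_cobounded.2 (tendsto_wp hl)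
  rw [tendsto_atTop] at h1 ⊢
  intro b
  filter_upwards [h1 (1 + |b| ^ 2 + ‖hexPeriods.g₃‖), eventually_notMem_lattice l] with z hz hzl
  have h2 : ‖wp' z‖ ^ 2 ≥ 4 * ‖wp z‖ ^ 3 - ‖hexPeriods.g₃‖ := by
    rw [← norm_pow, wp'_sq hzl]
    refine le_trans ?_ (norm_sub_norm_le _ _)
    simp
  have h3 : 0 ≤ ‖hexPeriods.g₃‖ := norm_nonneg _
  have h4 : ‖wp z‖ ≤ ‖wp z‖ ^ 3 := le_self_pow₀ (by nlinarith [sq_nonneg |b|]) (by norm_num)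
  have h5 : |b| ^ 2 ≤ ‖wp' z‖ ^ 2 := by nlinarith [sq_nonneg |b|]
  exact (le_abs_self b).trans ((sq_le_sq₀ (abs_nonneg b) (norm_nonneg _)).1 h5)

open Filter Topology in
/-- A function with a pole at the origin is not constant. -/
theorem not_eqOn_const_of_tendsto_cobounded {f : ℂ → ℂ}
    (hf : Tendsto f (𝓝[≠] 0) (Bornology.cobounded ℂ)) (c : ℂ) :
    ¬ ∀ z ∈ (lattice : Set ℂ)ᶜ, f z = c := by
  intro h
  have h1 : Tendsto f (𝓝[≠] 0) (𝓝 c) :=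
    tendsto_const_nhds.congr' (by
      filter_upwards [eventually_notMem_lattice 0] with z hz
      exact (h z hz).symm)
  exact h1.not_tendsto (Metric.disjoint_nhds_cobounded c) hf

/-- The differential equation `℘'' = 6 ℘²` of the hexagonal lattice. -/
theorem hasDerivAt_wp' {z : ℂ} (hz : z ∉ lattice) : HasDerivAt wp' (6 * wp z ^ 2) z := by
  have hU : IsOpen (lattice : Set ℂ)ᶜ := isClosed_lattice.isOpen_compl
  have hd : ∀ z ∉ lattice, HasDerivAt wp' (deriv wp' z) z := fun z hz =>
    (analyticOnNhd_wp' z hz).differentiableAt.hasDerivAt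
  have h1 : ∀ z ∈ (lattice : Set ℂ)ᶜ, wp' z * (deriv wp' z - 6 * wp z ^ 2) = 0 := by
    intro z hz
    have e1 := (hd z hz).pow 2
    have e2 := (((hasDerivAt_wp hz).pow 3).const_mul 4).sub_const hexPeriods.g₃
    have e3 := e1.unique (e2.congr_of_eventuallyEq (by
      filter_upwards [hU.mem_nhds hz] with w hw
      exact wp'_sq hw))
    simp at e3
    linear_combination (1 / 2 : ℂ) * e3
  have ha : AnalyticOnNhd ℂ (fun z => deriv wp' z - 6 * wp z ^ 2) (lattice : Set ℂ)ᶜ :=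
    analyticOnNhd_wp'.deriv.sub (analyticOnNhd_const.mul (analyticOnNhd_wp.pow 2))
  rcases AnalyticOnNhd.eq_zero_or_eq_zero_of_mul_eq_zero analyticOnNhd_wp' ha h1
    (isPreconnected_compl_of_countable countable_lattice) with h | h
  · exact absurd h (not_eqOn_const_of_tendsto_cobounded (tendsto_wp' lattice.zero_mem) 0)
  · rw [← sub_eq_zero.1 (h z hz)]
    exact hd z hz

open Filter Topology in
/-- By uniqueness for `℘'' = 6 ℘²`, two points with the same values of `℘` and `℘'` differ by a
period, hence by an element of the lattice. -/
theorem sub_mem_lattice_of_wp_eq {z₀ z₁ : ℂ} (h₀ : z₀ ∉ lattice) (h₁ : z₁ ∉ lattice)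
    (h : wp z₀ = wp z₁) (h' : wp' z₀ = wp' z₁) : z₁ - z₀ ∈ lattice := by
  have hU : IsOpen (lattice : Set ℂ)ᶜ := isClosed_lattice.isOpen_compl
  -- equality along a real segment
  have hreal : ∀ᶠ t : ℝ in 𝓝 0, wp (z₀ + t) = wp (z₁ + t) := by
    set V : ℂ × ℂ → ℂ × ℂ := fun x => (x.2, 6 * x.1 ^ 2) with hV
    have hVC : ContDiff ℝ 1 V := by fun_prop
    obtain ⟨K, s, hs, hK⟩ := hVC.contDiffAt.exists_lipschitzOnWith (x := (wp z₀, wp' z₀))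
    have key : ∀ w, w ∉ lattice → (wp w, wp' w) = (wp z₀, wp' z₀) → ∀ᶠ t : ℝ in 𝓝 0,
        HasDerivAt (fun t : ℝ => (wp (w + t), wp' (w + t))) (V (wp (w + t), wp' (w + t))) t ∧
          (wp (w + t), wp' (w + t)) ∈ s := by
      intro w hw hwz
      have hc : Continuous fun t : ℝ => w + (t : ℂ) := by fun_prop
      have e1 : ∀ᶠ t : ℝ in 𝓝 0, w + (t : ℂ) ∉ lattice :=
        hc.continuousAt.preimage_mem_nhds (hU.mem_nhds (by simpa using hw))
      have e2 : ∀ᶠ t : ℝ in 𝓝 0, (wp (w + t), wp' (w + t)) ∈ s := by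
        have hc2 : ContinuousAt (fun t : ℝ => (wp (w + t), wp' (w + t))) 0 := by
          refine ContinuousAt.prodMk ?_ ?_
          · refine ContinuousAt.comp (g := wp) ?_ hc.continuousAt
            simpa using (analyticOnNhd_wp w hw).continuousAt
          · refine ContinuousAt.comp (g := wp') ?_ hc.continuousAt
            simpa using (analyticOnNhd_wp' w hw).continuousAt
        refine hc2.preimage_mem_nhds ?_
        simpa [hwz] using hs
      filter_upwards [e1, e2] with t ht1 ht2
      refine ⟨?_, ht2⟩
      have hd : HasDerivAt (fun t : ℝ => w + (t : ℂ)) 1 t :=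
        (Complex.ofRealCLM.hasDerivAt (x := t)).const_add w
      have d1 := (hasDerivAt_wp ht1).scomp t hd
      have d2 := (hasDerivAt_wp' ht1).scomp t hd
      simpa [hV] using d1.prodMk d2
    have := ODE_solution_unique_of_eventually (t₀ := (0 : ℝ)) (v := fun _ => V) (s := fun _ => s)
      (Eventually.of_forall fun _ => hK) (key z₀ h₀ rfl) (key z₁ h₁ (by rw [h, h']))
      (by simp [h, h'])
    filter_upwards [this] with t ht
    exact congrArg Prod.fst ht
  -- hence everywhere
  set U : Set ℂ := ((fun z => z - z₀) '' lattice ∪ (fun z => z - z₁) '' lattice)ᶜ with hUdef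
  have hmem : ∀ t ∈ U, z₀ + t ∉ lattice ∧ z₁ + t ∉ lattice := by
    intro t ht
    rw [hUdef, mem_compl_iff, mem_union, not_or] at ht
    exact ⟨fun h => ht.1 ⟨_, h, by ring⟩, fun h => ht.2 ⟨_, h, by ring⟩⟩
  have hUc : IsPreconnected U := isPreconnected_compl_of_countable
    ((countable_lattice.image _).union (countable_lattice.image _))
  have ha : ∀ w, (∀ t ∈ U, w + t ∉ lattice) → AnalyticOnNhd ℂ (fun t => wp (w + t)) U := by
    intro w hw t ht
    exact (analyticOnNhd_wp _ (hw t ht)).comp (f := fun t => w + t)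
      (analyticAt_const.add analyticAt_id)
  have ha0 := ha z₀ fun t ht => (hmem t ht).1
  have ha1 := ha z₁ fun t ht => (hmem t ht).2
  have h0U : (0 : ℂ) ∈ U := by
    rw [hUdef, mem_compl_iff, mem_union, not_or]
    constructor
    · rintro ⟨z, hz, hz2⟩
      rw [sub_eq_zero] at hz2
      exact h₀ (hz2 ▸ hz)
    · rintro ⟨z, hz, hz2⟩
      rw [sub_eq_zero] at hz2
      exact h₁ (hz2 ▸ hz)
  have hfreq : ∃ᶠ t in 𝓝[≠] (0 : ℂ), wp (z₀ + t) = wp (z₁ + t) := by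
    have ht : Tendsto (fun t : ℝ => (t : ℂ)) (𝓝[≠] 0) (𝓝[≠] 0) := by
      refine tendsto_nhdsWithin_iff.2 ⟨?_, ?_⟩
      · exact (Complex.continuous_ofReal.tendsto' 0 0 (by simp)).mono_left nhdsWithin_le_nhds
      · filter_upwards [self_mem_nhdsWithin] with t ht
        simpa using ht
    exact ht.frequently (hreal.filter_mono nhdsWithin_le_nhds).frequently
  have heq := ha0.eqOn_of_preconnected_of_frequently_eq ha1 hUc h0U hfreq
  -- otherwise `℘` would be bounded near its pole `0`, where it agrees with a translate of itself
  by_contra hd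
  have hneg : ∀ᶠ s in 𝓝[≠] (0 : ℂ), wp s = wp (z₁ - z₀ + s) := by
    have e2 : ∀ᶠ s in 𝓝[≠] (0 : ℂ), z₁ - z₀ + s ∉ lattice := by
      have hc : Continuous fun s : ℂ => z₁ - z₀ + s := by fun_prop
      exact nhdsWithin_le_nhds (hc.continuousAt.preimage_mem_nhds (hU.mem_nhds (by simpa using hd)))
    filter_upwards [eventually_notMem_lattice 0, e2] with s hs hs2
    have hsU : s - z₀ ∈ U := by
      rw [hUdef, mem_compl_iff, mem_union, not_or]
      constructor
      · rintro ⟨z, hz, hz2⟩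
        exact hs (sub_left_inj.1 hz2 ▸ hz)
      · rintro ⟨z, hz, hz2⟩
        refine hs2 ?_
        have : z₁ - z₀ + s = z := by linear_combination -hz2
        exact this ▸ hz
    have := heq hsU
    simp only at this
    rw [show z₀ + (s - z₀) = s by ring, show z₁ + (s - z₀) = z₁ - z₀ + s by ring] at this
    exact this
  have hlim : Tendsto wp (𝓝[≠] 0) (𝓝 (wp (z₁ - z₀))) := by
    have hc : ContinuousAt (fun s : ℂ => wp (z₁ - z₀ + s)) 0 := by
      refine ContinuousAt.comp (g := wp) ?_ (by fun_prop)
      simpa using (analyticOnNhd_wp _ hd).continuousAt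
    have : Tendsto (fun s : ℂ => wp (z₁ - z₀ + s)) (𝓝[≠] 0) (𝓝 (wp (z₁ - z₀))) := by
      simpa using hc.tendsto.mono_left nhdsWithin_le_nhds
    exact this.congr' (hneg.mono fun s hs => hs.symm)
  exact hlim.not_tendsto (Metric.disjoint_nhds_cobounded _) (tendsto_wp lattice.zero_mem)

theorem wp_zeta_pow_mul (k : ℕ) (z : ℂ) : wp (zeta ^ k * z) = zeta ^ k * wp z := by
  induction k with
  | zero => simp
  | succ k ih => rw [pow_succ', mul_assoc, wp_zeta_mul, ih]; ring

theorem wp'_zeta_pow_mul (k : ℕ) (z : ℂ) : wp' (zeta ^ k * z) = wp' z := by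
  induction k with
  | zero => simp
  | succ k ih => rw [pow_succ', mul_assoc, wp'_zeta_mul, ih]

theorem exists_zeta_pow_mul_of_pow_three_eq {x y : ℂ} (h : x ^ 3 = y ^ 3) :
    ∃ k < 3, x = zeta ^ k * y := by
  have h1 : (x - y) * ((x - zeta * y) * (x - zeta ^ 2 * y)) = 0 := by
    linear_combination h + (-x ^ 2 * y + x * y ^ 2 * zeta) * one_add_zeta_add_sq
      - y ^ 3 * zeta_pow_three
  rcases mul_eq_zero.1 h1 with h | h
  · exact ⟨0, by norm_num, by linear_combination h⟩
  · rcases mul_eq_zero.1 h with h | h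
    · exact ⟨1, by norm_num, by linear_combination h⟩
    · exact ⟨2, by norm_num, by linear_combination h⟩

/-- `℘'` separates the points of the quotient. -/
theorem proj_eq_of_wp'_eq {z₀ z₁ : ℂ} (h₀ : z₀ ∉ lattice) (h₁ : z₁ ∉ lattice)
    (h : wp' z₀ = wp' z₁) : proj z₀ = proj z₁ := by
  have h3 : wp z₀ ^ 3 = wp z₁ ^ 3 := by
    have e0 := wp'_sq h₀
    have e1 := wp'_sq h₁
    rw [h, e1] at e0
    linear_combination -(1 / 4 : ℂ) * e0
  obtain ⟨k, hk, hkz⟩ := exists_zeta_pow_mul_of_pow_three_eq h3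
  have h4 := sub_mem_lattice_of_wp_eq h₀ (z₁ := zeta ^ k * z₁)
    (fun h => h₁ ((zeta_pow_mul_mem_lattice k).1 h)) (by rw [wp_zeta_pow_mul, hkz])
    (by rw [wp'_zeta_pow_mul, h])
  exact proj_eq_iff.2 ⟨k, hk, h4⟩

theorem wp'_eq_of_proj_eq {z₀ z₁ : ℂ} (h : proj z₀ = proj z₁) : wp' z₀ = wp' z₁ := by
  obtain ⟨k, -, hk⟩ := proj_eq_iff.1 h
  have h1 := PeriodPair.derivWeierstrassP_add_coe hexPeriods z₀ ⟨_, mem_hexPeriods_lattice.2 hk⟩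
  rw [← h1, ← wp'_zeta_pow_mul k z₁]
  congr 1
  ring

theorem wp_add_lattice (z : ℂ) {l : ℂ} (hl : l ∈ lattice) : wp (z + l) = wp z :=
  PeriodPair.weierstrassP_add_coe hexPeriods z ⟨l, mem_hexPeriods_lattice.2 hl⟩

theorem mem_lattice_congr {z₀ z₁ : ℂ} (h : proj z₀ = proj z₁) : z₀ ∈ lattice ↔ z₁ ∈ lattice := by
  obtain ⟨k, -, hk⟩ := proj_eq_iff.1 h
  rw [← zeta_pow_mul_mem_lattice k (z := z₁)]
  constructor
  · intro h
    simpa using lattice.add_mem hk h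
  · intro h
    simpa using lattice.sub_mem h hk

/-! ### The cone points and the normalised uniformising function -/

/-- The second cone point `2 e^{πi/3}` in Cartesian coordinates. -/
theorem two_mul_exp_eq :
    2 * Complex.exp (Real.pi * Complex.I / 3) = 1 + (Real.sqrt 3 : ℂ) * Complex.I := by
  have h : (Real.pi * Complex.I / 3 : ℂ) = ((Real.pi / 3 : ℝ) : ℂ) * Complex.I := by
    push_cast; ring
  rw [h, Complex.exp_mul_I, ← Complex.ofReal_cos, ← Complex.ofReal_sin,
    Real.cos_pi_div_three, Real.sin_pi_div_three]
  push_cast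
  ring

theorem int_coords_of_mem_lattice {z : ℂ} (hz : z ∈ lattice) :
    ∃ m n : ℤ, z.re = 3 * (m + n) ∧ z.im = Real.sqrt 3 * (n - m) := by
  obtain ⟨m, n, rfl⟩ := mem_lattice_iff.1 hz
  refine ⟨m, n, ?_, ?_⟩
  · rw [omega₁_eq, omega₂_eq]; simp; ring
  · rw [omega₁_eq, omega₂_eq]; simp; ring

theorem notMem_lattice_of_re {z : ℂ} (n : ℤ) (hz : z.re = n) (hn : n % 3 ≠ 0) : z ∉ lattice := by
  intro h
  obtain ⟨m, k, h1, -⟩ := int_coords_of_mem_lattice h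
  rw [hz] at h1
  have : n = 3 * (m + k) := by exact_mod_cast h1
  omega

theorem two_notMem_lattice : (2 : ℂ) ∉ lattice := notMem_lattice_of_re 2 (by simp) (by norm_num)

theorem omega₁_mem : omega₁ ∈ lattice := AddSubgroup.subset_closure (by simp)

theorem omega₂_mem : omega₂ ∈ lattice := AddSubgroup.subset_closure (by simp)

/-- The rotation fixes the class of `2` modulo the lattice and multiplies `℘` by `ζ`. -/
theorem wp_two : wp 2 = 0 := by
  have h1 : zeta * 2 = 2 + -omega₁ := by
    rw [zeta_eq, omega₁_eq]; ring
  have h2 := wp_zeta_mul 2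
  rw [h1, wp_add_lattice _ (lattice.neg_mem omega₁_mem)] at h2
  have h3 : (1 - zeta) * wp 2 = 0 := by linear_combination h2
  exact (mul_eq_zero.1 h3).resolve_left (sub_ne_zero.2 zeta_ne_one.symm)

theorem proj_zero_eq_iff {z : ℂ} : proj z = proj 0 ↔ z ∈ lattice := by
  constructor
  · intro h
    exact (mem_lattice_congr h).2 lattice.zero_mem
  · intro h
    simpa using proj_add_mem 0 h

theorem proj_neg_two : proj (2 * Complex.exp (Real.pi * Complex.I / 3)) = proj (-2) := by
  rw [two_mul_exp_eq, ← proj_add_mem (-2) omega₂_mem, omega₂_eq]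
  congr 1
  ring

theorem proj_two_ne_proj_neg_two : proj 2 ≠ proj (-2) := by
  intro h
  obtain ⟨k, hk, h⟩ := proj_eq_iff.1 h
  interval_cases k
  · exact notMem_lattice_of_re (-4) (by simp; norm_num) (by norm_num) h
  · refine notMem_lattice_of_re (-1) ?_ (by norm_num) h
    simp [zeta_eq]; norm_num
  · have h2 : zeta ^ 2 = -1 - zeta := by linear_combination one_add_zeta_add_sq
    refine notMem_lattice_of_re (-1) ?_ (by norm_num) h
    rw [h2]
    simp [zeta_eq]; norm_num

/-- The second and the third cone point are the images of `2` and `-2`; the real parts of lattice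
points are multiples of `3`. -/
theorem conePoint_injective : Function.Injective conePoint := by
  have h0 : proj 0 ≠ proj 2 := fun h => two_notMem_lattice (proj_zero_eq_iff.1 h.symm)
  have h1 : proj 0 ≠ proj (-2) := fun h =>
    two_notMem_lattice (by simpa using lattice.neg_mem (proj_zero_eq_iff.1 h.symm))
  have h2 := proj_two_ne_proj_neg_two
  intro i j h
  fin_cases i <;> fin_cases j <;> simp [conePoint, proj_neg_two] at h ⊢ <;>
    first
      | exact h0 h | exact h0 h.symm | exact h1 h | exact h1 h.symm | exact h2 h | exact h2 h.symm

theorem mem_coneSet_iff {z : ℂ} :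
    z ∈ coneSet ↔ z ∈ lattice ∨ proj z = proj 2 ∨ proj z = proj (-2) := by
  simp only [coneSet, mem_preimage, mem_range, Fin.exists_fin_succ, conePoint]
  simp [proj_neg_two, ← proj_zero_eq_iff, eq_comm]

/-- The value of `℘'` at the cone point `2`. -/
noncomputable def coneValue : ℂ := wp' 2

theorem wp'_neg_two : wp' (-2) = -coneValue := PeriodPair.derivWeierstrassP_neg hexPeriods 2

theorem coneValue_ne_zero : coneValue ≠ 0 := by
  intro h
  refine proj_two_ne_proj_neg_two (proj_eq_of_wp'_eq two_notMem_lattice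
    (fun h => two_notMem_lattice (by simpa using lattice.neg_mem h)) ?_)
  rw [wp'_neg_two, ← coneValue, h, neg_zero]

/-- The differential equation of `℘` at the point `2`, where `℘` vanishes. -/
theorem g₃_hexPeriods : hexPeriods.g₃ = -coneValue ^ 2 := by
  have h := wp'_sq two_notMem_lattice
  rw [wp_two] at h
  rw [coneValue, h]
  ring

/-- The uniformising function `℘' / ℘'(2)`; it takes the values `1` and `-1` at the cone points
`2` and `2 e^{πi/3}`, and has its poles at the lattice. -/
noncomputable def unif (z : ℂ) : ℂ := wp' z / coneValue

/-- The differential equation `℘'² = 4 ℘³ - g₃` in terms of `unif`. -/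
theorem four_mul_wp_pow_three {z : ℂ} (hz : z ∉ lattice) :
    4 * wp z ^ 3 = coneValue ^ 2 * (unif z ^ 2 - 1) := by
  have h := wp'_sq hz
  have hb := coneValue_ne_zero
  rw [g₃_hexPeriods] at h
  rw [unif]
  field_simp
  linear_combination -h

/-- The derivative of `unif`. -/
noncomputable def unif' (z : ℂ) : ℂ := 6 * wp z ^ 2 / coneValue

theorem hasDerivAt_unif {z : ℂ} (hz : z ∉ lattice) : HasDerivAt unif (unif' z) z :=
  (hasDerivAt_wp' hz).div_const coneValue

/-- The second order equation satisfied by `unif`: `℘` is eliminated from `℘'' = 6 ℘²` by means of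
the first order equation. -/
theorem hasDerivAt_unif' {z : ℂ} (hz : z ∉ lattice) (hz2 : unif z ^ 2 ≠ 1) :
    HasDerivAt unif' (4 / 3 * (unif z / (unif z ^ 2 - 1)) * unif' z ^ 2) z := by
  have h := (((hasDerivAt_wp hz).pow 2).const_mul 6).div_const coneValue
  refine h.congr_deriv ?_
  have hb := coneValue_ne_zero
  have h3 := four_mul_wp_pow_three hz
  have h4 : unif z ^ 2 - 1 ≠ 0 := sub_ne_zero.2 hz2
  have h5 : wp' z = unif z * coneValue := by rw [unif]; field_simp
  rw [unif', h5]
  field_simp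
  simp
  linear_combination (-6 * unif z * wp z) * h3

theorem unif_eq_of_proj_eq {z₀ z₁ : ℂ} (h : proj z₀ = proj z₁) : unif z₀ = unif z₁ := by
  rw [unif, unif, wp'_eq_of_proj_eq h]

theorem proj_eq_of_unif_eq {z₀ z₁ : ℂ} (h₀ : z₀ ∉ lattice) (h₁ : z₁ ∉ lattice)
    (h : unif z₀ = unif z₁) : proj z₀ = proj z₁ := by
  refine proj_eq_of_wp'_eq h₀ h₁ ?_
  have hb := coneValue_ne_zero
  rw [unif, unif] at h
  field_simp at h
  exact h

theorem unif_two : unif 2 = 1 := div_self coneValue_ne_zero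

theorem unif_neg_two : unif (-2) = -1 := by
  rw [unif, wp'_neg_two, neg_div, div_self coneValue_ne_zero]

theorem unif_sq_ne_one {z : ℂ} (hz : z ∉ coneSet) : unif z ^ 2 ≠ 1 := by
  rw [mem_coneSet_iff, not_or, not_or] at hz
  intro h
  have h2 : (unif z - 1) * (unif z + 1) = 0 := by linear_combination h
  rcases mul_eq_zero.1 h2 with h3 | h3
  · refine hz.2.1 (proj_eq_of_unif_eq hz.1 two_notMem_lattice ?_)
    rw [unif_two]
    linear_combination h3
  · refine hz.2.2 (proj_eq_of_unif_eq hz.1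
      (fun h => two_notMem_lattice (by simpa using lattice.neg_mem h)) ?_)
    rw [unif_neg_two]
    linear_combination h3

theorem analyticOnNhd_unif : AnalyticOnNhd ℂ unif (lattice : Set ℂ)ᶜ :=
  analyticOnNhd_wp'.div analyticOnNhd_const fun _ _ => coneValue_ne_zero

open Filter Topology in
theorem tendsto_unif {l : ℂ} (hl : l ∈ lattice) :
    Tendsto unif (𝓝[≠] l) (Bornology.cobounded ℂ) := by
  rw [← tendsto_norm_atTop_iff_cobounded]
  have h1 := tendsto_norm_atTop_iff_cobounded.2 (tendsto_wp' hl)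
  simp only [unif, norm_div]
  exact h1.atTop_div_const (norm_pos_iff.2 coneValue_ne_zero)

/-! ### The Riemann sphere -/

/-- Inverse stereographic projection `ℂ → S²`, sending `0` to `basePoint`, `±1` to the second
coordinate axis and leaving out `-basePoint`. -/
noncomputable def stereo (W : ℂ) : E3 :=
  !₂[(1 - (W.re ^ 2 + W.im ^ 2)) / (1 + (W.re ^ 2 + W.im ^ 2)),
    2 * W.re / (1 + (W.re ^ 2 + W.im ^ 2)), 2 * W.im / (1 + (W.re ^ 2 + W.im ^ 2))]

/-- The differential of `stereo`. -/
noncomputable def dstereo (W w : ℂ) : E3 :=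
  !₂[-4 * (W.re * w.re + W.im * w.im) / (1 + (W.re ^ 2 + W.im ^ 2)) ^ 2,
    2 * w.re / (1 + (W.re ^ 2 + W.im ^ 2))
      - 4 * W.re * (W.re * w.re + W.im * w.im) / (1 + (W.re ^ 2 + W.im ^ 2)) ^ 2,
    2 * w.im / (1 + (W.re ^ 2 + W.im ^ 2))
      - 4 * W.im * (W.re * w.re + W.im * w.im) / (1 + (W.re ^ 2 + W.im ^ 2)) ^ 2]

theorem inner_E3 (x y : E3) : inner ℝ x y = x 0 * y 0 + x 1 * y 1 + x 2 * y 2 := by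
  simp [PiLp.inner_apply, Fin.sum_univ_three]
  ring

theorem one_add_sq_pos (W : ℂ) : 0 < 1 + (W.re ^ 2 + W.im ^ 2) := by positivity

theorem norm_stereo (W : ℂ) : ‖stereo W‖ = 1 := by
  have h : inner ℝ (stereo W) (stereo W) = (1 : ℝ) := by
    have := (one_add_sq_pos W).ne'
    rw [inner_E3]
    simp [stereo]
    field_simp
    ring
  rw [real_inner_self_eq_norm_sq] at h
  nlinarith [norm_nonneg (stereo W)]

/-- `stereo` as a map into the sphere. -/
noncomputable def stereoSphere (W : ℂ) : S2 := ⟨stereo W, by simp [norm_stereo]⟩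

theorem inner_dstereo (W v w : ℂ) : inner ℝ (dstereo W v) (dstereo W w) =
    4 / (1 + (W.re ^ 2 + W.im ^ 2)) ^ 2 * inner ℝ v w := by
  have := (one_add_sq_pos W).ne'
  rw [inner_E3, Complex.inner]
  simp [dstereo]
  field_simp
  ring

theorem contDiff_stereo : ContDiff ℝ ∞ stereo := by
  have h1 : ContDiff ℝ ∞ fun W : ℂ => W.re := Complex.reCLM.contDiff
  have h2 : ContDiff ℝ ∞ fun W : ℂ => W.im := Complex.imCLM.contDiff
  have h3 : ∀ W : ℂ, 1 + (W.re ^ 2 + W.im ^ 2) ≠ 0 := fun W => (one_add_sq_pos W).ne'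
  rw [contDiff_euclidean]
  intro i
  fin_cases i
  · exact ContDiff.div (by fun_prop) (by fun_prop) h3
  · exact ContDiff.div (by fun_prop) (by fun_prop) h3
  · exact ContDiff.div (by fun_prop) (by fun_prop) h3

theorem contMDiff_stereoSphere : ContMDiff 𝓘(ℝ, ℂ) (𝓡 2) ∞ stereoSphere := by
  have := Fact.mk (@finrank_euclideanSpace_fin ℝ _ (2 + 1))
  exact contDiff_stereo.contMDiff.codRestrict_sphere (n := 2) (fun W => by simp [norm_stereo])

theorem hasDerivAt_E3_of_apply {f : ℝ → E3} {f' : E3} {s : ℝ}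
    (h : ∀ i, HasDerivAt (fun s => f s i) (f' i) s) : HasDerivAt f f' s := by
  rw [hasDerivAt_iff_hasFDerivAt, ← hasFDerivWithinAt_univ, hasFDerivWithinAt_euclidean]
  intro i
  rw [hasFDerivWithinAt_univ]
  refine (h i).hasFDerivAt.congr_fderiv ?_
  ext
  simp

theorem hasDerivAt_re {W : ℝ → ℂ} {w : ℂ} {t : ℝ} (h : HasDerivAt W w t) :
    HasDerivAt (fun t => (W t).re) w.re t :=
  (Complex.reCLM.hasFDerivAt (x := W t)).comp_hasDerivAt t h

theorem hasDerivAt_im {W : ℝ → ℂ} {w : ℂ} {t : ℝ} (h : HasDerivAt W w t) :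
    HasDerivAt (fun t => (W t).im) w.im t :=
  (Complex.imCLM.hasFDerivAt (x := W t)).comp_hasDerivAt t h

theorem hasDerivAt_stereo {W : ℝ → ℂ} {w : ℂ} {t : ℝ} (h : HasDerivAt W w t) :
    HasDerivAt (fun t => stereo (W t)) (dstereo (W t) w) t := by
  have hx := hasDerivAt_re h
  have hy := hasDerivAt_im h
  have h0 := (one_add_sq_pos (W t)).ne'
  have hr : HasDerivAt (fun t => (W t).re ^ 2 + (W t).im ^ 2)
      (2 * ((W t).re * w.re + (W t).im * w.im)) t :=
    ((hx.pow 2).add (hy.pow 2)).congr_deriv (by simp; ring)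
  have hN := hr.const_add 1
  apply hasDerivAt_E3_of_apply
  intro i
  fin_cases i
  · refine ((hr.const_sub 1).fun_div hN h0).congr_deriv ?_
    simp [dstereo]
    field_simp
    ring
  · refine ((hx.const_mul 2).fun_div hN h0).congr_deriv ?_
    simp [dstereo]
    field_simp
    ring
  · refine ((hy.const_mul 2).fun_div hN h0).congr_deriv ?_
    simp [dstereo]
    field_simp
    ring

theorem fderiv_stereo (W v : ℂ) : fderiv ℝ stereo W v = dstereo W v := by
  have h1 : HasDerivAt (fun t : ℝ => W + t * v) v 0 := by
    simpa using ((Complex.ofRealCLM.hasDerivAt (x := (0 : ℝ))).mul_const v).const_add W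
  have h2 := hasDerivAt_stereo h1
  have h4 := ((contDiff_stereo.differentiable (by simp)) (W + (0 : ℝ) * v)).hasFDerivAt
  have h3 := h4.comp_hasDerivAt (0 : ℝ) h1
  simpa using h3.unique h2

/-- The second derivative of a curve in the sphere, in the stereographic coordinate: its tangential
part is given by the Levi-Civita connection of the round metric. -/
theorem hasDerivAt_dstereo {W w : ℝ → ℂ} {w' : ℂ} {t : ℝ} (h : HasDerivAt W (w t) t)
    (hw : HasDerivAt w w' t) :
    HasDerivAt (fun t => dstereo (W t) (w t))
      (-(‖dstereo (W t) (w t)‖ ^ 2) • stereo (W t)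
        + dstereo (W t) (w' - 2 * (starRingEnd ℂ (W t)
            / (1 + ((W t).re ^ 2 + (W t).im ^ 2) : ℝ)) * w t ^ 2)) t := by
  rw [← real_inner_self_eq_norm_sq, inner_dstereo, Complex.inner]
  have hx := hasDerivAt_re h
  have hy := hasDerivAt_im h
  have ha := hasDerivAt_re hw
  have hb := hasDerivAt_im hw
  have h0 := (one_add_sq_pos (W t)).ne'
  have h02 : (1 + ((W t).re ^ 2 + (W t).im ^ 2)) ^ 2 ≠ 0 := pow_ne_zero 2 h0
  have hr : HasDerivAt (fun t => (W t).re ^ 2 + (W t).im ^ 2)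
      (2 * ((W t).re * (w t).re + (W t).im * (w t).im)) t :=
    ((hx.pow 2).add (hy.pow 2)).congr_deriv (by simp; ring)
  have hN := hr.const_add 1
  have hq : HasDerivAt (fun t => (W t).re * (w t).re + (W t).im * (w t).im)
      ((w t).re ^ 2 + (w t).im ^ 2 + ((W t).re * w'.re + (W t).im * w'.im)) t :=
    ((hx.mul ha).add (hy.mul hb)).congr_deriv (by ring)
  have hre : (w' - 2 * (starRingEnd ℂ (W t)
            / (1 + ((W t).re ^ 2 + (W t).im ^ 2) : ℝ)) * w t ^ 2).re =
      w'.re - 2 * ((W t).re * ((w t).re ^ 2 - (w t).im ^ 2)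
        + (W t).im * (2 * (w t).re * (w t).im)) /
        (1 + ((W t).re ^ 2 + (W t).im ^ 2)) := by
    simp [Complex.div_re, Complex.div_im, pow_two, Complex.normSq_apply]
    field_simp
    ring
  have him : (w' - 2 * (starRingEnd ℂ (W t)
            / (1 + ((W t).re ^ 2 + (W t).im ^ 2) : ℝ)) * w t ^ 2).im =
      w'.im - 2 * ((W t).re * (2 * (w t).re * (w t).im)
        - (W t).im * ((w t).re ^ 2 - (w t).im ^ 2)) /
        (1 + ((W t).re ^ 2 + (W t).im ^ 2)) := by
    simp [Complex.div_re, Complex.div_im, pow_two, Complex.normSq_apply]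
    field_simp
    ring
  generalize w' - 2 * (starRingEnd ℂ (W t)
            / (1 + ((W t).re ^ 2 + (W t).im ^ 2) : ℝ)) * w t ^ 2 = e at hre him
  apply hasDerivAt_E3_of_apply
  intro i
  fin_cases i
  · refine ((hq.const_mul (-4)).fun_div (hN.fun_pow 2) h02).congr_deriv ?_
    simp [dstereo, stereo, hre, him]
    field_simp
    ring
  · refine (((ha.const_mul 2).fun_div hN h0).sub
      (((hx.const_mul 4).mul hq).fun_div (hN.fun_pow 2) h02)).congr_deriv ?_
    simp [dstereo, stereo, hre, him]
    field_simp
    ring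
  · refine (((hb.const_mul 2).fun_div hN h0).sub
      (((hy.const_mul 4).mul hq).fun_div (hN.fun_pow 2) h02)).congr_deriv ?_
    simp [dstereo, stereo, hre, him]
    field_simp
    ring

theorem dstereo_add (W v w : ℂ) : dstereo W (v + w) = dstereo W v + dstereo W w := by
  ext i
  fin_cases i <;> simp [dstereo] <;> ring

theorem dstereo_smul (W : ℂ) (c : ℝ) (w : ℂ) : dstereo W (c * w) = c • dstereo W w := by
  ext i
  fin_cases i <;> simp [dstereo] <;> ring

/-- The three points of the sphere which carry the cone points; in the stereographic coordinate
they are `∞`, `1` and `-1`. -/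
noncomputable def pole : Fin 3 → E3 :=
  ![EuclideanSpace.single 0 (-1), EuclideanSpace.single 1 1, EuclideanSpace.single 1 (-1)]

/-- The quadratic correction to the geodesic equation of the round sphere, caused by a potential
with gradient `q`. -/
noncomputable def connTerm (q x y : E3) : E3 :=
  -(2 * inner ℝ q y) • y + ‖y‖ ^ 2 • (q - inner ℝ q x • x)

/-- The correction caused by `-(1/2) log` of the squared distance to the pole at `∞`, in the
stereographic coordinate. -/
theorem connTerm_pole_zero (W w : ℂ) :
    (2 - 2 * inner ℝ (pole 0) (stereo W))⁻¹ • connTerm (pole 0) (stereo W) (dstereo W w) =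
      dstereo W (-(starRingEnd ℂ W / (1 + (W.re ^ 2 + W.im ^ 2) : ℝ)) * w ^ 2) := by
  have h0 := (one_add_sq_pos W).ne'
  have hre : (-(starRingEnd ℂ W / (1 + (W.re ^ 2 + W.im ^ 2) : ℝ)) * w ^ 2).re =
      - (W.re * (w.re ^ 2 - w.im ^ 2) + W.im * (2 * w.re * w.im)) /
        (1 + (W.re ^ 2 + W.im ^ 2)) := by
    simp [Complex.div_re, Complex.div_im, pow_two, Complex.normSq_apply]
    field_simp
    ring
  have him : (-(starRingEnd ℂ W / (1 + (W.re ^ 2 + W.im ^ 2) : ℝ)) * w ^ 2).im =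
      - (W.re * (2 * w.re * w.im) - W.im * (w.re ^ 2 - w.im ^ 2)) /
        (1 + (W.re ^ 2 + W.im ^ 2)) := by
    simp [Complex.div_re, Complex.div_im, pow_two, Complex.normSq_apply]
    field_simp
    ring
  generalize -(starRingEnd ℂ W / (1 + (W.re ^ 2 + W.im ^ 2) : ℝ)) * w ^ 2 = e at hre him ⊢
  have hs : (2 - 2 * inner ℝ (pole 0) (stereo W))⁻¹ = (1 + (W.re ^ 2 + W.im ^ 2)) / 4 := by
    rw [← inv_inj, inv_inv, inner_E3]
    simp [pole, stereo]
    field_simp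
    ring
  rw [hs, connTerm, ← real_inner_self_eq_norm_sq, inner_dstereo, Complex.inner, inner_E3, inner_E3]
  ext i
  fin_cases i
  · simp [dstereo, stereo, hre, him, pole]
    field_simp
    ring
  · simp [dstereo, stereo, hre, him, pole]
    field_simp
    ring
  · simp [dstereo, stereo, hre, him, pole]
    field_simp
    ring

/-- The correction caused by `-(1/2) log` of the squared distance to the pole at `σ = ±1`, in the
stereographic coordinate. -/
theorem connTerm_single_one (W w : ℂ) {σ : ℝ} (hσ : σ ^ 2 = 1) (hW : W ≠ σ) :
    (2 - 2 * inner ℝ (EuclideanSpace.single 1 σ : E3) (stereo W))⁻¹ •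
      connTerm (EuclideanSpace.single 1 σ : E3) (stereo W) (dstereo W w) =
      dstereo W ((1 / (W - σ) - starRingEnd ℂ W / (1 + (W.re ^ 2 + W.im ^ 2) : ℝ)) * w ^ 2) := by
  have h0 := (one_add_sq_pos W).ne'
  have h1 : (W.re - σ) ^ 2 + W.im ^ 2 ≠ 0 := by
    intro h
    apply hW
    have h3 : W.im = 0 := by nlinarith [sq_nonneg (W.re - σ), sq_nonneg W.im]
    have h4 : W.re - σ = 0 := by nlinarith [sq_nonneg (W.re - σ), sq_nonneg W.im]
    apply Complex.ext <;> simp <;> linarith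
  have hre : ((1 / (W - σ) - starRingEnd ℂ W / (1 + (W.re ^ 2 + W.im ^ 2) : ℝ)) * w ^ 2).re =
      ((W.re - σ) * (w.re ^ 2 - w.im ^ 2) + W.im * (2 * w.re * w.im)) /
        ((W.re - σ) ^ 2 + W.im ^ 2)
      - (W.re * (w.re ^ 2 - w.im ^ 2) + W.im * (2 * w.re * w.im)) /
        (1 + (W.re ^ 2 + W.im ^ 2)) := by
    simp [Complex.div_re, Complex.div_im, pow_two, Complex.normSq_apply]
    simp only [← pow_two]
    field_simp
    ring
  have him : ((1 / (W - σ) - starRingEnd ℂ W / (1 + (W.re ^ 2 + W.im ^ 2) : ℝ)) * w ^ 2).im =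
      ((W.re - σ) * (2 * w.re * w.im) - W.im * (w.re ^ 2 - w.im ^ 2)) /
        ((W.re - σ) ^ 2 + W.im ^ 2)
      - (W.re * (2 * w.re * w.im) - W.im * (w.re ^ 2 - w.im ^ 2)) /
        (1 + (W.re ^ 2 + W.im ^ 2)) := by
    simp [Complex.div_re, Complex.div_im, pow_two, Complex.normSq_apply]
    simp only [← pow_two]
    field_simp
    ring
  generalize (1 / (W - σ) - starRingEnd ℂ W / (1 + (W.re ^ 2 + W.im ^ 2) : ℝ)) * w ^ 2 = e
    at hre him ⊢
  have hs : (2 - 2 * inner ℝ (EuclideanSpace.single 1 σ : E3) (stereo W))⁻¹ =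
      (1 + (W.re ^ 2 + W.im ^ 2)) / (2 * ((W.re - σ) ^ 2 + W.im ^ 2)) := by
    rw [← inv_inj, inv_inv, inner_E3]
    simp [stereo]
    field_simp
    linear_combination -hσ
  rw [hs, connTerm, ← real_inner_self_eq_norm_sq, inner_dstereo, Complex.inner, inner_E3, inner_E3]
  ext i
  fin_cases i
  · simp [dstereo, stereo, hre, him]
    rcases sq_eq_one_iff.1 hσ with rfl | rfl <;> field_simp <;> ring
  · simp [dstereo, stereo, hre, him]
    rcases sq_eq_one_iff.1 hσ with rfl | rfl <;> field_simp <;> ring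
  · simp [dstereo, stereo, hre, him]
    rcases sq_eq_one_iff.1 hσ with rfl | rfl <;> field_simp <;> ring

theorem pole_one : pole 1 = EuclideanSpace.single 1 (1 : ℝ) := rfl

theorem pole_two : pole 2 = EuclideanSpace.single 1 (-1 : ℝ) := rfl

theorem norm_pole (i : Fin 3) : ‖pole i‖ = 1 := by
  fin_cases i <;> simp [pole]

/-- The squared chordal distance to the `i`-th pole. -/
noncomputable def chord (i : Fin 3) (x : E3) : ℝ := 2 - 2 * inner ℝ (pole i) x

theorem chord_zero_stereo (W : ℂ) : chord 0 (stereo W) = 4 / (1 + ‖W‖ ^ 2) := by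
  have h0 := (one_add_sq_pos W).ne'
  rw [chord, inner_E3, Complex.sq_norm, Complex.normSq_apply, ← pow_two, ← pow_two]
  simp [pole, stereo]
  field_simp
  ring

theorem chord_single_stereo (W : ℂ) {σ : ℝ} (hσ : σ ^ 2 = 1) :
    2 - 2 * inner ℝ (EuclideanSpace.single 1 σ : E3) (stereo W) =
      2 * ‖W - σ‖ ^ 2 / (1 + ‖W‖ ^ 2) := by
  have h0 := (one_add_sq_pos W).ne'
  rw [inner_E3, Complex.sq_norm, Complex.sq_norm, Complex.normSq_apply, Complex.normSq_apply,
    ← pow_two, ← pow_two, ← pow_two, ← pow_two]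
  simp [stereo]
  field_simp
  linear_combination -hσ

theorem chord_one_stereo (W : ℂ) : chord 1 (stereo W) = 2 * ‖W - 1‖ ^ 2 / (1 + ‖W‖ ^ 2) := by
  rw [chord, pole_one]
  simpa using chord_single_stereo W (σ := 1) (by norm_num)

theorem chord_two_stereo (W : ℂ) : chord 2 (stereo W) = 2 * ‖W + 1‖ ^ 2 / (1 + ‖W‖ ^ 2) := by
  rw [chord, pole_two]
  simpa using chord_single_stereo W (σ := -1) (by norm_num)

theorem prod_chord_stereo (W : ℂ) :
    ∏ i, chord i (stereo W) = 16 * ‖W ^ 2 - 1‖ ^ 2 / (1 + ‖W‖ ^ 2) ^ 3 := by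
  have h : W ^ 2 - 1 = (W - 1) * (W + 1) := by ring
  rw [Fin.prod_univ_three, chord_zero_stereo, chord_one_stereo, chord_two_stereo, h, norm_mul]
  field_simp
  ring

/-- The three corrections together: the multiples of `conj W / (1 + |W|²)` add up to three, so
that two thirds of the sum contain exactly the connection term of the round metric in
`hasDerivAt_dstereo`. -/
theorem sum_connTerm_pole {W : ℂ} (w : ℂ) (h1 : W ≠ 1) (h2 : W ≠ -1) :
    ∑ i, (chord i (stereo W))⁻¹ • connTerm (pole i) (stereo W) (dstereo W w) =
      dstereo W ((2 * (W / (W ^ 2 - 1))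
        - 3 * (starRingEnd ℂ W / (1 + (W.re ^ 2 + W.im ^ 2) : ℝ))) * w ^ 2) := by
  have e1 := connTerm_single_one W w (σ := 1) (by norm_num) (by simpa using h1)
  have e2 := connTerm_single_one W w (σ := -1) (by norm_num) (by simpa using h2)
  simp only [chord, Fin.sum_univ_three]
  rw [connTerm_pole_zero, pole_one, pole_two, e1, e2, ← dstereo_add, ← dstereo_add]
  congr 1
  have h3 : W - 1 ≠ 0 := sub_ne_zero.2 h1
  have h4 : W + 1 ≠ 0 := fun h => h2 (eq_neg_of_add_eq_zero_left h)
  have h5 : W ^ 2 - 1 = (W - 1) * (W + 1) := by ring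
  have h6 : W / (W ^ 2 - 1) = (1 / (W - 1) + 1 / (W + 1)) / 2 := by
    rw [h5]; field_simp; ring
  rw [h6]
  simp
  ring

/-- The equation `W'' = (4/3) W/(W² - 1) W'²` satisfied by the image of a straight line under the
uniformizing function is the geodesic equation of the potential `-(1/3) ∑ log (chord i)`. -/
theorem hasDerivAt_dstereo_of_flat {W w : ℝ → ℂ} {t : ℝ} (h : HasDerivAt W (w t) t)
    (hw : HasDerivAt w (4 / 3 * (W t / (W t ^ 2 - 1)) * w t ^ 2) t)
    (h1 : W t ≠ 1) (h2 : W t ≠ -1) :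
    HasDerivAt (fun t => dstereo (W t) (w t))
      (-(‖dstereo (W t) (w t)‖ ^ 2) • stereo (W t) + (2 / 3 : ℝ) • ∑ i,
        (chord i (stereo (W t)))⁻¹ • connTerm (pole i) (stereo (W t)) (dstereo (W t) (w t))) t := by
  refine (hasDerivAt_dstereo h hw).congr_deriv ?_
  rw [sum_connTerm_pole _ h1 h2, ← dstereo_smul]
  congr 2
  push_cast
  ring

theorem connTerm_add (p q x y : E3) : connTerm (p + q) x y = connTerm p x y + connTerm q x y := by
  simp only [connTerm, inner_add_left]
  module

theorem connTerm_smul (c : ℝ) (q x y : E3) : connTerm (c • q) x y = c • connTerm q x y := by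
  simp only [connTerm, real_inner_smul_left]
  module

theorem geoField_eq (v : E3 → ℝ) (x y : E3) :
    geoField v x y = -(‖y‖ ^ 2) • x + connTerm (gradient v x) x y := by
  simp only [connTerm, geoField]
  module

/-! ### The uniformization of the quotient -/

theorem stereoSphere_injective : Function.Injective stereoSphere := by
  intro W V h
  have h1 : stereo W = stereo V := congrArg Subtype.val h
  have h0 := one_add_sq_pos W
  have h0' := one_add_sq_pos V
  have e0 := congrArg (fun x : E3 => x 0) h1
  have e1 := congrArg (fun x : E3 => x 1) h1
  have e2 := congrArg (fun x : E3 => x 2) h1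
  simp only [stereo, PiLp.toLp_apply, Matrix.cons_val] at e0 e1 e2
  have e3 : W.re ^ 2 + W.im ^ 2 = V.re ^ 2 + V.im ^ 2 := by
    rw [div_eq_div_iff h0.ne' h0'.ne'] at e0
    nlinarith
  rw [e3, div_left_inj' h0'.ne'] at e1 e2
  exact Complex.ext (by linarith) (by linarith)

theorem coe_neg_basePoint : ((-basePoint : S2) : E3) = pole 0 := by
  ext i
  fin_cases i <;> simp [basePoint, pole]

theorem stereoSphere_ne_neg_basePoint (W : ℂ) : stereoSphere W ≠ -basePoint := by
  intro h
  have h1 : stereo W = pole 0 := by rw [← coe_neg_basePoint, ← h]; rfl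
  have h2 := chord_zero_stereo W
  rw [h1, chord, real_inner_self_eq_norm_sq, norm_pole] at h2
  have : 0 < 4 / (1 + ‖W‖ ^ 2) := by positivity
  linarith

theorem exists_stereoSphere_eq {x : S2} (hx : x ≠ -basePoint) : ∃ W, stereoSphere W = x := by
  have hn : (x : E3) 0 ^ 2 + (x : E3) 1 ^ 2 + (x : E3) 2 ^ 2 = 1 := by
    have h := real_inner_self_eq_norm_sq (x : E3)
    rw [inner_E3, norm_eq_of_mem_sphere x] at h
    linarith
  have h0 : 1 + (x : E3) 0 ≠ 0 := by
    intro h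
    apply hx
    have h1 : (x : E3) 0 = -1 := by linarith
    rw [h1] at hn
    have h2 : (x : E3) 1 = 0 := by nlinarith [sq_nonneg ((x : E3) 1), sq_nonneg ((x : E3) 2)]
    have h3 : (x : E3) 2 = 0 := by nlinarith [sq_nonneg ((x : E3) 1), sq_nonneg ((x : E3) 2)]
    apply Subtype.ext
    rw [coe_neg_basePoint]
    ext i
    fin_cases i <;> simp [pole, h1, h2, h3]
  refine ⟨⟨(x : E3) 1 / (1 + (x : E3) 0), (x : E3) 2 / (1 + (x : E3) 0)⟩, ?_⟩
  apply Subtype.ext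
  change stereo _ = _
  have h1 : 1 + (((x : E3) 1 / (1 + (x : E3) 0)) ^ 2 + ((x : E3) 2 / (1 + (x : E3) 0)) ^ 2) =
      2 / (1 + (x : E3) 0) := by
    field_simp
    linear_combination hn
  have h2 : 1 - (((x : E3) 1 / (1 + (x : E3) 0)) ^ 2 + ((x : E3) 2 / (1 + (x : E3) 0)) ^ 2) =
      2 * (x : E3) 0 / (1 + (x : E3) 0) := by
    field_simp
    linear_combination -hn
  ext i
  fin_cases i
  · simp only [stereo, h1, h2]
    simp
    field_simp
  · simp only [stereo, h1]
    simp
    field_simp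
  · simp only [stereo, h1]
    simp
    field_simp

open Filter Topology in
theorem tendsto_stereoSphere :
    Tendsto stereoSphere (Bornology.cobounded ℂ) (𝓝 (-basePoint)) := by
  rw [tendsto_subtype_rng, coe_neg_basePoint, tendsto_iff_norm_sub_tendsto_zero]
  have h : ∀ W, ‖(stereoSphere W : E3) - pole 0‖ = Real.sqrt (4 / (1 + ‖W‖ ^ 2)) := by
    intro W
    rw [← chord_zero_stereo, chord]
    rw [← Real.sqrt_sq (norm_nonneg _), norm_sub_sq_real, norm_pole, real_inner_comm]
    change √(‖stereo W‖ ^ 2 - _ + _) = _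
    rw [norm_stereo]
    congr 1
    change 1 ^ 2 - 2 * inner ℝ (pole 0) (stereo W) + 1 ^ 2 = _
    ring
  simp only [h]
  rw [← Real.sqrt_zero]
  refine (Real.continuous_sqrt.tendsto 0).comp ?_
  refine Tendsto.div_atTop tendsto_const_nhds (tendsto_atTop_add_const_left _ _ ?_)
  exact (tendsto_pow_atTop two_ne_zero).comp tendsto_norm_cobounded_atTop

open Classical in
/-- The map of the plane onto the sphere induced by the uniformizing function; the lattice points
are the poles of `unif`. -/
noncomputable def devMap (z : ℂ) : S2 := if z ∈ lattice then -basePoint else stereoSphere (unif z)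

theorem devMap_of_mem {z : ℂ} (hz : z ∈ lattice) : devMap z = -basePoint := if_pos hz

theorem devMap_of_notMem {z : ℂ} (hz : z ∉ lattice) : devMap z = stereoSphere (unif z) := if_neg hz

/-- The induced map on the quotient is injective. -/
theorem devMap_eq_iff {z w : ℂ} : devMap z = devMap w ↔ proj z = proj w := by
  constructor
  · intro h
    by_cases hz : z ∈ lattice <;> by_cases hw : w ∈ lattice
    · exact (proj_zero_eq_iff.2 hz).trans (proj_zero_eq_iff.2 hw).symm
    · rw [devMap_of_mem hz, devMap_of_notMem hw] at h
      exact absurd h.symm (stereoSphere_ne_neg_basePoint _)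
    · rw [devMap_of_mem hw, devMap_of_notMem hz] at h
      exact absurd h (stereoSphere_ne_neg_basePoint _)
    · rw [devMap_of_notMem hw, devMap_of_notMem hz] at h
      exact proj_eq_of_unif_eq hz hw (stereoSphere_injective h)
  · intro h
    have h1 := mem_lattice_congr h
    by_cases hz : z ∈ lattice
    · rw [devMap_of_mem hz, devMap_of_mem (h1.1 hz)]
    · rw [devMap_of_notMem hz, devMap_of_notMem (fun h => hz (h1.2 h)), unif_eq_of_proj_eq h]

theorem contMDiffOn_devMap : ContMDiffOn 𝓘(ℝ, ℂ) (𝓡 2) ∞ devMap (lattice : Set ℂ)ᶜ := by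
  have h1 : ContDiffOn ℝ ∞ unif (lattice : Set ℂ)ᶜ :=
    (analyticOnNhd_unif.contDiffOn (isClosed_lattice.isOpen_compl.uniqueDiffOn)).restrict_scalars ℝ
  refine (contMDiff_stereoSphere.comp_contMDiffOn h1.contMDiffOn).congr ?_
  intro z hz
  exact devMap_of_notMem hz

open Filter Topology in
/-- Continuity at the lattice points holds because `unif` has poles there. -/
theorem continuous_devMap : Continuous devMap := by
  rw [continuous_iff_continuousAt]
  intro z
  by_cases hz : z ∈ lattice
  · rw [continuousAt_iff_punctured_nhds, devMap_of_mem hz]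
    refine (tendsto_stereoSphere.comp (tendsto_unif hz)).congr' ?_
    filter_upwards [eventually_notMem_lattice z] with w hw
    exact (devMap_of_notMem hw).symm
  · exact contMDiffOn_devMap.continuousOn.continuousAt (isClosed_lattice.isOpen_compl.mem_nhds hz)

theorem isCompact_range_of_lattice_periodic {F : Type*} [TopologicalSpace F] {f : ℂ → F}
    (hf : Continuous f) (h : ∀ z, ∀ l ∈ lattice, f (z + l) = f z) : IsCompact (range f) :=
  IsZLattice.isCompact_range_of_periodic hexPeriods.lattice f hf
    fun z l hl => h z l (mem_hexPeriods_lattice.1 hl)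

theorem devMap_add_mem {l : ℂ} (z : ℂ) (hl : l ∈ lattice) : devMap (z + l) = devMap z :=
  devMap_eq_iff.2 (proj_add_mem z hl)

instance : CompactSpace CrokeSphere := by
  have h := isCompact_range_of_lattice_periodic continuous_proj fun z _ hl => proj_add_mem z hl
  rw [proj_surjective.range_eq] at h
  exact ⟨h⟩

/-- The image of `unif` is open by the open mapping theorem, and closed because the image of the
torus in the sphere is compact. -/
theorem surjOn_unif : SurjOn unif (lattice : Set ℂ)ᶜ univ := by
  have hop : IsOpen (unif '' (lattice : Set ℂ)ᶜ) := by
    rcases analyticOnNhd_unif.is_constant_or_isOpen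
      (isPreconnected_compl_of_countable countable_lattice) with ⟨c, hc⟩ | h
    · exact absurd hc (not_eqOn_const_of_tendsto_cobounded (tendsto_unif lattice.zero_mem) c)
    · exact h _ subset_rfl isClosed_lattice.isOpen_compl
  have hcl : IsClosed (unif '' (lattice : Set ℂ)ᶜ) := by
    have h1 : unif '' (lattice : Set ℂ)ᶜ = stereoSphere ⁻¹' range devMap := by
      ext W
      constructor
      · rintro ⟨z, hz, rfl⟩
        exact ⟨z, devMap_of_notMem hz⟩
      · rintro ⟨z, hz⟩
        by_cases h : z ∈ lattice
        · rw [devMap_of_mem h] at hz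
          exact absurd hz.symm (stereoSphere_ne_neg_basePoint W)
        · rw [devMap_of_notMem h] at hz
          exact ⟨z, h, stereoSphere_injective hz⟩
    rw [h1]
    exact (isCompact_range_of_lattice_periodic continuous_devMap
      fun z _ hl => devMap_add_mem z hl).isClosed.preimage contMDiff_stereoSphere.continuous
  rcases isClopen_iff.1 ⟨hcl, hop⟩ with h | h
  · exact absurd h (Set.Nonempty.ne_empty ⟨_, mem_image_of_mem _ two_notMem_lattice⟩)
  · exact h.ge

theorem devMap_surjective : Function.Surjective devMap := by
  intro x
  by_cases hx : x = -basePoint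
  · exact ⟨0, by rw [devMap_of_mem lattice.zero_mem, hx]⟩
  · obtain ⟨W, rfl⟩ := exists_stereoSphere_eq hx
    obtain ⟨z, hz, rfl⟩ := surjOn_unif (mem_univ W)
    exact ⟨z, devMap_of_notMem hz⟩

/-- The uniformization of the quotient: a continuous bijection from a compact space to a Hausdorff
space. -/
theorem exists_homeomorph_comp_proj : ∃ Φ : CrokeSphere ≃ₜ S2, ∀ z, Φ (proj z) = devMap z := by
  have hex : ∀ p : CrokeSphere, ∃ x, ∀ z, proj z = p → devMap z = x := by
    intro p
    obtain ⟨z, rfl⟩ := proj_surjective p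
    exact ⟨devMap z, fun w hw => devMap_eq_iff.2 hw⟩
  choose φ hφ using hex
  have hφ' : ∀ z, φ (proj z) = devMap z := fun z => (hφ _ z rfl).symm
  have hbij : Function.Bijective φ := by
    constructor
    · intro p q h
      obtain ⟨z, rfl⟩ := proj_surjective p
      obtain ⟨w, rfl⟩ := proj_surjective q
      rw [hφ', hφ'] at h
      exact devMap_eq_iff.1 h
    · intro x
      obtain ⟨z, rfl⟩ := devMap_surjective x
      exact ⟨proj z, hφ' z⟩
  have hcont : Continuous φ := by
    refine continuous_coinduced_dom.2 (continuous_coinduced_dom.2 ?_)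
    exact continuous_devMap.congr fun z => (hφ' z).symm
  exact ⟨hcont.homeoOfEquivCompactToT2 (f := Equiv.ofBijective φ hbij), hφ'⟩

/-! ### The smoothed potential -/

/-- A smooth monotone cutoff, `0` up to `ε / 2` and `1` from `ε` on. -/
noncomputable def cutoff (ε x : ℝ) : ℝ := Real.smoothTransition (2 * x / ε - 1)

theorem contDiff_cutoff (ε : ℝ) : ContDiff ℝ ∞ (cutoff ε) :=
  Real.smoothTransition.contDiff.comp (by fun_prop)

theorem cutoff_nonneg (ε x : ℝ) : 0 ≤ cutoff ε x := Real.smoothTransition.nonneg _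

theorem cutoff_le_one (ε x : ℝ) : cutoff ε x ≤ 1 := Real.smoothTransition.le_one _

theorem monotone_cutoff {ε : ℝ} (hε : 0 < ε) : Monotone (cutoff ε) := by
  intro x y h
  refine Real.smoothTransition.monotone ?_
  gcongr

theorem cutoff_eq_zero {ε x : ℝ} (hε : 0 < ε) (hx : x ≤ ε / 2) : cutoff ε x = 0 := by
  refine Real.smoothTransition.zero_of_nonpos ?_
  rw [sub_nonpos, div_le_one hε]
  linarith

theorem cutoff_eq_one {ε x : ℝ} (hε : 0 < ε) (hx : ε ≤ x) : cutoff ε x = 1 := by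
  refine Real.smoothTransition.one_of_one_le ?_
  have : 1 ≤ x / ε := (one_le_div hε).2 hx
  rw [mul_div_assoc]
  linarith

open Filter Topology in
theorem contDiff_cutoff_div {ε : ℝ} (hε : 0 < ε) : ContDiff ℝ ∞ fun x => cutoff ε x / x := by
  rw [contDiff_iff_contDiffAt]
  intro x
  by_cases hx : x = 0
  · have h : (fun x => cutoff ε x / x) =ᶠ[𝓝 x] fun _ => (0 : ℝ) := by
      filter_upwards [Iio_mem_nhds (show x < ε / 2 by rw [hx]; positivity)] with y hy
      rw [cutoff_eq_zero hε (le_of_lt hy), zero_div]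
    exact contDiffAt_const.congr_of_eventuallyEq h
  · exact (contDiff_cutoff ε).contDiffAt.div contDiffAt_id hx

/-- A smooth function on the line which is the logarithm from `ε` on and constant up to `ε / 2`. -/
noncomputable def smoothLog (ε s : ℝ) : ℝ := Real.log ε + ∫ x in ε..s, cutoff ε x / x

theorem hasDerivAt_smoothLog {ε : ℝ} (hε : 0 < ε) (s : ℝ) :
    HasDerivAt (smoothLog ε) (cutoff ε s / s) s := by
  have hc := (contDiff_cutoff_div hε).continuous
  exact (hc.integral_hasStrictDerivAt ε s).hasDerivAt.const_add _

theorem deriv_smoothLog {ε : ℝ} (hε : 0 < ε) : deriv (smoothLog ε) = fun s => cutoff ε s / s :=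
  funext fun s => (hasDerivAt_smoothLog hε s).deriv

theorem contDiff_smoothLog {ε : ℝ} (hε : 0 < ε) : ContDiff ℝ ∞ (smoothLog ε) := by
  rw [contDiff_infty_iff_deriv, deriv_smoothLog hε]
  exact ⟨fun s => (hasDerivAt_smoothLog hε s).differentiableAt, contDiff_cutoff_div hε⟩

theorem smoothLog_of_le {ε s : ℝ} (hε : 0 < ε) (hs : ε ≤ s) : smoothLog ε s = Real.log s := by
  have h : ∫ x in ε..s, cutoff ε x / x = ∫ x in ε..s, 1 / x := by
    refine intervalIntegral.integral_congr fun x hx => ?_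
    rw [uIcc_of_le hs] at hx
    simp only [cutoff_eq_one hε hx.1]
  rw [smoothLog, h, integral_one_div_of_pos hε (hε.trans_le hs),
    Real.log_div (hε.trans_le hs).ne' hε.ne']
  ring

/-- Smoothing increases the logarithm, hence decreases the conformal factor and the area. -/
theorem log_le_smoothLog {ε s : ℝ} (hε : 0 < ε) (hs : 0 < s) : Real.log s ≤ smoothLog ε s := by
  rcases le_total ε s with h | h
  · exact (smoothLog_of_le hε h).ge
  · have hanti : AntitoneOn (fun x => smoothLog ε x - Real.log x) (Ioi 0) := by
      refine antitoneOn_of_hasDerivWithinAt_nonpos (f' := fun x => cutoff ε x / x - x⁻¹)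
        (convex_Ioi 0) ?_ ?_ ?_
      · intro x hx
        exact ((hasDerivAt_smoothLog hε x).sub
          (Real.hasDerivAt_log (ne_of_gt hx))).continuousAt.continuousWithinAt
      · intro x hx
        rw [interior_Ioi] at hx
        exact ((hasDerivAt_smoothLog hε x).sub
          (Real.hasDerivAt_log (ne_of_gt hx))).hasDerivWithinAt
      · intro x hx
        rw [interior_Ioi] at hx
        rw [sub_nonpos, div_eq_mul_inv]
        exact mul_le_of_le_one_left (inv_nonneg.2 (le_of_lt hx)) (cutoff_le_one _ _)
    have := hanti hs (hs.trans_le h) h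
    simp only [smoothLog_of_le hε le_rfl] at this
    linarith

/-- This also holds at `s = 0`, where both sides vanish. -/
theorem mul_deriv_smoothLog {ε : ℝ} (hε : 0 < ε) (s : ℝ) :
    s * deriv (smoothLog ε) s = cutoff ε s := by
  rw [deriv_smoothLog hε]
  by_cases hs : s = 0
  · rw [hs, cutoff_eq_zero hε (by positivity), zero_mul]
  · exact mul_div_cancel₀ _ hs

theorem deriv_chordal_smoothLog {ε : ℝ} (hε : 0 < ε) (s : ℝ) :
    deriv (fun s => s * (4 - s) * deriv (smoothLog ε) s) s =
      -cutoff ε s + (4 - s) * deriv (cutoff ε) s := by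
  have h : (fun s => s * (4 - s) * deriv (smoothLog ε) s) = fun s => (4 - s) * cutoff ε s := by
    funext s
    rw [← mul_deriv_smoothLog hε]
    ring
  rw [h]
  have h1 := ((contDiff_cutoff ε).differentiable (by simp) s).hasDerivAt
  exact (((hasDerivAt_id s).const_sub 4).mul h1).deriv.trans (by simp)

/-- Since the cutoff is at most `1` and increasing, smoothing the logarithm only increases `(s (4
- s) L')'`, which is `-1` for `L = log`. -/
theorem neg_one_le_deriv_chordal_smoothLog {ε s : ℝ} (hε : 0 < ε) (hs : s ≤ 4) :
    -1 ≤ deriv (fun s => s * (4 - s) * deriv (smoothLog ε) s) s := by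
  rw [deriv_chordal_smoothLog hε]
  have h1 := cutoff_le_one ε s
  have h2 : 0 ≤ deriv (cutoff ε) s := (monotone_cutoff hε).deriv_nonneg
  nlinarith [mul_nonneg (sub_nonneg.2 hs) h2]

open Filter Topology in
theorem deriv_chordal_smoothLog_eq_zero {ε s : ℝ} (hε : 0 < ε) (hs : s < ε / 2) :
    deriv (fun s => s * (4 - s) * deriv (smoothLog ε) s) s = 0 := by
  rw [deriv_chordal_smoothLog hε, cutoff_eq_zero hε hs.le]
  have h : cutoff ε =ᶠ[𝓝 s] fun _ => (0 : ℝ) := by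
    filter_upwards [Iio_mem_nhds hs] with y hy
    exact cutoff_eq_zero hε (le_of_lt hy)
  rw [h.deriv_eq]
  simp

theorem contDiff_chord (i : Fin 3) : ContDiff ℝ ∞ (chord i) := by
  unfold chord
  exact contDiff_const.sub (contDiff_const.mul (contDiff_const.inner ℝ contDiff_id))

theorem chord_eq_norm_sq (i : Fin 3) {x : E3} (hx : ‖x‖ = 1) : chord i x = ‖x - pole i‖ ^ 2 := by
  rw [chord, norm_sub_sq_real, hx, norm_pole, real_inner_comm]
  ring

theorem chord_nonneg (i : Fin 3) (x : S2) : 0 ≤ chord i x := by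
  rw [chord_eq_norm_sq i (norm_eq_of_mem_sphere x)]
  positivity

theorem chord_le_four (i : Fin 3) (x : S2) : chord i x ≤ 4 := by
  have h := abs_real_inner_le_norm (pole i) (x : E3)
  rw [norm_pole, norm_eq_of_mem_sphere x] at h
  have := (abs_le.1 h).1
  rw [chord]
  linarith

/-- The additive constant which makes the flat part of the metric agree with that of the plane. -/
noncomputable def flatConst : ℝ :=
  ((10 / 3) * Real.log 2 - 2 * Real.log 6 - (2 / 3) * Real.log ‖coneValue‖) / 2

/-- The potential of the smoothed metric. -/
noncomputable def potential (ε : ℝ) (x : E3) : ℝ :=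
  flatConst - (1 / 3) * ∑ i, smoothLog ε (chord i x)

theorem contDiff_potential {ε : ℝ} (hε : 0 < ε) : ContDiff ℝ ∞ (potential ε) := by
  refine contDiff_const.sub (contDiff_const.mul (ContDiff.sum fun i _ => ?_))
  exact (contDiff_smoothLog hε).comp (contDiff_chord i)

/-- As a function on space; only its component tangent to the sphere matters. -/
theorem gradient_potential {ε : ℝ} (hε : 0 < ε) (x : E3) :
    gradient (potential ε) x =
      (2 / 3 : ℝ) • ∑ i, deriv (smoothLog ε) (chord i x) • pole i := by
  have h : ∀ i, HasGradientAt (fun x => smoothLog ε (chord i x))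
      (deriv (smoothLog ε) (chord i x) • (-2 : ℝ) • pole i) x := by
    intro i
    have h1 : HasFDerivAt (chord i) ((-2 : ℝ) • innerSL ℝ (pole i)) x := by
      have := (((innerSL ℝ (pole i)).hasFDerivAt (x := x)).const_mul 2).const_sub 2
      refine this.congr_fderiv ?_
      ext; simp
    have h2 := ((contDiff_smoothLog hε).differentiable (by simp) (chord i x)).hasDerivAt
    rw [hasGradientAt_iff_hasFDerivAt]
    refine (h2.comp_hasFDerivAt x h1).congr_fderiv ?_
    ext y
    simp
  have h2 : HasGradientAt (potential ε) (-((1 / 3 : ℝ) • ∑ i,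
      deriv (smoothLog ε) (chord i x) • (-2 : ℝ) • pole i)) x := by
    rw [hasGradientAt_iff_hasFDerivAt]
    have := ((HasFDerivAt.fun_sum fun i (_ : i ∈ Finset.univ) => (h i).hasFDerivAt).const_mul
      (1 / 3)).const_sub flatConst
    refine this.congr_fderiv ?_
    ext y
    simp [Fin.sum_univ_three]
  rw [h2.gradient]
  simp only [Fin.sum_univ_three]
  module

/-- The points of the sphere on which the metric with parameter `ε` is flat. -/
def flatRegion (ε : ℝ) : Set E3 := {x | ∀ i, ε ≤ chord i x}

theorem geoField_of_mem_flatRegion {ε : ℝ} (hε : 0 < ε) {x : E3} (hx : x ∈ flatRegion ε) (y : E3) :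
    geoField (potential ε) x y =
      -(‖y‖ ^ 2) • x + (2 / 3 : ℝ) • ∑ i, (chord i x)⁻¹ • connTerm (pole i) x y := by
  rw [geoField_eq, gradient_potential hε, connTerm_smul]
  simp only [Fin.sum_univ_three, connTerm_add, connTerm_smul, deriv_smoothLog hε,
    cutoff_eq_one hε (hx _), one_div]

theorem potential_of_mem_flatRegion {ε : ℝ} (hε : 0 < ε) {x : E3} (hx : x ∈ flatRegion ε) :
    potential ε x = flatConst - (1 / 3) * Real.log (∏ i, chord i x) := by
  rw [potential, Real.log_prod fun i _ => (hε.trans_le (hx i)).ne']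
  congr 2
  exact Finset.sum_congr rfl fun i _ => smoothLog_of_le hε (hx i)

/-- The singular potential pulls the round metric back to the flat metric of the plane. -/
theorem exp_flat_mul {z : ℂ} (hz : z ∉ lattice) (hz2 : unif z ^ 2 ≠ 1) :
    Real.exp (2 * (flatConst - (1 / 3) * Real.log (∏ i, chord i (stereo (unif z))))) *
      (4 / (1 + ‖unif z‖ ^ 2) ^ 2 * ‖unif' z‖ ^ 2) = 1 := by
  have hb : 0 < ‖coneValue‖ := norm_pos_iff.2 coneValue_ne_zero
  have hW : 0 < ‖unif z ^ 2 - 1‖ := norm_pos_iff.2 (sub_ne_zero.2 hz2)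
  have h4 := congrArg norm (four_mul_wp_pow_three hz)
  rw [norm_mul, norm_mul, norm_pow, norm_pow] at h4
  norm_num at h4
  have hP : 0 < ‖PeriodPair.weierstrassP hexPeriods z‖ := by
    rw [norm_pos_iff]
    intro h
    rw [h] at h4
    simp at h4
    rcases h4 with h4 | h4
    · exact coneValue_ne_zero h4
    · exact hW.ne' (by rw [h4, norm_zero])
  have h1 : ‖unif' z‖ = 6 * ‖PeriodPair.weierstrassP hexPeriods z‖ ^ 2 / ‖coneValue‖ := by
    rw [unif', norm_div, norm_mul, norm_pow]
    norm_num
  have hN : 0 < 1 + ‖unif z‖ ^ 2 := by positivity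
  rw [prod_chord_stereo, h1, flatConst]
  generalize ‖PeriodPair.weierstrassP hexPeriods z‖ = P at *
  generalize ‖coneValue‖ = b at *
  generalize ‖unif z ^ 2 - 1‖ = Q at *
  generalize 1 + ‖unif z‖ ^ 2 = N at *
  have e1 : Real.log (16 * Q ^ 2 / N ^ 3) = 4 * Real.log 2 + 2 * Real.log Q - 3 * Real.log N := by
    rw [Real.log_div (by positivity) (by positivity), Real.log_mul (by positivity) (by positivity),
      Real.log_pow, Real.log_pow, show (16 : ℝ) = 2 ^ 4 by norm_num, Real.log_pow]
    norm_num
  have e2 : Real.log (4 / N ^ 2 * (6 * P ^ 2 / b) ^ 2) = 2 * Real.log 2 - 2 * Real.log N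
      + 2 * (Real.log 6 + 2 * Real.log P - Real.log b) := by
    rw [Real.log_mul (by positivity) (by positivity), Real.log_div (by positivity) (by positivity),
      Real.log_pow, Real.log_pow, Real.log_div (by positivity) (by positivity),
      Real.log_mul (by positivity) (by positivity), Real.log_pow, show (4 : ℝ) = 2 ^ 2 by norm_num,
      Real.log_pow]
    norm_num
  have e3 : 2 * Real.log 2 + 3 * Real.log P = 2 * Real.log b + Real.log Q := by
    have h := congrArg Real.log h4
    rw [Real.log_mul (by positivity) (by positivity), Real.log_mul (by positivity) (by positivity),
      Real.log_pow, Real.log_pow, show (4 : ℝ) = 2 ^ 2 by norm_num, Real.log_pow] at h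
    exact_mod_cast h
  have e4 : 2 * (((10 / 3) * Real.log 2 - 2 * Real.log 6 - (2 / 3) * Real.log b) / 2
      - (1 / 3) * Real.log (16 * Q ^ 2 / N ^ 3)) = -Real.log (4 / N ^ 2 * (6 * P ^ 2 / b) ^ 2) := by
    rw [e1, e2]
    linarith
  rw [e4, Real.exp_neg, Real.exp_log (by positivity)]
  exact inv_mul_cancel₀ (by positivity)

/-- The smoothed potential is at most the potential of the flat metric. -/
theorem potential_le {ε : ℝ} (hε : 0 < ε) {x : E3} (hx : ∀ i, 0 < chord i x) :
    potential ε x ≤ flatConst - (1 / 3) * Real.log (∏ i, chord i x) := by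
  rw [potential, Real.log_prod fun i _ => (hx i).ne']
  have := Finset.sum_le_sum fun i (_ : i ∈ Finset.univ) => log_le_smoothLog hε (hx i)
  linarith

/-- The `i`-th pole as a point of the sphere. -/
noncomputable def poleSphere (i : Fin 3) : S2 := ⟨pole i, by simp [norm_pole]⟩

theorem sphereLaplacian_potential {ε : ℝ} (hε : 0 < ε) (p : S2) :
    sphereLaplacian (potential ε) p = -(1 / 3) * ∑ i,
      deriv (fun s => s * (4 - s) * deriv (smoothLog ε) s) (chord i p) := by
  have hL := contDiff_smoothLog hε
  have h1 : ∀ i : Fin 3, ∀ j : Fin 2, ContDiff ℝ ∞ fun t : ℝ =>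
      smoothLog ε (chord i (chartInv p (t • EuclideanSpace.single j (1 : ℝ)))) := fun i j =>
    hL.comp ((contDiff_chord i).comp ((contDiff_chartInv p).comp (by fun_prop)))
  have h2 : ∀ i : Fin 3, ∑ j : Fin 2, deriv (deriv fun t : ℝ =>
      smoothLog ε (chord i (chartInv p (t • EuclideanSpace.single j (1 : ℝ))))) 0 =
      deriv (fun s => s * (4 - s) * deriv (smoothLog ε) s) (chord i p) := by
    intro i
    have := sum_deriv_deriv_chordal hL p (poleSphere i)
    simp only [real_inner_comm (poleSphere i : E3)] at this
    exact this
  have h3 : ∀ j : Fin 2, deriv (deriv fun t : ℝ =>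
      potential ε (chartInv p (t • EuclideanSpace.single j (1 : ℝ)))) 0 =
      -(1 / 3) * ∑ i, deriv (deriv fun t : ℝ =>
        smoothLog ε (chord i (chartInv p (t • EuclideanSpace.single j (1 : ℝ))))) 0 := by
    intro j
    have e1 : (deriv fun t : ℝ => potential ε (chartInv p (t • EuclideanSpace.single j (1 : ℝ)))) =
        fun t => -(1 / 3) * ∑ i, deriv (fun t : ℝ =>
          smoothLog ε (chord i (chartInv p (t • EuclideanSpace.single j (1 : ℝ))))) t := by
      funext t
      have := ((HasDerivAt.fun_sum fun i (_ : i ∈ Finset.univ) =>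
        ((h1 i j).differentiable (by simp) t).hasDerivAt).const_mul (1 / 3)).const_sub flatConst
      exact this.deriv.trans (by ring)
    rw [e1]
    have := (HasDerivAt.fun_sum fun i (_ : i ∈ Finset.univ) =>
      ((contDiff_infty_iff_deriv.1 (h1 i j)).2.differentiable (by simp) 0).hasDerivAt).const_mul
        (-(1 / 3))
    exact this.deriv
  rw [sphereLaplacian]
  simp only [h3, ← Finset.mul_sum]
  rw [Finset.sum_comm]
  simp only [h2]

/-- The sphere metric with the three cone points smoothed at scale `ε`. -/
noncomputable def cappedMetric {ε : ℝ} (hε : 0 < ε) : SphereMetric :=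
  confMetric (potential ε) (contDiff_potential hε)

theorem gaussCurvature_cappedMetric {ε : ℝ} (hε : 0 < ε) (p : S2) :
    gaussCurvature (cappedMetric hε) p = Real.exp (-(2 * potential ε p)) * (1 + (1 / 3) *
      ∑ i, deriv (fun s => s * (4 - s) * deriv (smoothLog ε) s) (chord i p)) := by
  rw [cappedMetric, gaussCurvature_confMetric, sphereLaplacian_potential hε]
  ring

/-- Each of the three terms contributes at least `-1/3` to the factor `1 + (1/3) ∑ …`. -/
theorem gaussCurvature_cappedMetric_nonneg {ε : ℝ} (hε : 0 < ε) (p : S2) :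
    0 ≤ gaussCurvature (cappedMetric hε) p := by
  rw [gaussCurvature_cappedMetric]
  have h : ∀ i, -1 ≤ deriv (fun s => s * (4 - s) * deriv (smoothLog ε) s) (chord i p) :=
    fun i => neg_one_le_deriv_chordal_smoothLog hε (chord_le_four i p)
  refine mul_nonneg (Real.exp_pos _).le ?_
  rw [Fin.sum_univ_three]
  linarith [h 0, h 1, h 2]

/-- Near `-basePoint` the curvature is bounded below. -/
theorem le_gaussCurvature_cappedMetric {ε : ℝ} (hε : 0 < ε) {p : S2} (hp : chord 0 p < ε / 2) :
    Real.exp (-(2 * potential ε p)) / 3 ≤ gaussCurvature (cappedMetric hε) p := by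
  rw [gaussCurvature_cappedMetric]
  have h : ∀ i, -1 ≤ deriv (fun s => s * (4 - s) * deriv (smoothLog ε) s) (chord i p) :=
    fun i => neg_one_le_deriv_chordal_smoothLog hε (chord_le_four i p)
  have h0 := deriv_chordal_smoothLog_eq_zero hε hp
  rw [div_eq_mul_inv]
  refine mul_le_mul_of_nonneg_left ?_ (Real.exp_pos _).le
  rw [Fin.sum_univ_three, h0]
  linarith [h 1, h 2]

/-! ### The distance to the cone points on the sphere -/

theorem chord_eq_zero_iff {i : Fin 3} {x : S2} : chord i x = 0 ↔ x = poleSphere i := by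
  rw [chord_eq_norm_sq i (norm_eq_of_mem_sphere x), sq_eq_zero_iff, norm_eq_zero, sub_eq_zero,
    Subtype.ext_iff]
  rfl

theorem chord_pos_iff {i : Fin 3} {x : S2} : 0 < chord i x ↔ x ≠ poleSphere i := by
  rw [ne_eq, ← chord_eq_zero_iff, (chord_nonneg i x).lt_iff_ne, ne_comm]

theorem continuous_chord (i : Fin 3) : Continuous fun x : S2 => chord i x :=
  (contDiff_chord i).continuous.comp continuous_subtype_val

theorem devMap_zero : devMap 0 = poleSphere 0 := by
  rw [devMap_of_mem lattice.zero_mem]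
  exact Subtype.ext coe_neg_basePoint

theorem stereoSphere_one : stereoSphere 1 = poleSphere 1 := by
  rw [← chord_eq_zero_iff]
  exact (chord_one_stereo 1).trans (by simp)

theorem stereoSphere_neg_one : stereoSphere (-1) = poleSphere 2 := by
  rw [← chord_eq_zero_iff]
  exact (chord_two_stereo (-1)).trans (by simp)

theorem devMap_two : devMap 2 = poleSphere 1 := by
  rw [devMap_of_notMem two_notMem_lattice, unif_two, stereoSphere_one]

theorem devMap_neg_two : devMap (-2) = poleSphere 2 := by
  rw [devMap_of_notMem (fun h => two_notMem_lattice (by simpa using lattice.neg_mem h)),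
    unif_neg_two, stereoSphere_neg_one]

theorem mem_coneSet_iff_devMap {z : ℂ} : z ∈ coneSet ↔ ∃ i, devMap z = poleSphere i := by
  rw [mem_coneSet_iff]
  have : (∃ i, devMap z = poleSphere i) ↔
      devMap z = poleSphere 0 ∨ devMap z = poleSphere 1 ∨ devMap z = poleSphere 2 := by
    constructor
    · rintro ⟨i, hi⟩
      fin_cases i
      · exact Or.inl hi
      · exact Or.inr (Or.inl hi)
      · exact Or.inr (Or.inr hi)
    · rintro (h | h | h)
      exacts [⟨_, h⟩, ⟨_, h⟩, ⟨_, h⟩]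
  rw [this, ← devMap_zero, ← devMap_two, ← devMap_neg_two, devMap_eq_iff, devMap_eq_iff,
    devMap_eq_iff, proj_zero_eq_iff]

theorem isClosed_coneSet : IsClosed coneSet := by
  have : coneSet = devMap ⁻¹' range poleSphere := by
    ext z
    rw [mem_coneSet_iff_devMap]
    simp [eq_comm]
  rw [this]
  exact (finite_range _).isClosed.preimage continuous_devMap

theorem zero_mem_coneSet : (0 : ℂ) ∈ coneSet := mem_coneSet_iff.2 (Or.inl lattice.zero_mem)

theorem mem_coneSet_congr {z w : ℂ} (h : proj z = proj w) : z ∈ coneSet ↔ w ∈ coneSet := by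
  rw [mem_coneSet_iff, mem_coneSet_iff, mem_lattice_congr h, h]

theorem proj_affine (k : ℕ) {l : ℂ} (hl : l ∈ lattice) (z : ℂ) :
    proj (zeta ^ k * z + l) = proj z := by
  rw [proj_add_mem _ hl]
  induction k with
  | zero => simp
  | succ k ih => rw [pow_succ', mul_assoc, proj_zeta_mul, ih]

theorem isometry_affine (k : ℕ) (l : ℂ) : Isometry fun z => zeta ^ k * z + l := by
  refine Isometry.of_dist_eq fun z w => ?_
  rw [dist_add_right, dist_eq_norm, dist_eq_norm, ← mul_sub, norm_mul, norm_pow, norm_zeta, one_pow,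
    one_mul]

/-- The motions of the plane which generate the quotient preserve the set of points over the cone
points. -/
theorem infDist_coneSet_eq_of_proj_eq {z w : ℂ} (h : proj z = proj w) :
    Metric.infDist z coneSet = Metric.infDist w coneSet := by
  obtain ⟨k, -, hl⟩ := proj_eq_iff.1 h
  set l := zeta ^ k * w - z with hl'
  have h2 : (fun z => zeta ^ k * z + -l) '' coneSet = coneSet := by
    ext y
    constructor
    · rintro ⟨x, hx, rfl⟩
      exact (mem_coneSet_congr (proj_affine k (lattice.neg_mem hl) x)).2 hx
    · intro hy
      have h3 : zeta ^ k * ((zeta ^ k)⁻¹ * (y + l)) + -l = y := by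
        rw [mul_inv_cancel_left₀ (pow_ne_zero _ zeta_ne_zero)]; ring
      refine ⟨(zeta ^ k)⁻¹ * (y + l), ?_, h3⟩
      rw [← mem_coneSet_congr (proj_affine k (lattice.neg_mem hl) _), h3]
      exact hy
  rw [← Metric.infDist_image (isometry_affine k (-l)) (x := w), h2]
  congr 1
  rw [hl']
  ring

/-- The flat distance of a point of the sphere to the cone points. -/
noncomputable def poleDist (x : S2) : ℝ :=
  Metric.infDist (Function.surjInv devMap_surjective x) coneSet

theorem poleDist_devMap (z : ℂ) : poleDist (devMap z) = Metric.infDist z coneSet :=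
  infDist_coneSet_eq_of_proj_eq
    (devMap_eq_iff.1 (Function.surjInv_eq devMap_surjective (devMap z)))

theorem isQuotientMap_devMap : Topology.IsQuotientMap devMap := by
  obtain ⟨Φ, hΦ⟩ := exists_homeomorph_comp_proj
  have h : devMap = Φ ∘ proj := funext fun z => (hΦ z).symm
  rw [h]
  exact Φ.isQuotientMap.comp (isQuotientMap_quotient_mk'.comp isQuotientMap_quotient_mk')

theorem continuous_poleDist : Continuous poleDist := by
  rw [isQuotientMap_devMap.continuous_iff]
  exact (Metric.continuous_infDist_pt coneSet).congr fun z => (poleDist_devMap z).symm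

theorem poleDist_pos_iff {x : S2} : 0 < poleDist x ↔ ∀ i, x ≠ poleSphere i := by
  obtain ⟨z, rfl⟩ := devMap_surjective x
  rw [poleDist_devMap, ← isClosed_coneSet.notMem_iff_infDist_pos ⟨0, zero_mem_coneSet⟩,
    mem_coneSet_iff_devMap, not_exists]

/-- By compactness, a bound on the flat distance to the cone points from below bounds the chordal
distances to the poles from below. -/
theorem exists_le_chord {r : ℝ} (hr : 0 < r) :
    ∃ ε > 0, ∀ x : S2, r ≤ poleDist x → ∀ i, ε ≤ chord i x := by
  have h : ∀ i, ∃ ε > 0, ∀ x ∈ {x : S2 | r ≤ poleDist x}, ε ≤ chord i x := by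
    intro i
    have hK : IsCompact {x : S2 | r ≤ poleDist x} :=
      (isClosed_le continuous_const continuous_poleDist).isCompact
    obtain ⟨ε, hε, h⟩ := hK.exists_forall_le' (continuous_chord i).continuousOn (a := 0)
      fun x hx => chord_pos_iff.2 (poleDist_pos_iff.1 (hr.trans_le hx) i)
    exact ⟨ε, hε, h⟩
  choose ε hε h using h
  refine ⟨min (ε 0) (min (ε 1) (ε 2)), by simp [hε], fun x hx i => le_trans ?_ (h i x hx)⟩
  fin_cases i <;> simp

/-- By compactness, the points at small flat distance to the cone points lie in small caps. -/
theorem exists_chord_lt {s : ℝ} (hs : 0 < s) :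
    ∃ r > 0, ∀ x : S2, poleDist x ≤ r → ∃ i, chord i x < s := by
  have hK : IsCompact {x : S2 | ∀ i, s ≤ chord i x} := by
    refine IsClosed.isCompact ?_
    simp only [ofPred_forall]
    exact isClosed_iInter fun i => isClosed_le continuous_const (continuous_chord i)
  obtain ⟨r, hr, h⟩ := hK.exists_forall_le' continuous_poleDist.continuousOn (a := 0)
    fun x hx => poleDist_pos_iff.2 fun i => chord_pos_iff.1 (hs.trans_le (hx i))
  refine ⟨r / 2, by positivity, fun x hx => ?_⟩
  by_contra! hc
  have := h x hc
  linarith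

/-! ### The developing map is an isometry of the flat region -/

theorem coe_devMap {z : ℂ} (hz : z ∉ lattice) : (devMap z : E3) = stereo (unif z) := by
  rw [devMap_of_notMem hz]
  rfl

theorem notMem_lattice_of_notMem_coneSet {z : ℂ} (hz : z ∉ coneSet) : z ∉ lattice :=
  fun h => hz (mem_coneSet_iff.2 (Or.inl h))

theorem unif_ne_one {z : ℂ} (hz : z ∉ coneSet) : unif z ≠ 1 := fun h =>
  unif_sq_ne_one hz (by rw [h]; norm_num)

theorem unif_ne_neg_one {z : ℂ} (hz : z ∉ coneSet) : unif z ≠ -1 := fun h =>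
  unif_sq_ne_one hz (by rw [h]; norm_num)

open Filter Topology in
theorem hasFDerivAt_devMap {z : ℂ} (hz : z ∉ lattice) :
    HasFDerivAt (fun z => (devMap z : E3)) ((fderiv ℝ stereo (unif z)).comp
      ((ContinuousLinearMap.restrictScalars ℝ
        (ContinuousLinearMap.toSpanSingleton ℂ (unif' z))))) z := by
  have h1 := ((hasDerivAt_unif hz).hasFDerivAt.restrictScalars ℝ)
  have h2 := ((contDiff_stereo.differentiable (by simp) (unif z)).hasFDerivAt).comp z h1
  refine h2.congr_of_eventuallyEq ?_
  filter_upwards [isClosed_lattice.isOpen_compl.mem_nhds hz] with w hw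
  exact coe_devMap hw

theorem dcoe_mfderiv_devMap {z : ℂ} (hz : z ∉ lattice) (v : ℂ) :
    dcoe (devMap z) (mfderiv 𝓘(ℝ, ℂ) (𝓡 2) devMap z v) = dstereo (unif z) (unif' z * v) := by
  have h1 : MDifferentiableAt 𝓘(ℝ, ℂ) (𝓡 2) devMap z :=
    (contMDiffOn_devMap.contMDiffAt (isClosed_lattice.isOpen_compl.mem_nhds hz)).mdifferentiableAt
      (by simp)
  have h2 : MDifferentiableAt (𝓡 2) 𝓘(ℝ, E3) (fun x : S2 => (x : E3)) (devMap z) :=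
    contMDiff_coe.mdifferentiable (by simp) _
  have h3 := mfderiv_comp z h2 h1
  have h4 := (hasFDerivAt_devMap hz).fderiv
  rw [← mfderiv_eq_fderiv] at h4
  have h5 := (congrArg (fun f => f v) (h3.symm.trans h4)).trans (fderiv_stereo _ _)
  refine h5.trans (congrArg (dstereo (unif z)) ?_)
  exact mul_comm v (unif' z)

/-- On the flat region the capped metric is the flat metric of the plane. -/
theorem exp_potential_mul {ε : ℝ} (hε : 0 < ε) {z : ℂ} (hz : z ∉ coneSet)
    (hf : (devMap z : E3) ∈ flatRegion ε) (v w : ℂ) :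
    Real.exp (2 * potential ε (devMap z)) *
      inner ℝ (dstereo (unif z) (unif' z * v)) (dstereo (unif z) (unif' z * w)) = inner ℝ v w := by
  have hl := notMem_lattice_of_notMem_coneSet hz
  have h1 := exp_flat_mul hl (unif_sq_ne_one hz)
  rw [potential_of_mem_flatRegion hε hf, coe_devMap hl, inner_dstereo]
  have h2 : inner ℝ (unif' z * v) (unif' z * w) = ‖unif' z‖ ^ 2 * inner ℝ v w := by
    rw [Complex.inner, Complex.inner, map_mul, Complex.sq_norm, Complex.normSq_apply]
    simp
    ring
  have h3 : 1 + ((unif z).re ^ 2 + (unif z).im ^ 2) = 1 + ‖unif z‖ ^ 2 := by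
    rw [Complex.sq_norm, Complex.normSq_apply]; ring
  rw [h2, h3]
  linear_combination (inner ℝ v w) * h1

/-- The hypothesis `h` says that the metric is unchanged at the points whose flat distance to the
cone points is at least `r`. -/
theorem agreesOutside_cappedMetric {ε r : ℝ} (hε : 0 < ε) (hr : 0 < r)
    (h : ∀ x : S2, r ≤ poleDist x → ∀ i, ε ≤ chord i x) (Φ : CrokeSphere ≃ₜ S2)
    (hΦ : ∀ z, Φ (proj z) = devMap z) : AgreesOutside Φ (cappedMetric hε) r := by
  intro z hz v w
  have hΦ' : (fun x => Φ (proj x)) = devMap := funext hΦ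
  have hc : z ∉ coneSet := (isClosed_coneSet.notMem_iff_infDist_pos ⟨0, zero_mem_coneSet⟩).2
    (hr.trans_le hz)
  have hl := notMem_lattice_of_notMem_coneSet hc
  rw [hΦ', hΦ]
  refine (confMetric_inner _ _ _ _ _).trans ?_
  rw [dcoe_mfderiv_devMap hl, dcoe_mfderiv_devMap hl]
  exact exp_potential_mul hε hc (h _ (by rwa [poleDist_devMap])) v w

/-! ### The area of the quotient -/

theorem lattice_eq_span :
    lattice = (Submodule.span ℤ (range hexPeriods.basis)).toAddSubgroup := by
  ext z
  rw [← mem_hexPeriods_lattice, hexPeriods.lattice_eq_span_range_basis]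
  rfl

instance : Countable lattice := countable_lattice.to_subtype

theorem volume_fundamentalDomain_hexPeriods :
    volume (ZSpan.fundamentalDomain hexPeriods.basis) = ENNReal.ofReal (6 * √3) := by
  rw [ZSpan.measure_fundamentalDomain hexPeriods.basis volume Complex.orthonormalBasisOneI.toBasis,
    measure_congr (ZSpan.fundamentalDomain_ae_parallelepiped _ _)]
  have h := Complex.orthonormalBasisOneI.volume_parallelepiped
  have hb : ⇑Complex.orthonormalBasisOneI.toBasis = ⇑Complex.orthonormalBasisOneI := by simp
  rw [hb, h, mul_one]
  congr 1
  rw [Module.Basis.det_apply, Matrix.det_fin_two]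
  simp only [Module.Basis.toMatrix_apply]
  have e0 : hexPeriods.basis 0 = omega₁ := PeriodPair.basis_zero _
  have e1 : hexPeriods.basis 1 = omega₂ := PeriodPair.basis_one _
  have h3 := sqrt_three_pos
  rw [e0, e1, omega₁_eq, omega₂_eq]
  simp
  rw [abs_of_pos] <;> nlinarith

theorem isAddFundamentalDomain_hexPeriods :
    IsAddFundamentalDomain lattice (ZSpan.fundamentalDomain hexPeriods.basis)
      (volume : Measure ℂ) := by
  rw [lattice_eq_span]
  exact ZSpan.isAddFundamentalDomain' hexPeriods.basis volume

theorem countable_coneSet : coneSet.Countable := by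
  have h : ∀ c : ℂ, {z : ℂ | proj z = proj c}.Countable := by
    intro c
    refine ((countable_lattice.biUnion fun l _ =>
      countable_range fun k : ℕ => zeta ^ k * c - l)).mono ?_
    intro z hz
    obtain ⟨k, -, hl⟩ := proj_eq_iff.1 hz
    exact mem_biUnion hl ⟨k, by ring⟩
  refine ((h 0).union ((h 2).union (h (-2)))).mono fun z hz => ?_
  rw [mem_coneSet_iff, ← proj_zero_eq_iff] at hz
  exact hz

theorem zeta_pow_ne_one {k : ℕ} (hk : 0 < k) (hk3 : k < 3) : zeta ^ k ≠ 1 := by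
  intro h
  apply zeta_ne_one
  interval_cases k
  · simpa using h
  · linear_combination zeta_pow_three - zeta * h

/-- The nontrivial rotations of the group have their centres in `coneSet`. -/
theorem mem_coneSet_of_fixed {z : ℂ} {k : ℕ} (hk : 0 < k) (hk3 : k < 3)
    (h : zeta ^ k * z - z ∈ lattice) : z ∈ coneSet := by
  by_contra hz
  have h1 := wp_add_lattice z h
  rw [add_sub_cancel, wp_zeta_pow_mul] at h1
  have h2 : (zeta ^ k - 1) * PeriodPair.weierstrassP hexPeriods z = 0 := by
    linear_combination h1
  have h3 := (mul_eq_zero.1 h2).resolve_left (sub_ne_zero.2 (zeta_pow_ne_one hk hk3))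
  have h4 := four_mul_wp_pow_three (notMem_lattice_of_notMem_coneSet hz)
  rw [h3] at h4
  have h5 := (mul_eq_zero.1 (h4.symm.trans (by simp))).resolve_left
    (pow_ne_zero 2 coneValue_ne_zero)
  exact unif_sq_ne_one hz (sub_eq_zero.1 h5)

/-- A set of representatives and its two rotated copies form, up to a null set, a fundamental
domain of the lattice, whose covolume is `6√3`. -/
theorem volume_eq_of_bijOn_proj {D : Set ℂ} (hm : MeasurableSet D) (hD : BijOn proj D univ) :
    volume D = ENNReal.ofReal (2 * √3) := by
  have hz0 : ∀ k : ℕ, zeta ^ k ≠ 0 := fun k => pow_ne_zero k zeta_ne_zero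
  -- a rotated copy of `D`
  set r : ℕ → Set ℂ := fun k => (fun z => zeta ^ k * z) '' D with hr
  have hrot : ∀ k : ℕ, MeasurePreserving (fun z : ℂ => zeta ^ k * z) volume volume := by
    intro k
    let e : ℂ ≃ₗᵢ[ℝ] ℂ := rotation ⟨zeta ^ k, by
      simp [Submonoid.unitSphere, norm_pow, norm_zeta]⟩
    exact e.measurePreserving
  have hemb : ∀ k : ℕ, MeasurableEmbedding (fun z : ℂ => zeta ^ k * z) := fun k =>
    measurableEmbedding_mulLeft₀ (hz0 k)
  have hrm : ∀ k, MeasurableSet (r k) := fun k => (hemb k).measurableSet_image.2 hm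
  have hrv : ∀ k, volume (r k) = volume D := by
    intro k
    rw [← (hrot k).measure_preimage (hrm k).nullMeasurableSet,
      preimage_image_eq _ (mul_right_injective₀ (hz0 k))]
  -- two copies of `D` overlap in cone points only
  have hov : ∀ j k : ℕ, j < 3 → k < 3 → ∀ l ∈ lattice, ∀ x, x ∈ r j → x + l ∈ r k →
      (j = k ∧ l = 0) ∨ x ∈ coneSet := by
    rintro j k hj hk l hl x ⟨d, hd, rfl⟩ ⟨d', hd', h⟩
    simp only at h
    have hp : proj d = proj d' := by
      have e1 := proj_affine j hl d
      rw [← h] at e1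
      have e2 := proj_affine k lattice.zero_mem d'
      rw [add_zero] at e2
      exact e1.symm.trans e2
    obtain rfl := hD.injOn hd hd' hp
    by_cases hjk : j = k
    · left
      refine ⟨hjk, ?_⟩
      rw [hjk] at h
      simpa using h.symm
    · right
      have hx : proj (zeta ^ j * d) = proj d := by
        simpa using proj_affine j lattice.zero_mem d
      rw [mem_coneSet_congr hx]
      rcases lt_or_gt_of_ne hjk with hlt | hlt
      · refine mem_coneSet_of_fixed (k := k - j) (by omega) (by omega) ?_
        rw [← zeta_pow_mul_mem_lattice (k := j), mul_sub, ← mul_assoc, ← pow_add,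
          Nat.add_sub_cancel' hlt.le, h]
        simpa using hl
      · refine mem_coneSet_of_fixed (k := j - k) (by omega) (by omega) ?_
        rw [← zeta_pow_mul_mem_lattice (k := k), mul_sub, ← mul_assoc, ← pow_add,
          Nat.add_sub_cancel' hlt.le, h]
        simpa using hl
  -- the rotated copies form a fundamental domain, to be compared with the period parallelogram
  have hnull : volume coneSet = 0 := countable_coneSet.measure_zero _
  have hF : IsAddFundamentalDomain lattice (⋃ k ∈ Finset.range 3, r k) (volume : Measure ℂ) := by
    refine ⟨(Finset.measurableSet_biUnion _ fun k _ => hrm k).nullMeasurableSet, ?_, ?_⟩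
    · refine Filter.Eventually.of_forall fun x => ?_
      obtain ⟨d, hd, hdx⟩ := hD.surjOn (mem_univ (proj x))
      obtain ⟨k, hk, hl⟩ := proj_eq_iff.1 hdx.symm
      refine ⟨⟨_, hl⟩, ?_⟩
      simp only [mem_iUnion]
      refine ⟨k, Finset.mem_range.2 hk, d, hd, ?_⟩
      change _ = (zeta ^ k * d - x) + x
      ring
    · intro g h hgh
      refine measure_mono_null ?_ hnull
      rintro x ⟨hx1, hx2⟩
      rw [mem_vadd_set_iff_neg_vadd_mem] at hx1 hx2
      simp only [mem_iUnion, Finset.mem_range] at hx1 hx2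
      obtain ⟨j, hj, hx1⟩ := hx1
      obtain ⟨k, hk, hx2⟩ := hx2
      have e1 : (-g +ᵥ x : ℂ) = -(g : ℂ) + x := rfl
      have e2 : (-h +ᵥ x : ℂ) = (-(g : ℂ) + x) + ((g : ℂ) - h) := by
        change -(h : ℂ) + x = _
        ring
      rw [e1] at hx1
      rw [e2] at hx2
      rcases hov j k hj hk _ (lattice.sub_mem g.2 h.2) _ hx1 hx2 with ⟨-, h0⟩ | h0
      · exact absurd (Subtype.ext (sub_eq_zero.1 h0)) hgh
      · have e3 : proj (-(g : ℂ) + x) = proj x := by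
          rw [add_comm]
          exact proj_add_mem x (lattice.neg_mem g.2)
        exact (mem_coneSet_congr e3).1 h0
  have hdisj : (↑(Finset.range 3) : Set ℕ).Pairwise fun j k => AEDisjoint volume (r j) (r k) := by
    intro j hj k hk hjk
    refine measure_mono_null ?_ hnull
    rintro x ⟨hx1, hx2⟩
    rcases hov j k (Finset.mem_range.1 hj) (Finset.mem_range.1 hk) 0 lattice.zero_mem x hx1
      (by simpa using hx2) with ⟨h, -⟩ | h
    · exact absurd h hjk
    · exact h
  have := hF.measure_eq isAddFundamentalDomain_hexPeriods
  rw [measure_biUnion_finset₀ hdisj fun k _ => (hrm k).nullMeasurableSet,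
    volume_fundamentalDomain_hexPeriods] at this
  simp only [hrv, Finset.sum_const, Finset.card_range, nsmul_eq_mul] at this
  have h6 : ENNReal.ofReal (6 * √3) = ((3 : ℕ) : ENNReal) * ENNReal.ofReal (2 * √3) := by
    rw [← ENNReal.ofReal_natCast, ← ENNReal.ofReal_mul (by norm_num)]
    congr 1
    norm_num
    ring
  rw [h6] at this
  exact (ENNReal.mul_right_inj (by norm_num) (by simp)).1 this

theorem finite_lattice_inter_closedBall (R : ℝ) :
    ((lattice : Set ℂ) ∩ Metric.closedBall 0 R).Finite := by
  rw [inter_comm]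
  refine Metric.finite_isBounded_inter_isClosed ?_ Metric.isBounded_closedBall isClosed_lattice
  have h : (lattice : Set ℂ) = hexPeriods.lattice := by
    ext z; exact mem_hexPeriods_lattice.symm
  rw [h]
  exact isDiscrete_iff_discreteTopology.2 (inferInstanceAs (DiscreteTopology hexPeriods.lattice))

/-- The lexicographic order by modulus, real part and imaginary part singles out one point of every
orbit. -/
noncomputable def orbitKey (z : ℂ) : ℝ ×ₗ ℝ ×ₗ ℝ := toLex (‖z‖, toLex (z.re, z.im))

theorem orbitKey_injective : Function.Injective orbitKey := by
  intro z w h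
  simp only [orbitKey, EmbeddingLike.apply_eq_iff_eq, Prod.mk.injEq] at h
  exact Complex.ext h.2.1 h.2.2

/-- In each orbit the least point for the order of `orbitKey` is chosen. -/
theorem exists_measurableSet_bijOn_proj : ∃ D : Set ℂ, MeasurableSet D ∧ BijOn proj D univ := by
  refine ⟨⋂ k : Fin 3, ⋂ l : lattice, {z | orbitKey z ≤ orbitKey (zeta ^ (k : ℕ) * z + l)}, ?_,
    fun _ _ => mem_univ _, ?_, ?_⟩
  · refine MeasurableSet.iInter fun k => MeasurableSet.iInter fun l => ?_
    have h0 : Measurable fun z : ℂ => zeta ^ (k : ℕ) * z + l := by fun_prop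
    simp only [orbitKey, Prod.Lex.le_iff, ofLex_toLex]
    have m1 : Measurable fun z : ℂ => ‖zeta ^ (k : ℕ) * z + l‖ := h0.norm
    have m2 : Measurable fun z : ℂ => (zeta ^ (k : ℕ) * z + l).re := Complex.measurable_re.comp h0
    have m3 : Measurable fun z : ℂ => (zeta ^ (k : ℕ) * z + l).im := Complex.measurable_im.comp h0
    refine (measurableSet_lt measurable_norm m1).union
      ((measurableSet_eq_fun measurable_norm m1).inter
      ((measurableSet_lt Complex.measurable_re m2).union
        ((measurableSet_eq_fun Complex.measurable_re m2).inter
          (measurableSet_le Complex.measurable_im m3))))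
  · have key : ∀ z w : ℂ, proj z = proj w →
        w ∈ ⋂ k : Fin 3, ⋂ l : lattice, {z | orbitKey z ≤ orbitKey (zeta ^ (k : ℕ) * z + l)} →
        orbitKey w ≤ orbitKey z := by
      intro z w h hw
      obtain ⟨k, hk, hl⟩ := proj_eq_iff.1 h
      have := mem_iInter.1 (mem_iInter.1 hw ⟨k, hk⟩) ⟨_, lattice.neg_mem hl⟩
      simpa using this
    intro z hz w hw h
    exact orbitKey_injective (le_antisymm (key w z h.symm hz) (key z w h hw))
  · intro p _
    obtain ⟨z, rfl⟩ := proj_surjective p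
    have hfin : {w | proj w = proj z ∧ ‖w‖ ≤ ‖z‖}.Finite := by
      refine ((finite_lattice_inter_closedBall (2 * ‖z‖)).biUnion fun l _ =>
        finite_range fun k : Fin 3 => zeta ^ (k : ℕ) * z - l).subset ?_
      rintro w ⟨hw, hn⟩
      obtain ⟨k, hk, hl⟩ := proj_eq_iff.1 hw
      refine mem_biUnion (x := zeta ^ k * z - w) ⟨hl, ?_⟩ ⟨⟨k, hk⟩, by simp⟩
      rw [mem_closedBall_zero_iff]
      refine (norm_sub_le _ _).trans ?_
      rw [norm_mul, norm_pow, norm_zeta, one_pow]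
      linarith
    obtain ⟨w, ⟨hw, hn⟩, hmin⟩ := hfin.exists_minimalFor orbitKey _ ⟨z, rfl, le_rfl⟩
    refine ⟨w, ?_, hw⟩
    refine mem_iInter.2 fun k => mem_iInter.2 fun l => ?_
    by_contra hlt
    rw [mem_ofPred_eq, not_le] at hlt
    have h1 : proj (zeta ^ (k : ℕ) * w + l) = proj z := (proj_affine k l.2 w).trans hw
    have h2 : ‖zeta ^ (k : ℕ) * w + l‖ ≤ ‖w‖ := by
      have := (Prod.Lex.le_iff.1 hlt.le)
      simp only [orbitKey, ofLex_toLex] at this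
      rcases this with h | h
      · exact h.le
      · exact h.1.le
    exact absurd (hmin ⟨h1, h2.trans hn⟩ hlt.le) (not_le.2 hlt)

theorem hasArea_crokeSphere : HasArea (2 * √3) :=
  ⟨exists_measurableSet_bijOn_proj, fun _ hm hD => volume_eq_of_bijOn_proj hm hD⟩

/-! ### The area of the capped metric -/

theorem areaMeasure_confMetric {v : E3 → ℝ} (hv : ContDiff ℝ ∞ v) :
    areaMeasure (confMetric v hv) = Measure.map (extChartAt (𝓡 2) basePoint).symm
      (volume.withDensity fun u =>
        ENNReal.ofReal (Real.exp (2 * chartPotential v basePoint u))) := by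
  unfold areaMeasure
  congr 2
  funext u
  rw [coeff_confMetric, Matrix.det_smul, Matrix.det_one, Fintype.card_fin, mul_one,
    Real.sqrt_sq (Real.exp_pos _).le]

theorem exp_two_mul_chartPotential (v : E3 → ℝ) (p : S2) (u : E2) :
    Real.exp (2 * chartPotential v p u) =
      Real.exp (2 * v (chartInv p u)) * (16 * (‖u‖ ^ 2 + 4)⁻¹ ^ 2) := by
  have h : 0 < 4 * (‖u‖ ^ 2 + 4)⁻¹ := by positivity
  rw [chartPotential, mul_add, Real.exp_add, two_mul (Real.log _), Real.exp_add, Real.exp_log h]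
  ring

/-- The developing map in the chart used for integration. -/
noncomputable def devChart (z : ℂ) : E2 := extChartAt (𝓡 2) basePoint (devMap z)

theorem mem_chart_source_iff {p x : S2} : x ∈ (chartAt E2 p).source ↔ x ≠ -p := by
  have := Fact.mk (@finrank_euclideanSpace_fin ℝ _ (2 + 1))
  have h : (chartAt (EuclideanSpace ℝ (Fin 2)) p).source = {-p}ᶜ :=
    stereographic'_source (n := 2) (-p)
  rw [h]
  rfl

theorem devMap_ne {z : ℂ} (hz : z ∉ lattice) : devMap z ≠ -basePoint := by
  rw [devMap_of_notMem hz]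
  exact stereoSphere_ne_neg_basePoint _

theorem extChartAt_symm_devChart {z : ℂ} (hz : z ∉ lattice) :
    (extChartAt (𝓡 2) basePoint).symm (devChart z) = devMap z := by
  refine (extChartAt (𝓡 2) basePoint).left_inv ?_
  rw [extChartAt_source, mem_chart_source_iff]
  exact devMap_ne hz

theorem chartInv_devChart {z : ℂ} (hz : z ∉ lattice) :
    chartInv basePoint (devChart z) = devMap z := by
  rw [← extChartAt_symm_devChart hz]
  exact (coe_extChartAt_symm basePoint _).symm

theorem differentiableAt_devChart {z : ℂ} (hz : z ∉ lattice) : DifferentiableAt ℝ devChart z := by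
  have h1 : ContMDiffAt 𝓘(ℝ, ℂ) (𝓡 2) ∞ devMap z :=
    contMDiffOn_devMap.contMDiffAt (isClosed_lattice.isOpen_compl.mem_nhds hz)
  have h2 : ContMDiffAt (𝓡 2) 𝓘(ℝ, E2) ∞ (extChartAt (𝓡 2) basePoint) (devMap z) :=
    contMDiffAt_extChartAt' (mem_chart_source_iff.2 (devMap_ne hz))
  exact (contMDiffAt_iff_contDiffAt.1 (h2.comp z h1)).differentiableAt (by simp)

open Filter Topology in
theorem inner_fderiv_devChart {z : ℂ} (hz : z ∉ lattice) (v w : ℂ) :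
    16 * (‖devChart z‖ ^ 2 + 4)⁻¹ ^ 2 * inner ℝ (fderiv ℝ devChart z v) (fderiv ℝ devChart z w) =
      4 / (1 + ‖unif z‖ ^ 2) ^ 2 * ‖unif' z‖ ^ 2 * inner ℝ v w := by
  have h1 := (hasFDerivAt_chartInv basePoint (devChart z)).comp z
    (differentiableAt_devChart hz).hasFDerivAt
  have h2 : (chartInv basePoint ∘ devChart) =ᶠ[𝓝 z] fun z => (devMap z : E3) := by
    filter_upwards [isClosed_lattice.isOpen_compl.mem_nhds hz] with w hw
    exact chartInv_devChart hw
  have h3 := h1.unique ((hasFDerivAt_devMap hz).congr_of_eventuallyEq h2)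
  have h4 : ∀ v, chartInvDeriv basePoint (devChart z) (fderiv ℝ devChart z v) =
      dstereo (unif z) (unif' z * v) := by
    intro v
    have := (congrArg (fun f => f v) h3).trans (fderiv_stereo _ _)
    refine this.trans (congrArg (dstereo (unif z)) ?_)
    exact mul_comm v (unif' z)
  rw [← inner_chartInvDeriv basePoint, h4, h4, inner_dstereo]
  have h5 : inner ℝ (unif' z * v) (unif' z * w) = ‖unif' z‖ ^ 2 * inner ℝ v w := by
    rw [Complex.inner, Complex.inner, map_mul, Complex.sq_norm, Complex.normSq_apply]
    simp
    ring
  have h6 : 1 + ((unif z).re ^ 2 + (unif z).im ^ 2) = 1 + ‖unif z‖ ^ 2 := by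
    rw [Complex.sq_norm, Complex.normSq_apply]; ring
  rw [h5, h6]
  ring

/-- The Jacobian of a conformal linear map. -/
theorem abs_det_eq_of_conformal {A : E2 →L[ℝ] E2} {c : ℝ} (hc : 0 ≤ c)
    (h : ∀ v w, inner ℝ (A v) (A w) = c * inner ℝ v w) : |A.det| = c := by
  set b := EuclideanSpace.basisFun (Fin 2) ℝ
  have h1 : A.det = (LinearMap.toMatrix b.toBasis b.toBasis (A : E2 →ₗ[ℝ] E2)).det :=
    (LinearMap.det_toMatrix b.toBasis _).symm
  have h2 : (LinearMap.toMatrix b.toBasis b.toBasis (A : E2 →ₗ[ℝ] E2)).transpose *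
      LinearMap.toMatrix b.toBasis b.toBasis (A : E2 →ₗ[ℝ] E2) = c • 1 := by
    ext i j
    have := h (EuclideanSpace.single i 1) (EuclideanSpace.single j 1)
    simp only [PiLp.inner_apply, Fin.sum_univ_two] at this
    rw [Matrix.mul_apply, Fin.sum_univ_two]
    simp only [Matrix.transpose_apply, LinearMap.toMatrix_apply]
    fin_cases i <;> fin_cases j <;> simpa [b, mul_comm, sq] using this
  have h3 := congrArg Matrix.det h2
  rw [Matrix.det_mul, Matrix.det_transpose, Matrix.det_smul, Matrix.det_one, Fintype.card_fin,
    ← h1] at h3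
  rw [← Real.sqrt_sq hc, ← Real.sqrt_sq_eq_abs]
  congr 1
  linarith

theorem devChart_injOn {D : Set ℂ} (hD : InjOn proj D) (hl : ∀ z ∈ D, z ∉ lattice) :
    InjOn devChart D := by
  intro z hz w hw h
  refine hD hz hw (devMap_eq_iff.1 ?_)
  rw [← extChartAt_symm_devChart (hl z hz), ← extChartAt_symm_devChart (hl w hw), h]

/-- The developing map carries a set of representatives onto the sphere up to finitely many
points. It is an isometry for the singular potential, which is at least the smoothed one; so the
area is at most that of the set of representatives. -/
theorem area_cappedMetric_le {ε : ℝ} (hε : 0 < ε) :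
    area (cappedMetric hε) ≤ ENNReal.ofReal (2 * √3) := by
  obtain ⟨D, hDm, hD⟩ := exists_measurableSet_bijOn_proj
  let e : ℂ ≃ₗᵢ[ℝ] E2 := Complex.orthonormalBasisOneI.repr
  set D' : Set ℂ := D \ coneSet with hD'
  have hD'm : MeasurableSet D' := hDm.diff countable_coneSet.measurableSet
  have hc : ∀ z ∈ D', z ∉ coneSet := fun z hz => hz.2
  have hl : ∀ z ∈ D', z ∉ lattice := fun z hz => notMem_lattice_of_notMem_coneSet hz.2
  set f : E2 → E2 := devChart ∘ e.symm with hf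
  set S : Set E2 := e.symm ⁻¹' D' with hS
  have hSm : MeasurableSet S := e.symm.continuous.measurable hD'm
  have hSD : volume S ≤ ENNReal.ofReal (2 * √3) := by
    rw [← volume_eq_of_bijOn_proj hDm hD]
    rw [hS, e.symm.measurePreserving.measure_preimage hD'm.nullMeasurableSet]
    exact measure_mono sdiff_subset
  have hinj : InjOn f S := fun u hu u' hu' h => e.symm.injective
    (devChart_injOn (hD.injOn.mono sdiff_subset) hl hu hu' h)
  set f' : E2 → E2 →L[ℝ] E2 := fun u =>
    (fderiv ℝ devChart (e.symm u)).comp (e.symm : E2 →L[ℝ] ℂ) with hf'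
  have hfd : ∀ u ∈ S, HasFDerivWithinAt f (f' u) S u := fun u hu =>
    ((differentiableAt_devChart (hl _ hu)).hasFDerivAt.comp u
      (e.symm : E2 →L[ℝ] ℂ).hasFDerivAt).hasFDerivWithinAt
  -- the image omits at most the images of the three poles
  have himg : volume (f '' S)ᶜ = 0 := by
    have hfin : ((fun i => extChartAt (𝓡 2) basePoint (poleSphere i)) '' univ).Finite :=
      finite_univ.image _
    refine measure_mono_null ?_ (hfin.measure_zero volume)
    intro u hu
    by_contra hu2
    apply hu
    obtain ⟨z, hz, hzu⟩ := hD.surjOn (mem_univ (proj (Function.surjInv devMap_surjective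
      ((extChartAt (𝓡 2) basePoint).symm u))))
    have hzu' : devMap z = (extChartAt (𝓡 2) basePoint).symm u := by
      rw [devMap_eq_iff.2 hzu]
      exact Function.surjInv_eq devMap_surjective _
    have hdu : devChart z = u := by
      rw [devChart, hzu']
      exact (extChartAt (𝓡 2) basePoint).right_inv (by rw [extChartAt_target_eq]; trivial)
    refine ⟨e z, ?_, by simp [hf, hdu]⟩
    rw [hS, mem_preimage, e.symm_apply_apply]
    refine ⟨hz, fun hcone => hu2 ?_⟩
    obtain ⟨i, hi⟩ := mem_coneSet_iff_devMap.1 hcone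
    exact ⟨i, mem_univ i, (congrArg _ hi.symm).trans hdu⟩
  -- the pulled back area density is at most that of the plane
  have hdens : ∀ u ∈ S, ENNReal.ofReal |(f' u).det| * ENNReal.ofReal
      (Real.exp (2 * chartPotential (potential ε) basePoint (f u))) ≤ 1 := by
    intro u hu
    have hz := hl _ hu
    set z := e.symm u with hz'
    have hA := inner_fderiv_devChart hz
    set a := 16 * (‖devChart z‖ ^ 2 + 4)⁻¹ ^ 2 with ha
    have ha0 : 0 < a := by positivity
    set b := 4 / (1 + ‖unif z‖ ^ 2) ^ 2 * ‖unif' z‖ ^ 2 with hb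
    have hdet : |(f' u).det| = b / a := by
      refine abs_det_eq_of_conformal (by positivity) fun v w => ?_
      have := hA (e.symm v) (e.symm w)
      rw [e.symm.inner_map_map] at this
      rw [div_mul_eq_mul_div, eq_div_iff ha0.ne', ← this]
      change inner ℝ (fderiv ℝ devChart z (e.symm v)) (fderiv ℝ devChart z (e.symm w)) * a = _
      ring
    rw [← ENNReal.ofReal_mul (abs_nonneg _), hdet, exp_two_mul_chartPotential]
    have hfu : f u = devChart z := rfl
    rw [hfu, chartInv_devChart hz, ← ha, ENNReal.ofReal_le_one]
    have hpos : ∀ i, 0 < chord i (devMap z) := fun i => chord_pos_iff.2 fun h =>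
      hc _ hu (mem_coneSet_iff_devMap.2 ⟨i, h⟩)
    have h1 := exp_flat_mul hz (unif_sq_ne_one (hc _ hu))
    rw [← coe_devMap hz, ← hb] at h1
    have h2 := Real.exp_le_exp.2 (mul_le_mul_of_nonneg_left (potential_le hε hpos) zero_le_two)
    calc b / a * (Real.exp (2 * potential ε (devMap z)) * a)
        = Real.exp (2 * potential ε (devMap z)) * b := by field_simp
      _ ≤ _ := mul_le_mul_of_nonneg_right h2 (by positivity)
      _ = 1 := h1
  rw [area, cappedMetric, areaMeasure_confMetric,
    Measure.map_apply (continuous_chart_symm _).measurable MeasurableSet.univ, preimage_univ,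
    withDensity_apply _ MeasurableSet.univ, Measure.restrict_univ]
  calc ∫⁻ u, ENNReal.ofReal (Real.exp (2 * chartPotential (potential ε) basePoint u))
      = ∫⁻ u in f '' S,
          ENNReal.ofReal (Real.exp (2 * chartPotential (potential ε) basePoint u)) := by
        rw [Measure.restrict_eq_self_of_ae_mem]
        exact himg
    _ = ∫⁻ u in S, ENNReal.ofReal |(f' u).det| * ENNReal.ofReal
          (Real.exp (2 * chartPotential (potential ε) basePoint (f u))) :=
        lintegral_image_eq_lintegral_abs_det_fderiv_mul volume hSm hfd hinj _
    _ ≤ ∫⁻ u in S, 1 := setLIntegral_mono' hSm hdens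
    _ = volume S := by simp
    _ ≤ _ := hSD

/-! ### The first eigenvalue -/

instance {ε : ℝ} (hε : 0 < ε) : IsFiniteMeasure (areaMeasure (cappedMetric hε)) :=
  ⟨(area_cappedMetric_le hε).trans_lt ENNReal.ofReal_lt_top⟩

theorem contDiff_exp_chartPotential {v : E3 → ℝ} (hv : ContDiff ℝ ∞ v) (p : S2) :
    ContDiff ℝ ∞ fun u => Real.exp (2 * chartPotential v p u) :=
  (contDiff_const.mul (contDiff_chartPotential hv p)).exp

theorem integrable_areaMeasure_iff {v : E3 → ℝ} (hv : ContDiff ℝ ∞ v) {h : S2 → ℝ}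
    (hh : Continuous h) : Integrable h (areaMeasure (confMetric v hv)) ↔
      Integrable fun u => Real.exp (2 * chartPotential v basePoint u) *
        h ((extChartAt (𝓡 2) basePoint).symm u) := by
  rw [areaMeasure_confMetric, integrable_map_measure hh.aestronglyMeasurable
    (continuous_chart_symm _).aemeasurable, integrable_withDensity_iff_integrable_smul₀'
    (contDiff_exp_chartPotential hv _).continuous.measurable.ennreal_ofReal.aemeasurable
    (Filter.Eventually.of_forall fun _ => ENNReal.ofReal_lt_top)]
  simp only [ENNReal.toReal_ofReal (Real.exp_pos _).le]
  rfl

theorem integral_areaMeasure {v : E3 → ℝ} (hv : ContDiff ℝ ∞ v) {h : S2 → ℝ} (hh : Continuous h) :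
    ∫ p, h p ∂(areaMeasure (confMetric v hv)) =
      ∫ u, Real.exp (2 * chartPotential v basePoint u) *
        h ((extChartAt (𝓡 2) basePoint).symm u) := by
  rw [areaMeasure_confMetric, integral_map (continuous_chart_symm _).aemeasurable
    hh.aestronglyMeasurable, integral_withDensity_eq_integral_toReal_smul₀
    (contDiff_exp_chartPotential hv _).continuous.measurable.ennreal_ofReal.aemeasurable
    (Filter.Eventually.of_forall fun _ => ENNReal.ofReal_lt_top)]
  simp only [ENNReal.toReal_ofReal (Real.exp_pos _).le]
  rfl

/-- A conformal linear map is, up to scaling, orthogonal, so it preserves the squared norm of a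
linear form up to the same factor. -/
theorem sum_sq_comp_conformal {A : E2 →L[ℝ] E2} {c : ℝ} (hc : c ≠ 0)
    (h : ∀ v w, inner ℝ (A v) (A w) = c * inner ℝ v w) (l : E2 →L[ℝ] ℝ) :
    ∑ i, l (A (EuclideanSpace.single i 1)) ^ 2 = c * ∑ i, l (EuclideanSpace.single i 1) ^ 2 := by
  let M : Matrix (Fin 2) (Fin 2) ℝ := Matrix.of fun i j => A (EuclideanSpace.single j 1) i
  have h2 : (c⁻¹ • M.transpose) * M = 1 := by
    rw [Matrix.smul_mul, inv_smul_eq_iff₀ hc]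
    ext i j
    have := h (EuclideanSpace.single i 1) (EuclideanSpace.single j 1)
    simp only [PiLp.inner_apply, Fin.sum_univ_two] at this
    rw [Matrix.mul_apply, Fin.sum_univ_two]
    fin_cases i <;> fin_cases j <;> simpa [M, mul_comm, sq] using this
  have h3 := mul_eq_one_comm.1 h2
  rw [Matrix.mul_smul, inv_smul_eq_iff₀ hc] at h3
  have e00 := congrFun (congrFun h3 0) 0
  have e01 := congrFun (congrFun h3 0) 1
  have e11 := congrFun (congrFun h3 1) 1
  simp [Matrix.mul_apply, M] at e00 e01 e11
  have hl : ∀ w : E2, l w =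
      w 0 * l (EuclideanSpace.single 0 1) + w 1 * l (EuclideanSpace.single 1 1) := by
    intro w
    rw [← smul_eq_mul, ← smul_eq_mul, ← map_smul, ← map_smul, ← map_add]
    congr 1
    ext i
    fin_cases i <;> simp
  rw [Fin.sum_univ_two, Fin.sum_univ_two, hl (A (EuclideanSpace.single 0 1)),
    hl (A (EuclideanSpace.single 1 1))]
  linear_combination l (EuclideanSpace.single 0 1) ^ 2 * e00
    + 2 * l (EuclideanSpace.single 0 1) * l (EuclideanSpace.single 1 1) * e01
    + l (EuclideanSpace.single 1 1) ^ 2 * e11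

theorem extChartAt_symm_extChartAt {p x : S2} (h : x ∈ (chartAt E2 p).source) :
    (extChartAt (𝓡 2) p).symm (extChartAt (𝓡 2) p x) = x :=
  (extChartAt (𝓡 2) p).left_inv (by rwa [extChartAt_source])

open Filter Topology in
/-- The squared gradient in an arbitrary chart. -/
theorem gradSq_confMetric {v : E3 → ℝ} (hv : ContDiff ℝ ∞ v) {f : S2 → ℝ}
    (hf : ContMDiff (𝓡 2) 𝓘(ℝ) ∞ f) (p₀ : S2) (u : E2) :
    gradSq (confMetric v hv) f ((extChartAt (𝓡 2) p₀).symm u) =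
      Real.exp (-(2 * chartPotential v p₀ u)) *
        ∑ i, pd i (f ∘ (extChartAt (𝓡 2) p₀).symm) u ^ 2 := by
  set p := (extChartAt (𝓡 2) p₀).symm u with hp
  set F := f ∘ (extChartAt (𝓡 2) p₀).symm with hF
  have hFd : ContDiff ℝ ∞ F :=
    contMDiff_iff_contDiff.1 (hf.comp (contMDiff_extChartAt_symm p₀))
  set τ : E2 → E2 := fun y => extChartAt (𝓡 2) p₀ ((extChartAt (𝓡 2) p).symm y) with hτ
  have hps : p ∈ (chartAt E2 p₀).source := by
    rw [← extChartAt_source (𝓡 2)]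
    exact (extChartAt (𝓡 2) p₀).map_target (by rw [extChartAt_target_eq]; trivial)
  have hτ0 : τ 0 = u := by
    rw [hτ]
    simp only [extChartAt_symm_zero]
    exact (extChartAt (𝓡 2) p₀).right_inv (by rw [extChartAt_target_eq]; trivial)
  have hτd : DifferentiableAt ℝ τ 0 := by
    have h1 : ContMDiffAt 𝓘(ℝ, E2) (𝓡 2) ∞ (extChartAt (𝓡 2) p).symm 0 :=
      contMDiff_extChartAt_symm p 0
    have h2 : ContMDiffAt (𝓡 2) 𝓘(ℝ, E2) ∞ (extChartAt (𝓡 2) p₀)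
        ((extChartAt (𝓡 2) p).symm 0) := by
      rw [extChartAt_symm_zero]
      exact contMDiffAt_extChartAt' hps
    exact (contMDiffAt_iff_contDiffAt.1 (h2.comp 0 h1)).differentiableAt (by simp)
  have hev : ∀ᶠ y in 𝓝 (0 : E2),
      (extChartAt (𝓡 2) p₀).symm (τ y) = (extChartAt (𝓡 2) p).symm y := by
    have : ∀ᶠ y in 𝓝 (0 : E2), (extChartAt (𝓡 2) p).symm y ∈ (chartAt E2 p₀).source := by
      refine (continuous_chart_symm p).continuousAt.eventually_mem ?_
      rw [extChartAt_symm_zero]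
      exact (chartAt E2 p₀).open_source.mem_nhds hps
    filter_upwards [this] with y hy
    exact extChartAt_symm_extChartAt hy
  set A := fderiv ℝ τ 0 with hA
  have hconf : ∀ x y, inner ℝ (A x) (A y) = ((‖u‖ ^ 2 + 4) ^ 2 / 16) * inner ℝ x y := by
    have h1 := (hasFDerivAt_chartInv p₀ (τ 0)).comp 0 hτd.hasFDerivAt
    have h2 : (chartInv p₀ ∘ τ) =ᶠ[𝓝 0] chartInv p := by
      filter_upwards [hev] with y hy
      rw [← coe_comp_extChartAt_symm, ← coe_comp_extChartAt_symm, Function.comp_apply,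
        Function.comp_apply, Function.comp_apply, hy]
    have h3 := h1.unique ((hasFDerivAt_chartInv p 0).congr_of_eventuallyEq h2)
    rw [hτ0] at h3
    intro x y
    have h4 := inner_chartInvDeriv p 0 x y
    rw [← h3] at h4
    have h5 := (inner_chartInvDeriv p₀ u (A x) (A y)).symm.trans h4
    norm_num at h5
    rw [← h5]
    field_simp
  have hpd : ∀ i, pd i (f ∘ (extChartAt (𝓡 2) p).symm) 0 =
      fderiv ℝ F u (A (EuclideanSpace.single i 1)) := by
    intro i
    have h1 : (f ∘ (extChartAt (𝓡 2) p).symm) =ᶠ[𝓝 0] F ∘ τ := by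
      filter_upwards [hev] with y hy
      rw [hF, Function.comp_apply, Function.comp_apply, Function.comp_apply, hy]
    have h2 := (hFd.differentiable (by simp) (τ 0)).hasFDerivAt.comp 0 hτd.hasFDerivAt
    rw [pd, (h2.congr_of_eventuallyEq h1).fderiv, hτ0]
    rfl
  have hsum := sum_sq_comp_conformal (by positivity) hconf (fderiv ℝ F u)
  have hpot : chartPotential v p 0 = v p := by
    rw [chartPotential]
    have : chartInv p 0 = p := by
      rw [← coe_comp_extChartAt_symm, Function.comp_apply, extChartAt_symm_zero]
    rw [this]
    norm_num
  have hvp : v (chartInv p₀ u) = v p := by rw [← coe_comp_extChartAt_symm]; rfl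
  rw [gradSq, extChartAt_self]
  simp only [coeff_confMetric, hpot, hpd]
  have hinv : (Real.exp (2 * v p) • (1 : Matrix (Fin 2) (Fin 2) ℝ))⁻¹ =
      Real.exp (-(2 * v p)) • (1 : Matrix (Fin 2) (Fin 2) ℝ) := by
    apply Matrix.inv_eq_left_inv
    rw [Matrix.smul_mul, Matrix.mul_smul, smul_smul, ← Real.exp_add]
    simp
  rw [hinv]
  have h1 : ∑ i, ∑ j, (Real.exp (-(2 * v p)) • (1 : Matrix (Fin 2) (Fin 2) ℝ)) i j *
      fderiv ℝ F u (A (EuclideanSpace.single i 1)) * fderiv ℝ F u (A (EuclideanSpace.single j 1)) =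
      Real.exp (-(2 * v p)) * ∑ i, fderiv ℝ F u (A (EuclideanSpace.single i 1)) ^ 2 := by
    simp [Fin.sum_univ_two]
    ring
  rw [h1, hsum, Real.exp_neg (2 * chartPotential v p₀ u), exp_two_mul_chartPotential, hvp,
    Real.exp_neg]
  simp only [pd]
  field_simp

open Filter Topology in
theorem continuous_gradSq_confMetric {v : E3 → ℝ} (hv : ContDiff ℝ ∞ v) {f : S2 → ℝ}
    (hf : ContMDiff (𝓡 2) 𝓘(ℝ) ∞ f) : Continuous (gradSq (confMetric v hv) f) := by
  rw [continuous_iff_continuousAt]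
  intro p
  set F := f ∘ (extChartAt (𝓡 2) p).symm with hF
  have hFd : ContDiff ℝ ∞ F :=
    contMDiff_iff_contDiff.1 (hf.comp (contMDiff_extChartAt_symm p))
  have h1 : Continuous fun u => Real.exp (-(2 * chartPotential v p u)) * ∑ i, pd i F u ^ 2 := by
    refine (Real.continuous_exp.comp
      (continuous_const.mul (contDiff_chartPotential hv p).continuous).neg).mul ?_
    exact continuous_finsetSum _ fun i _ => (contDiff_pd hFd i).continuous.pow 2
  have h2 : gradSq (confMetric v hv) f =ᶠ[𝓝 p]
      (fun u => Real.exp (-(2 * chartPotential v p u)) * ∑ i, pd i F u ^ 2) ∘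
        extChartAt (𝓡 2) p := by
    filter_upwards [(chartAt E2 p).open_source.mem_nhds (mem_chart_source E2 p)] with x hx
    rw [Function.comp_apply, ← gradSq_confMetric hv hf, extChartAt_symm_extChartAt hx]
  exact (h1.continuousAt.comp (continuousAt_extChartAt p)).congr h2.symm

theorem continuous_gaussCurvature_cappedMetric {ε : ℝ} (hε : 0 < ε) :
    Continuous (gaussCurvature (cappedMetric hε)) := by
  have h : gaussCurvature (cappedMetric hε) = fun p : S2 => Real.exp (-(2 * potential ε p)) *
      (1 + (1 / 3) * ∑ i,
        (-cutoff ε (chord i p) + (4 - chord i p) * deriv (cutoff ε) (chord i p))) := by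
    funext p
    rw [gaussCurvature_cappedMetric]
    simp only [deriv_chordal_smoothLog hε]
  rw [h]
  have h1 : Continuous fun p : S2 => potential ε p :=
    (contDiff_potential hε).continuous.comp continuous_subtype_val
  have h2 := (contDiff_cutoff ε).continuous
  have h3 := (contDiff_infty_iff_deriv.1 (contDiff_cutoff ε)).2.continuous
  have h4 := continuous_chord
  fun_prop

/-- A compactly supported vector field which is the position vector on a ball. -/
theorem exists_position_field {R : ℝ} (hR : 0 < R) :
    ∃ X : Fin 2 → E2 → ℝ, (∀ i, ContDiff ℝ ∞ (X i)) ∧ (∀ i, HasCompactSupport (X i)) ∧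
      (∀ i u, ‖u‖ < R → X i u = u i ∧ pd i (X i) u = 1) := by
  let χ : ContDiffBump (0 : E2) := ⟨R, 2 * R, hR, by linarith⟩
  have hcoord : ∀ i : Fin 2, ContDiff ℝ ∞ fun u : E2 => u i := fun i => by fun_prop
  have hX : ∀ i : Fin 2, ∀ u : E2, ‖u‖ < R → χ u * u i = u i := by
    intro i u hu
    rw [χ.one_of_mem_closedBall (by simpa using hu.le), one_mul]
  refine ⟨fun i u => χ u * u i, fun i => χ.contDiff.mul (hcoord i),
    fun i => χ.hasCompactSupport.mul_right, fun i u hu => ⟨hX i u hu, ?_⟩⟩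
  have hev : (fun u : E2 => χ u * u i) =ᶠ[nhds u] fun u : E2 => u i := by
    filter_upwards [(isOpen_lt continuous_norm continuous_const).mem_nhds hu] with y hy
    exact hX i y hy
  have h2 : HasFDerivAt (fun u : E2 => u i) (EuclideanSpace.proj i : E2 →L[ℝ] ℝ) u :=
    (EuclideanSpace.proj i : E2 →L[ℝ] ℝ).hasFDerivAt
  rw [pd, hev.fderiv_eq, h2.fderiv]
  simp

theorem integrable_sq_mul {X : Fin 2 → E2 → ℝ} (hX : ∀ i, ContDiff ℝ ∞ (X i))
    (hs : ∀ i, HasCompactSupport (X i)) {F : E2 → ℝ} (hF : ContDiff ℝ ∞ F) (i : Fin 2) :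
    Integrable fun u => X i u ^ 2 * F u ^ 2 := by
  have h : HasCompactSupport fun u => X i u * (X i u * F u ^ 2) := (hs i).mul_right
  have h2 : (fun u => X i u ^ 2 * F u ^ 2) = fun u => X i u * (X i u * F u ^ 2) := by
    funext u; ring
  rw [h2]
  exact ((hX i).continuous.mul ((hX i).continuous.mul
    (hF.continuous.pow 2))).integrable_of_hasCompactSupport h

theorem integrable_pd_mul {X : Fin 2 → E2 → ℝ} (hX : ∀ i, ContDiff ℝ ∞ (X i))
    (hs : ∀ i, HasCompactSupport (X i)) {F : E2 → ℝ} (hF : ContDiff ℝ ∞ F) (i : Fin 2) :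
    Integrable fun u => pd i (X i) u * F u ^ 2 := by
  have h : HasCompactSupport (pd i (X i)) := (hs i).fderiv_apply (𝕜 := ℝ) _
  exact ((contDiff_pd (hX i) i).continuous.mul
    (hF.continuous.pow 2)).integrable_of_hasCompactSupport h.mul_right

/-- Completing the square and integrating by parts against a compactly supported field. -/
theorem integral_field_le {X : Fin 2 → E2 → ℝ} (hX : ∀ i, ContDiff ℝ ∞ (X i))
    (hs : ∀ i, HasCompactSupport (X i)) {F : E2 → ℝ} (hF : ContDiff ℝ ∞ F)
    (hint : Integrable fun u => ∑ i, pd i F u ^ 2) :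
    ∫ u, (∑ i, (pd i (X i) u - X i u ^ 2)) * F u ^ 2 ≤ ∫ u, ∑ i, pd i F u ^ 2 := by
  have hcF : ∀ i, Continuous (pd i F) := fun i => (contDiff_pd hF i).continuous
  have i1 := integrable_pd_mul hX hs hF
  have i2 : ∀ i, Integrable fun u => X i u * (2 * F u * pd i F u) := fun i =>
    ((hX i).continuous.mul ((continuous_const.mul hF.continuous).mul (hcF i))
      ).integrable_of_hasCompactSupport (hs i).mul_right
  have i3 := integrable_sq_mul hX hs hF
  have hparts : ∀ i, ∫ u, X i u * (2 * F u * pd i F u) = -∫ u, pd i (X i) u * F u ^ 2 := by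
    intro i
    have hd : ∀ u, fderiv ℝ (fun u => F u ^ 2) u (EuclideanSpace.single i 1) =
        2 * F u * pd i F u := by
      intro u
      have := ((hF.differentiable (by simp) u).hasFDerivAt.pow 2).fderiv
      rw [this]
      simp [pd]
    have := integral_mul_fderiv_eq_neg_fderiv_mul_of_integrable (μ := volume) (f := X i)
      (g := fun u => F u ^ 2) (v := EuclideanSpace.single i 1) (i1 i)
      (by simpa only [hd] using i2 i)
      (((hX i).continuous.mul (hF.continuous.pow 2)).integrable_of_hasCompactSupport
        (hs i).mul_right)
      (fun u _ => (hX i).differentiable (by simp) u)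
      (fun u _ => (hF.pow 2).differentiable (by simp) u)
    simp only [hd] at this
    exact this
  have e1 : ∫ u, (∑ i, (pd i (X i) u - X i u ^ 2)) * F u ^ 2 =
      ∫ u, ∑ i, (-(X i u * (2 * F u * pd i F u)) - X i u ^ 2 * F u ^ 2) := by
    have i5 : ∀ i, Integrable fun u => -(X i u * (2 * F u * pd i F u)) - X i u ^ 2 * F u ^ 2 :=
      fun i => (i2 i).neg.sub (i3 i)
    have i6 : ∀ i, Integrable fun u => pd i (X i) u * F u ^ 2 - X i u ^ 2 * F u ^ 2 :=
      fun i => (i1 i).sub (i3 i)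
    rw [integral_finsetSum _ fun i _ => i5 i]
    simp only [Finset.sum_mul, sub_mul]
    rw [integral_finsetSum _ fun i _ => i6 i]
    refine Finset.sum_congr rfl fun i _ => ?_
    rw [integral_sub (i1 i) (i3 i), integral_sub (by exact (i2 i).neg) (i3 i)]
    have : ∫ u, -(X i u * (2 * F u * pd i F u)) = ∫ u, pd i (X i) u * F u ^ 2 := by
      rw [integral_neg, hparts, neg_neg]
    rw [this]
  rw [e1]
  refine integral_mono (integrable_finsetSum _ fun i _ => (i2 i).neg.sub (i3 i)) hint fun u => ?_
  refine Finset.sum_le_sum fun i _ => ?_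
  simp only
  nlinarith [sq_nonneg (pd i F u + X i u * F u)]

/-- A nonnegative potential which is positive near infinity, in the plane with a finite conformal
weight, can be improved by the divergence of a field to a potential with a positive lower bound. -/
theorem exists_improved_potential {w κ : E2 → ℝ} (hw : Continuous w)
    (hκ : ∀ u, 0 ≤ κ u) {R k : ℝ} (hR : 0 < R) (hk : 0 < k)
    (hκR : ∀ u, R ≤ ‖u‖ → k ≤ κ u) (hwpos : ∀ u, 0 < w u) :
    ∃ X : Fin 2 → E2 → ℝ, (∀ i, ContDiff ℝ ∞ (X i)) ∧ (∀ i, HasCompactSupport (X i)) ∧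
      ∃ c > 0, ∀ u, c * w u ≤ (∑ i, (pd i (X i) u - X i u ^ 2)) + w u * κ u := by
  obtain ⟨X, hX, hs, hXR⟩ := exists_position_field hR
  have hpX : ∀ i, HasCompactSupport (pd i (X i)) := fun i => (hs i).fderiv_apply (𝕜 := ℝ) _
  have hcX : ∀ i, Continuous (pd i (X i)) := fun i => (contDiff_pd (hX i) i).continuous
  -- bounds for the field and its derivative, and for the weight on the supports
  have hbd : ∃ C, 0 < C ∧ ∀ u, |∑ i, pd i (X i) u| ≤ C * w u ∧ ∑ i, X i u ^ 2 ≤ C * w u := by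
    set K := ⋃ i, (tsupport (X i) ∪ tsupport (pd i (X i))) with hK
    have hKc : IsCompact K := isCompact_iUnion fun i => (hs i).isCompact.union (hpX i).isCompact
    have hfc : Continuous fun u => (|∑ i, pd i (X i) u| + ∑ i, X i u ^ 2) / w u := by
      refine Continuous.div ?_ hw fun u => (hwpos u).ne'
      have := fun i => (hX i).continuous
      fun_prop
    obtain ⟨C, hC⟩ := hKc.bddAbove_image hfc.continuousOn
    refine ⟨max C 1, by positivity, fun u => ?_⟩
    by_cases hu : u ∈ K
    · have h1 := hC (mem_image_of_mem _ hu)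
      rw [div_le_iff₀ (hwpos u)] at h1
      have h2 : C * w u ≤ max C 1 * w u := by gcongr; exacts [(hwpos u).le, le_max_left _ _]
      have h3 : 0 ≤ ∑ i, X i u ^ 2 := by positivity
      have h4 := abs_nonneg (∑ i, pd i (X i) u)
      constructor <;> linarith
    · have h0 : ∀ i, X i u = 0 ∧ pd i (X i) u = 0 := fun i =>
        ⟨image_eq_zero_of_notMem_tsupport fun h => hu (mem_iUnion.2 ⟨i, Or.inl h⟩),
          image_eq_zero_of_notMem_tsupport fun h => hu (mem_iUnion.2 ⟨i, Or.inr h⟩)⟩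
      have : 0 ≤ max C 1 * w u := by have := hwpos u; positivity
      simp only [h0]
      simpa using this
  obtain ⟨C, hC, hbd⟩ := hbd
  obtain ⟨W, hW⟩ := (isCompact_closedBall (0 : E2) R).bddAbove_image hw.continuousOn
  -- the field is scaled down until its bad part is absorbed by the potential
  set η := min (min 1 (1 / R ^ 2)) (k / (4 * C)) with hη
  have hη0 : 0 < η := by positivity
  have hη1 : η ≤ 1 := (min_le_left _ _).trans (min_le_left _ _)
  have hη2 : η * R ^ 2 ≤ 1 := by
    have : η ≤ 1 / R ^ 2 := (min_le_left _ _).trans (min_le_right _ _)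
    rwa [le_div_iff₀ (by positivity)] at this
  have hη3 : η * C ≤ k / 4 := by
    have : η ≤ k / (4 * C) := min_le_right _ _
    rw [le_div_iff₀ (by positivity)] at this
    linarith
  have hpdη : ∀ i u, pd i (fun u => η * X i u) u = η * pd i (X i) u := by
    intro i u
    rw [pd, fderiv_const_mul ((hX i).differentiable (by simp) u)]
    rfl
  refine ⟨fun i u => η * X i u, fun i => contDiff_const.mul (hX i), fun i => (hs i).mul_left,
    min (η / max W 1) (k / 2), by positivity, fun u => ?_⟩
  have e : ∑ i, (pd i (fun u => η * X i u) u - (η * X i u) ^ 2) =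
      η * ∑ i, pd i (X i) u - η ^ 2 * ∑ i, X i u ^ 2 := by
    simp only [hpdη, Finset.mul_sum, ← Finset.sum_sub_distrib]
    exact Finset.sum_congr rfl fun i _ => by ring
  rw [e]
  have hwu := hwpos u
  by_cases hu : ‖u‖ < R
  · have h1 : ∑ i, pd i (X i) u = 2 := by
      rw [Fin.sum_univ_two, (hXR 0 u hu).2, (hXR 1 u hu).2]; norm_num
    have h2 : ∑ i, X i u ^ 2 = ‖u‖ ^ 2 := by
      rw [EuclideanSpace.norm_sq_eq]
      exact Finset.sum_congr rfl fun i _ => by rw [(hXR i u hu).1, Real.norm_eq_abs, sq_abs]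
    have h3 : w u ≤ max W 1 :=
      (hW (mem_image_of_mem _ (by simpa using hu.le))).trans (le_max_left _ _)
    have h4 : min (η / max W 1) (k / 2) * w u ≤ η := by
      calc _ ≤ (η / max W 1) * max W 1 := by gcongr; exact min_le_left _ _
        _ = η := by field_simp
    have h5 : η ^ 2 * ‖u‖ ^ 2 ≤ η := by
      have : ‖u‖ ^ 2 ≤ R ^ 2 := by gcongr
      calc η ^ 2 * ‖u‖ ^ 2 ≤ η ^ 2 * R ^ 2 := by gcongr
        _ = η * (η * R ^ 2) := by ring
        _ ≤ η * 1 := by gcongr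
        _ = η := mul_one η
    have h6 := mul_nonneg hwu.le (hκ u)
    rw [h1, h2]
    linarith
  · have h1 := hκR u (not_lt.1 hu)
    have h2 := (abs_le.1 (hbd u).1).1
    have h3 := (hbd u).2
    have h4 : min (η / max W 1) (k / 2) * w u ≤ k / 2 * w u := by gcongr; exact min_le_right _ _
    have h5 : -(k / 4 * w u) ≤ η * ∑ i, pd i (X i) u := by
      have := mul_le_mul_of_nonneg_left h2 hη0.le
      have := mul_le_mul_of_nonneg_right hη3 hwu.le
      linarith
    have h6 : η ^ 2 * ∑ i, X i u ^ 2 ≤ k / 4 * w u := by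
      have h7 : 0 ≤ C * w u := by positivity
      calc η ^ 2 * ∑ i, X i u ^ 2 ≤ η ^ 2 * (C * w u) := by gcongr
        _ = η * (η * C * w u) := by ring
        _ ≤ 1 * (k / 4 * w u) := by gcongr
        _ = _ := one_mul _
    have h8 : w u * k ≤ w u * κ u := by gcongr
    linarith

theorem chord_zero_chartInv (u : E2) :
    chord 0 (chartInv basePoint u) = 16 / (‖u‖ ^ 2 + 4) := by
  have h1 : pole 0 = -(basePoint : E3) := by rw [← coe_neg_basePoint]; rfl
  have h2 : inner ℝ (basePoint : E3) (basePoint : E3) = (1 : ℝ) := by simp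
  rw [chord, real_inner_comm, inner_chartInv, h1, inner_neg_right,
    real_inner_comm, inner_tangentEmb_self, inner_neg_right, h2]
  field_simp
  ring

/-- In the chart at `basePoint` the Dirichlet integral is that of the plane, and the curvature is
bounded below near infinity. By `integral_field_le` a vector field trades some of the Dirichlet
integral for a zeroth order term, and `exists_improved_potential` chooses it so that this term and
the curvature dominate a multiple of the area density. -/
theorem firstEigenvalue_cappedMetric_pos {ε : ℝ} (hε : 0 < ε) :
    0 < firstEigenvalue (cappedMetric hε) := by
  have hv := contDiff_potential hε
  set w : E2 → ℝ := fun u => Real.exp (2 * chartPotential (potential ε) basePoint u) with hw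
  set κ : E2 → ℝ := fun u => gaussCurvature (cappedMetric hε) ((extChartAt (𝓡 2) basePoint).symm u)
    with hκ
  have hwc : Continuous w := (contDiff_exp_chartPotential hv basePoint).continuous
  have hKc := continuous_gaussCurvature_cappedMetric hε
  -- an upper bound for the potential
  obtain ⟨V, hV⟩ : ∃ V, ∀ p : S2, potential ε p ≤ V := by
    obtain ⟨V, hV⟩ := (isCompact_univ (X := S2)).bddAbove_image
      (hv.continuous.comp continuous_subtype_val).continuousOn
    exact ⟨V, fun p => hV (mem_image_of_mem _ (mem_univ p))⟩
  have hκR : ∀ u, √(32 / ε) ≤ ‖u‖ → Real.exp (-(2 * V)) / 3 ≤ κ u := by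
    intro u hu
    have h1 : 32 / ε ≤ ‖u‖ ^ 2 := (Real.sqrt_le_left (norm_nonneg u)).1 hu
    have h2 : chord 0 ((extChartAt (𝓡 2) basePoint).symm u) < ε / 2 := by
      have := chord_zero_chartInv u
      rw [← coe_comp_extChartAt_symm] at this
      refine this.trans_lt ?_
      rw [div_lt_iff₀ (by positivity)]
      rw [div_le_iff₀ hε] at h1
      nlinarith
    refine le_trans ?_ (le_gaussCurvature_cappedMetric hε h2)
    have := hV ((extChartAt (𝓡 2) basePoint).symm u)
    gcongr
  obtain ⟨X, hX, hs, c, hc, hXc⟩ := exists_improved_potential (R := √(32 / ε)) hwc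
    (fun u => gaussCurvature_cappedMetric_nonneg hε _)
    (by positivity) (by positivity) hκR (fun u => Real.exp_pos _)
  refine hc.trans_le (le_csInf ?_ ?_)
  · exact ⟨_, fun _ => 1, contMDiff_const, fun h => by simpa using congrFun h basePoint, rfl⟩
  · rintro q ⟨f, hf, hf0, rfl⟩
    set F := f ∘ (extChartAt (𝓡 2) basePoint).symm with hF
    have hFd : ContDiff ℝ ∞ F :=
      contMDiff_iff_contDiff.1 (hf.comp (contMDiff_extChartAt_symm basePoint))
    have hgc := continuous_gradSq_confMetric hv hf
    have hfc := hf.continuous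
    have hI : ∀ {h : S2 → ℝ}, Continuous h → Integrable h (areaMeasure (cappedMetric hε)) :=
      fun hh => hh.integrable_of_hasCompactSupport (HasCompactSupport.of_compactSpace _)
    have i1 := (integrable_areaMeasure_iff hv hgc).1 (hI hgc)
    have i2 := (integrable_areaMeasure_iff hv (hKc.mul (hfc.pow 2))).1 (hI (hKc.mul (hfc.pow 2)))
    have i3 := (integrable_areaMeasure_iff hv (hfc.pow 2)).1 (hI (hfc.pow 2))
    have hgrad : ∀ u, w u * gradSq (confMetric (potential ε) hv) f
        ((extChartAt (𝓡 2) basePoint).symm u) = ∑ i, pd i F u ^ 2 := by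
      intro u
      rw [gradSq_confMetric, ← mul_assoc, hw, ← Real.exp_add, add_neg_cancel, Real.exp_zero,
        one_mul]
      exact hf
    have i1' : Integrable fun u => ∑ i, pd i F u ^ 2 := by
      refine i1.congr (Filter.Eventually.of_forall fun u => ?_)
      exact hgrad u
    have hpos : 0 < ∫ p, f p ^ 2 ∂(areaMeasure (cappedMetric hε)) := by
      have e : ∫ p, f p ^ 2 ∂(areaMeasure (cappedMetric hε)) = ∫ u, w u * F u ^ 2 :=
        integral_areaMeasure hv (hfc.pow 2)
      have i3' : Integrable fun u => w u * F u ^ 2 := i3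
      rw [e]
      rw [integral_pos_iff_support_of_nonneg
        (fun u => mul_nonneg (Real.exp_pos _).le (sq_nonneg _)) i3']
      have hcont : Continuous fun u => w u * F u ^ 2 := hwc.mul (hFd.continuous.pow 2)
      refine (hcont.isOpen_support).measure_pos volume ?_
      by_contra hemp
      rw [not_nonempty_iff_eq_empty] at hemp
      have hz : ∀ u, F u = 0 := by
        intro u
        have : u ∉ Function.support fun u => w u * F u ^ 2 := by rw [hemp]; exact id
        rw [Function.notMem_support] at this
        exact pow_eq_zero_iff two_ne_zero |>.1 ((mul_eq_zero.1 this).resolve_left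
          (Real.exp_pos _).ne')
      -- the chart misses the point `-basePoint`, where `f` vanishes by continuity
      have hz2 : ∀ x : S2, x ≠ -basePoint → f x = 0 := by
        intro x hx
        rw [← extChartAt_symm_extChartAt (mem_chart_source_iff.2 hx)]
        exact hz _
      have hz3 : f (-basePoint) = 0 := by
        have h1 := (hfc.tendsto _).comp tendsto_stereoSphere
        have h2 : f ∘ stereoSphere = fun _ => 0 :=
          funext fun W => hz2 _ (stereoSphere_ne_neg_basePoint W)
        rw [h2] at h1
        exact (tendsto_nhds_unique h1 tendsto_const_nhds)
      refine hf0 (funext fun x => ?_)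
      by_cases hx : x = -basePoint
      · rw [hx]; exact hz3
      · exact hz2 x hx
    rw [le_div_iff₀ hpos]
    have e1 : ∫ p, (gradSq (cappedMetric hε) f p + gaussCurvature (cappedMetric hε) p * f p ^ 2)
        ∂(areaMeasure (cappedMetric hε)) =
        (∫ u, ∑ i, pd i F u ^ 2) + ∫ u, w u * κ u * F u ^ 2 := by
      refine (integral_areaMeasure hv (hgc.add (hKc.mul (hfc.pow 2)))).trans ?_
      rw [← integral_add i1' (i2.congr (Filter.Eventually.of_forall fun u => ?_))]
      · refine integral_congr_ae (Filter.Eventually.of_forall fun u => ?_)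
        simp only
        rw [← hgrad u]
        change w u * (_ + κ u * F u ^ 2) = _
        ring
      · change w u * (κ u * F u ^ 2) = _
        ring
    have e2 : ∫ p, f p ^ 2 ∂(areaMeasure (cappedMetric hε)) = ∫ u, w u * F u ^ 2 :=
      integral_areaMeasure hv (hfc.pow 2)
    have i2' : Integrable fun u => w u * κ u * F u ^ 2 := i2.congr
      (Filter.Eventually.of_forall fun u => by
        change w u * (κ u * F u ^ 2) = _
        ring)
    have i4 : Integrable fun u => (∑ i, (pd i (X i) u - X i u ^ 2)) * F u ^ 2 := by
      simp only [Finset.sum_mul, sub_mul]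
      exact integrable_finsetSum _ fun i _ =>
        (integrable_pd_mul hX hs hFd i).sub (integrable_sq_mul hX hs hFd i)
    rw [e1, e2, ← integral_const_mul]
    have h5 := integral_field_le hX hs hFd i1'
    calc ∫ u, c * (w u * F u ^ 2)
        ≤ ∫ u, ((∑ i, (pd i (X i) u - X i u ^ 2)) * F u ^ 2 + w u * κ u * F u ^ 2) := by
          refine integral_mono (i3.const_mul c) (i4.add i2') fun u => ?_
          have := mul_le_mul_of_nonneg_right (hXc u) (sq_nonneg (F u))
          simp only
          linarith
      _ = (∫ u, (∑ i, (pd i (X i) u - X i u ^ 2)) * F u ^ 2) + ∫ u, w u * κ u * F u ^ 2 :=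
          integral_add i4 i2'
      _ ≤ _ := by gcongr

/-! ### Closed geodesics as periodic orbits -/

/-- The geodesic equation of a conformal metric as a first order system for position and
velocity. -/
noncomputable def stateField (v : E3 → ℝ) (X : E3 × E3) : E3 × E3 := (X.2, geoField v X.1 X.2)

theorem contDiff_gradient {v : E3 → ℝ} (hv : ContDiff ℝ ∞ v) : ContDiff ℝ ∞ (gradient v) :=
  (InnerProductSpace.toDual ℝ E3).symm.contDiff.comp (hv.fderiv_right (m := ∞) (by simp))

theorem contDiff_stateField {v : E3 → ℝ} (hv : ContDiff ℝ ∞ v) : ContDiff ℝ ∞ (stateField v) := by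
  have h1 : ContDiff ℝ ∞ fun X : E3 × E3 => gradient v X.1 :=
    (contDiff_gradient hv).comp contDiff_fst
  have h2 : ContDiff ℝ ∞ fun X : E3 × E3 => ‖X.2‖ ^ 2 := contDiff_snd.norm_sq ℝ
  have h3 : ContDiff ℝ ∞ fun X : E3 × E3 => inner ℝ (gradient v X.1) X.2 := h1.inner ℝ contDiff_snd
  have h4 : ContDiff ℝ ∞ fun X : E3 × E3 => inner ℝ (gradient v X.1) X.1 := h1.inner ℝ contDiff_fst
  unfold stateField geoField
  refine contDiff_snd.prodMk (ContDiff.add (ContDiff.sub (h2.neg.smul contDiff_fst)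
    ((contDiff_const.mul h3).smul contDiff_snd)) (h2.smul (h1.sub (h4.smul contDiff_fst))))

theorem geoField_smul (v : E3 → ℝ) (x y : E3) (a : ℝ) :
    geoField v x (a • y) = a ^ 2 • geoField v x y := by
  have h : ‖a • y‖ ^ 2 = a ^ 2 * ‖y‖ ^ 2 := by
    rw [norm_smul, mul_pow, Real.norm_eq_abs, sq_abs]
  simp only [geoField, h, real_inner_smul_right]
  module

theorem exists_lipschitzOnWith_stateField {v : E3 → ℝ} (hv : ContDiff ℝ ∞ v) (r : ℝ) :
    ∃ K, LipschitzOnWith K (stateField v) (Metric.closedBall 0 r) := by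
  have h := contDiff_stateField hv
  have hc : Continuous fun X => ‖fderiv ℝ (stateField v) X‖₊ :=
    (h.continuous_fderiv (by simp)).nnnorm
  obtain ⟨K, hK⟩ := (isCompact_closedBall (0 : E3 × E3) r).bddAbove_image hc.continuousOn
  exact ⟨K, (convex_closedBall _ _).lipschitzOnWith_of_nnnorm_fderiv_le
    (fun X _ => h.differentiable (by simp) X) fun X hX => hK (mem_image_of_mem _ hX)⟩

/-- Solutions of a smooth autonomous differential equation are smooth. -/
theorem contDiff_of_hasDerivAt {E : Type*} [NormedAddCommGroup E] [NormedSpace ℝ E] {f : E → E}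
    (hf : ContDiff ℝ ∞ f) {X : ℝ → E} (hX : ∀ t, HasDerivAt X (f (X t)) t) : ContDiff ℝ ∞ X := by
  have hd : deriv X = f ∘ X := funext fun t => (hX t).deriv
  rw [contDiff_infty]
  intro n
  induction n with
  | zero => exact contDiff_zero.2 (continuous_iff_continuousAt.2 fun t => (hX t).continuousAt)
  | succ n ih =>
    rw [Nat.cast_add, Nat.cast_one, contDiff_succ_iff_deriv]
    refine ⟨fun t => (hX t).differentiableAt, by simp, ?_⟩
    rw [hd]
    exact (hf.of_le (by exact_mod_cast le_top)).comp ih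

/-- A unit speed closed geodesic of period `L`, through position and velocity. -/
structure IsClosedOrbit (v : E3 → ℝ) (L : ℝ) (X : ℝ → E3 × E3) : Prop where
  hasDerivAt : ∀ t, HasDerivAt X (stateField v (X t)) t
  norm_fst : ∀ t, ‖(X t).1‖ = 1
  exp_mul_norm_snd : ∀ t, Real.exp (v (X t).1) * ‖(X t).2‖ = 1
  periodic : Function.Periodic X L

section ClosedOrbit

variable {v : E3 → ℝ} {L : ℝ} {X : ℝ → E3 × E3}

theorem IsClosedOrbit.hasDerivAt_fst (h : IsClosedOrbit v L X) (t : ℝ) :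
    HasDerivAt (fun t => (X t).1) (X t).2 t :=
  (hasFDerivAt_fst (p := X t)).comp_hasDerivAt t (h.hasDerivAt t)

theorem IsClosedOrbit.hasDerivAt_snd (h : IsClosedOrbit v L X) (t : ℝ) :
    HasDerivAt (fun t => (X t).2) (geoField v (X t).1 (X t).2) t :=
  (hasFDerivAt_snd (p := X t)).comp_hasDerivAt t (h.hasDerivAt t)

theorem IsClosedOrbit.snd_ne_zero (h : IsClosedOrbit v L X) (t : ℝ) : (X t).2 ≠ 0 := by
  intro h0
  have := h.exp_mul_norm_snd t
  rw [h0] at this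
  simp at this

/-- Position and velocity along a closed orbit are orthogonal. -/
theorem IsClosedOrbit.inner_eq_zero (h : IsClosedOrbit v L X) (t : ℝ) :
    inner ℝ (X t).1 (X t).2 = 0 := by
  have h1 := (h.hasDerivAt_fst t).inner ℝ (h.hasDerivAt_fst t)
  have h2 : (fun t => inner ℝ (X t).1 (X t).1) = fun _ => (1 : ℝ) := by
    funext t
    rw [real_inner_self_eq_norm_sq, h.norm_fst]
    norm_num
  rw [h2] at h1
  have := h1.unique (hasDerivAt_const t (1 : ℝ))
  rw [real_inner_comm (X t).1 (X t).2] at this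
  linarith

/-- Geodesics have constant speed. -/
theorem exp_mul_norm_deriv_const (hv : ContDiff ℝ ∞ v) {c y : ℝ → E3}
    (hc : ∀ t, HasDerivAt c (y t) t) (hy : ∀ t, HasDerivAt y (geoField v (c t) (y t)) t)
    (h1 : ∀ t, ‖c t‖ = 1) (s t : ℝ) :
    Real.exp (v (c s)) * ‖y s‖ = Real.exp (v (c t)) * ‖y t‖ := by
  have horth : ∀ t, inner ℝ (c t) (y t) = (0 : ℝ) := by
    intro t
    have e1 := (hc t).inner ℝ (hc t)
    have e2 : (fun t => inner ℝ (c t) (c t)) = fun _ => (1 : ℝ) := by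
      funext t
      rw [real_inner_self_eq_norm_sq, h1]
      norm_num
    rw [e2] at e1
    have := e1.unique (hasDerivAt_const t (1 : ℝ))
    rw [real_inner_comm (c t) (y t)] at this
    linarith
  have hE : ∀ t, HasDerivAt (fun t => Real.exp (2 * v (c t)) * inner ℝ (y t) (y t)) 0 t := by
    intro t
    have hd : HasDerivAt (fun t => v (c t)) (inner ℝ (gradient v (c t)) (y t)) t := by
      have := (hv.differentiable (by simp) (c t)).hasGradientAt.hasFDerivAt.comp_hasDerivAt t (hc t)
      exact this.congr_deriv (by simp)
    refine ((hd.const_mul 2).exp.mul ((hy t).inner ℝ (hy t))).congr_deriv ?_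
    have h2 := horth t
    have h3 : inner ℝ (y t) (c t) = (0 : ℝ) := by rw [real_inner_comm]; exact h2
    have h4 : inner ℝ (geoField v (c t) (y t)) (y t) =
        -(inner ℝ (gradient v (c t)) (y t) * ‖y t‖ ^ 2) := by
      simp only [geoField, inner_add_left, inner_sub_left, real_inner_smul_left, h2,
        real_inner_self_eq_norm_sq]
      ring
    rw [real_inner_comm (geoField v (c t) (y t)) (y t), h4, real_inner_self_eq_norm_sq]
    ring
  have h2 := is_const_of_deriv_eq_zero (fun t => (hE t).differentiableAt)
    (fun t => (hE t).deriv) s t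
  have h3 : ∀ t, Real.exp (2 * v (c t)) * inner ℝ (y t) (y t) =
      (Real.exp (v (c t)) * ‖y t‖) ^ 2 := by
    intro t
    rw [real_inner_self_eq_norm_sq, two_mul, Real.exp_add]
    ring
  rw [h3, h3] at h2
  exact (pow_left_inj₀ (by positivity) (by positivity) two_ne_zero).1 h2

/-- A closed geodesic has constant speed; parametrized by arc length, its period is its length. -/
theorem mem_closedGeodesicLengths_confMetric (hv : ContDiff ℝ ∞ v) :
    L ∈ closedGeodesicLengths (confMetric v hv) ↔ 0 < L ∧ ∃ X, IsClosedOrbit v L X := by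
  constructor
  · rintro ⟨γ, T, hT, hγ, hper, ⟨s, t, hst⟩, rfl⟩
    obtain ⟨hc, hgeo⟩ := (isGeodesic_confMetric_iff hv).1 hγ
    set c : ℝ → E3 := fun t => (γ t : E3) with hcdef
    have hc1 : ∀ t, HasDerivAt c (deriv c t) t := fun t =>
      (hc.differentiable (by simp) t).hasDerivAt
    have hc2 : ∀ t, HasDerivAt (deriv c) (geoField v (c t) (deriv c t)) t := fun t => by
      have := ((contDiff_infty_iff_deriv.1 hc).2.differentiable (by simp) t).hasDerivAt
      rwa [hgeo t] at this
    have hn : ∀ t, ‖c t‖ = 1 := fun t => norm_eq_of_mem_sphere (γ t)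
    set σ := Real.exp (v (c 0)) * ‖deriv c 0‖ with hσ
    have hspeed : ∀ t, Real.exp (v (c t)) * ‖deriv c t‖ = σ := fun t =>
      exp_mul_norm_deriv_const hv hc1 hc2 hn t 0
    -- the geodesic is not constant
    have hσ0 : 0 < σ := by
      refine lt_of_le_of_ne (by positivity) fun h0 => hst ?_
      have h1 : ∀ t, deriv c t = 0 := fun t => by
        have := hspeed t
        rw [← h0] at this
        exact norm_eq_zero.1 ((mul_eq_zero.1 this).resolve_left (Real.exp_pos _).ne')
      exact Subtype.ext (is_const_of_deriv_eq_zero (fun t => (hc1 t).differentiableAt) h1 s t)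
    have hlen : ∫ t in (0 : ℝ)..T, speed (confMetric v hv) γ t = T * σ := by
      have : ∀ t, speed (confMetric v hv) γ t = σ := fun t => by
        rw [speed_confMetric hv hc, ← hspeed t]
      simp only [this]
      simp
    have hcp : Function.Periodic c T := fun t => by simp only [hcdef, hper t]
    have hcp' : Function.Periodic (deriv c) T := fun t => by
      rw [← deriv_comp_add_const]
      congr 1
      exact funext hcp
    rw [hlen]
    refine ⟨by positivity, fun t => (c (t / σ), σ⁻¹ • deriv c (t / σ)), ⟨fun t => ?_, fun t => hn _,
      fun t => ?_, fun t => ?_⟩⟩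
    · have hdiv : HasDerivAt (fun t : ℝ => t / σ) σ⁻¹ t := by
        simpa [div_eq_mul_inv] using (hasDerivAt_id t).mul_const σ⁻¹
      have e1 := (hc1 (t / σ)).scomp t hdiv
      have e2 := ((hc2 (t / σ)).scomp t hdiv).const_smul σ⁻¹
      refine (e1.prodMk e2).congr_deriv ?_
      rw [stateField, geoField_smul, smul_smul, ← sq]
    · rw [norm_smul, Real.norm_of_nonneg (by positivity), mul_left_comm, hspeed,
        inv_mul_cancel₀ hσ0.ne']
    · have e : (t + T * σ) / σ = t / σ + T := by field_simp
      simp only [e, hcp (t / σ), hcp' (t / σ)]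
  · rintro ⟨hL, X, hX⟩
    have hXs := contDiff_of_hasDerivAt (contDiff_stateField hv) hX.hasDerivAt
    have hd : deriv (fun t => (X t).1) = fun t => (X t).2 :=
      funext fun t => (hX.hasDerivAt_fst t).deriv
    have hd2 : deriv (fun t => (X t).2) = fun t => geoField v (X t).1 (X t).2 :=
      funext fun t => (hX.hasDerivAt_snd t).deriv
    have hc : ContDiff ℝ ∞ fun t => (X t).1 := contDiff_fst.comp hXs
    refine ⟨fun t => ⟨(X t).1, by simp [hX.norm_fst t]⟩, L, hL,
      (isGeodesic_confMetric_iff hv).2 ⟨hc, fun t => ?_⟩, fun t => ?_, ?_, ?_⟩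
    · simp only [hd, hd2]
    · exact Subtype.ext (congrArg Prod.fst (hX.periodic t))
    · by_contra! hconst
      have : (fun t => (X t).1) = fun _ => (X 0).1 :=
        funext fun t => congrArg Subtype.val (hconst t 0)
      refine hX.snd_ne_zero 0 ?_
      rw [← congrFun hd 0, this]
      simp
    · have : ∀ t, speed (confMetric v hv) (fun t => (⟨(X t).1, by simp [hX.norm_fst t]⟩ : S2)) t
          = 1 := fun t => by
        rw [speed_confMetric hv hc, hd]
        exact hX.exp_mul_norm_snd t
      simp only [this]
      simp

/-- Two solutions of the geodesic equation which agree at an interior time of an interval agree on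
the interval. -/
theorem eqOn_of_hasDerivAt_stateField (hv : ContDiff ℝ ∞ v) {X Y : ℝ → E3 × E3} {a b t₀ : ℝ}
    (ht : t₀ ∈ Ioo a b) (hX : ∀ t ∈ Icc a b, HasDerivAt X (stateField v (X t)) t)
    (hY : ∀ t ∈ Icc a b, HasDerivAt Y (stateField v (Y t)) t) (h : X t₀ = Y t₀) :
    EqOn X Y (Icc a b) := by
  have cX : ContinuousOn X (Icc a b) := fun t ht => (hX t ht).continuousAt.continuousWithinAt
  have cY : ContinuousOn Y (Icc a b) := fun t ht => (hY t ht).continuousAt.continuousWithinAt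
  obtain ⟨r, hr⟩ := ((isCompact_Icc.image_of_continuousOn cX).union
    (isCompact_Icc.image_of_continuousOn cY)).isBounded.subset_closedBall 0
  obtain ⟨K, hK⟩ := exists_lipschitzOnWith_stateField hv r
  exact ODE_solution_unique_of_mem_Icc (v := fun _ => stateField v)
    (s := fun _ => Metric.closedBall 0 r) (fun _ _ => hK) ht cX
    (fun t ht => hX t (Ioo_subset_Icc_self ht))
    (fun t ht => hr (Or.inl (mem_image_of_mem _ (Ioo_subset_Icc_self ht)))) cY
    (fun t ht => hY t (Ioo_subset_Icc_self ht))
    (fun t ht => hr (Or.inr (mem_image_of_mem _ (Ioo_subset_Icc_self ht)))) h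

/-- Gronwall's inequality, forward and backward in time. -/
theorem dist_le_of_hasDerivAt {E : Type*} [NormedAddCommGroup E] [NormedSpace ℝ E] {f : E → E}
    {K : NNReal} {S : Set E} (hf : LipschitzOnWith K f S) {X Y : ℝ → E}
    (hX : ∀ t, HasDerivAt X (f (X t)) t) (hY : ∀ t, HasDerivAt Y (f (Y t)) t)
    (hXS : ∀ t, X t ∈ S) (hYS : ∀ t, Y t ∈ S) (t : ℝ) :
    dist (X t) (Y t) ≤ dist (X 0) (Y 0) * Real.exp (K * |t|) := by
  -- the estimate forward in time, for an arbitrary field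
  have key : ∀ {g : E → E} {X Y : ℝ → E}, LipschitzOnWith K g S →
      (∀ t, HasDerivAt X (g (X t)) t) → (∀ t, HasDerivAt Y (g (Y t)) t) → (∀ t, X t ∈ S) →
      (∀ t, Y t ∈ S) → ∀ t, 0 ≤ t →
      dist (X t) (Y t) ≤ dist (X 0) (Y 0) * Real.exp (K * t) := by
    intro g X Y hg hX hY hXS hYS t ht
    have := dist_le_of_trajectories_ODE_of_mem (v := fun _ => g) (s := fun _ => S) (a := 0) (b := t)
      (fun _ _ => hg) (fun t _ => (hX t).continuousAt.continuousWithinAt)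
      (fun t _ => (hX t).hasDerivWithinAt) (fun t _ => hXS t)
      (fun t _ => (hY t).continuousAt.continuousWithinAt)
      (fun t _ => (hY t).hasDerivWithinAt) (fun t _ => hYS t) le_rfl t ⟨ht, le_rfl⟩
    simpa using this
  rcases le_total 0 t with ht | ht
  · rw [abs_of_nonneg ht]
    exact key hf hX hY hXS hYS t ht
  · rw [abs_of_nonpos ht]
    have hneg : LipschitzOnWith K (fun x => -f x) S := by
      intro x hx y hy
      rw [edist_neg_neg]
      exact hf hx hy
    have hrev : ∀ {X : ℝ → E}, (∀ t, HasDerivAt X (f (X t)) t) →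
        ∀ t, HasDerivAt (fun t => X (-t)) (-f (X (-t))) t := by
      intro X hX t
      have := (hX (-t)).scomp t (hasDerivAt_neg t)
      exact this.congr_deriv (by simp)
    have := key hneg (hrev hX) (hrev hY) (fun t => hXS _) (fun t => hYS _) (-t) (by linarith)
    simpa using this

/-- The period of unit speed closed orbits is a closed condition away from `0`: a compactness
argument in the space of initial data. -/
theorem exists_isClosedOrbit_of_tendsto (hv : ContDiff ℝ ∞ v) {Ls : ℕ → ℝ} {Xs : ℕ → ℝ → E3 × E3}
    (h : ∀ n, IsClosedOrbit v (Ls n) (Xs n)) (hL : Filter.Tendsto Ls Filter.atTop (nhds L)) :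
    ∃ X, IsClosedOrbit v L X := by
  obtain ⟨C, hC⟩ : ∃ C, ∀ n t, ‖Xs n t‖ ≤ C := by
    have hcont : Continuous fun x => Real.exp (-v x) := Real.continuous_exp.comp hv.continuous.neg
    obtain ⟨C, hC⟩ := (isCompact_sphere (0 : E3) 1).bddAbove_image hcont.continuousOn
    refine ⟨max 1 C, fun n t => ?_⟩
    have h1 := (h n).norm_fst t
    have h2 := (h n).exp_mul_norm_snd t
    have h3 : ‖(Xs n t).2‖ = Real.exp (-v (Xs n t).1) := by
      rw [Real.exp_neg]
      exact eq_inv_of_mul_eq_one_right h2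
    rw [Prod.norm_def, h1, h3]
    exact max_le_max le_rfl (hC (mem_image_of_mem _ (by simp [h1])))
  obtain ⟨K, hK⟩ := exists_lipschitzOnWith_stateField hv C
  have hmem : ∀ n t, Xs n t ∈ Metric.closedBall (0 : E3 × E3) C := fun n t => by
    simpa using hC n t
  obtain ⟨X0, -, φ, hφ, hlim0⟩ := (isCompact_closedBall (0 : E3 × E3) C).tendsto_subseq
    fun n => hmem n 0
  -- the subsequence converges at every time
  have hcauchy : ∀ t, ∃ x, Filter.Tendsto (fun n => Xs (φ n) t) Filter.atTop (nhds x) := by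
    intro t
    refine cauchySeq_tendsto_of_complete (Metric.cauchySeq_iff.2 fun δ hδ => ?_)
    obtain ⟨N, hN⟩ := Metric.cauchySeq_iff.1 hlim0.cauchySeq (δ / Real.exp (K * |t|))
      (by positivity)
    refine ⟨N, fun m hm n hn => ?_⟩
    refine (dist_le_of_hasDerivAt hK (h (φ m)).hasDerivAt (h (φ n)).hasDerivAt (hmem _) (hmem _)
      t).trans_lt ?_
    exact (lt_div_iff₀ (Real.exp_pos _)).1 (hN m hm n hn)
  choose X hX using hcauchy
  have hfc : Continuous (stateField v) := (contDiff_stateField hv).continuous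
  obtain ⟨M, hM⟩ : ∃ M, ∀ n t, ‖stateField v (Xs n t)‖ ≤ M := by
    obtain ⟨M, hM⟩ := (isCompact_closedBall (0 : E3 × E3) C).bddAbove_image hfc.norm.continuousOn
    exact ⟨M, fun n t => hM (mem_image_of_mem _ (hmem n t))⟩
  have hlip : ∀ n s t, ‖Xs n s - Xs n t‖ ≤ M * ‖s - t‖ := fun n s t =>
    convex_univ.norm_image_sub_le_of_norm_hasDerivWithin_le
      (fun t _ => ((h n).hasDerivAt t).hasDerivWithinAt) (fun t _ => hM n t) (mem_univ t)
      (mem_univ s)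
  have hlipX : ∀ s t, ‖X s - X t‖ ≤ M * ‖s - t‖ := fun s t =>
    le_of_tendsto ((hX s).sub (hX t)).norm (Filter.Eventually.of_forall fun n => hlip _ s t)
  have hXc : Continuous X := by
    refine (LipschitzWith.of_dist_le_mul (K := M.toNNReal) fun s t => ?_).continuous
    rw [dist_eq_norm, dist_eq_norm]
    refine (hlipX s t).trans ?_
    gcongr
    exact Real.le_coe_toNNReal M
  -- the limit satisfies the integrated equation
  have hint : ∀ t, X t = X 0 + ∫ s in (0 : ℝ)..t, stateField v (X s) := by
    intro t
    have e1 : ∀ n, Xs (φ n) t = Xs (φ n) 0 + ∫ s in (0 : ℝ)..t, stateField v (Xs (φ n) s) := by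
      intro n
      have hcn : Continuous (Xs (φ n)) :=
        continuous_iff_continuousAt.2 fun t => ((h (φ n)).hasDerivAt t).continuousAt
      rw [intervalIntegral.integral_eq_sub_of_hasDerivAt (fun s _ => (h (φ n)).hasDerivAt s)
        ((hfc.comp hcn).intervalIntegrable _ _)]
      abel
    have e2 : Filter.Tendsto (fun n => ∫ s in (0 : ℝ)..t, stateField v (Xs (φ n) s)) Filter.atTop
        (nhds (∫ s in (0 : ℝ)..t, stateField v (X s))) := by
      refine intervalIntegral.tendsto_integral_filter_of_dominated_convergence (fun _ => M) ?_ ?_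
        (by simp) ?_
      · refine Filter.Eventually.of_forall fun n => ?_
        have hcn : Continuous (Xs (φ n)) :=
          continuous_iff_continuousAt.2 fun t => ((h (φ n)).hasDerivAt t).continuousAt
        exact (hfc.comp hcn).aestronglyMeasurable
      · exact Filter.Eventually.of_forall fun n => Filter.Eventually.of_forall fun s _ => hM _ s
      · exact Filter.Eventually.of_forall fun s _ => (hfc.tendsto _).comp (hX s)
    refine tendsto_nhds_unique (hX t) ?_
    simp only [e1]
    exact (hX 0).add e2
  refine ⟨X, fun t => ?_, fun t => ?_, fun t => ?_, fun t => ?_⟩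
  · have h1 := ((hfc.comp hXc).integral_hasStrictDerivAt 0 t).hasDerivAt.const_add (X 0)
    exact h1.congr_of_eventuallyEq (Filter.Eventually.of_forall hint)
  · refine tendsto_nhds_unique (((continuous_fst.tendsto _).comp (hX t)).norm) ?_
    simp only [Function.comp_def, (h _).norm_fst]
    exact tendsto_const_nhds
  · have hcont : Continuous fun Y : E3 × E3 => Real.exp (v Y.1) * ‖Y.2‖ :=
      (Real.continuous_exp.comp (hv.continuous.comp continuous_fst)).mul continuous_snd.norm
    refine tendsto_nhds_unique ((hcont.tendsto _).comp (hX t)) ?_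
    simp only [Function.comp_def, (h _).exp_mul_norm_snd]
    exact tendsto_const_nhds
  · have e1 : Filter.Tendsto (fun n => Xs (φ n) (t + L) - Xs (φ n) t) Filter.atTop (nhds 0) := by
      have e2 : Filter.Tendsto (fun n => M * ‖L - Ls (φ n)‖) Filter.atTop (nhds 0) := by
        have := ((tendsto_const_nhds (x := L)).sub (hL.comp hφ.tendsto_atTop)).norm.const_mul M
        simpa using this
      refine squeeze_zero_norm (fun n => ?_) e2
      have := hlip (φ n) (t + L) (t + Ls (φ n))
      rw [(h (φ n)).periodic t] at this
      simpa using this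
    exact sub_eq_zero.1 (tendsto_nhds_unique ((hX (t + L)).sub (hX t)) e1)

/-- A nonempty set of lengths of closed geodesics which is bounded away from `0` has a least
element. -/
theorem exists_isLeast_closedGeodesicLengths (hv : ContDiff ℝ ∞ v) {m : ℝ} (hm : 0 < m)
    (hne : (closedGeodesicLengths (confMetric v hv)).Nonempty)
    (hlb : ∀ L ∈ closedGeodesicLengths (confMetric v hv), m ≤ L) :
    ∃ ℓ, IsLeast (closedGeodesicLengths (confMetric v hv)) ℓ ∧ m ≤ ℓ := by
  set S := closedGeodesicLengths (confMetric v hv) with hS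
  have hbdd : BddBelow S := ⟨m, hlb⟩
  obtain ⟨Ls, -, hlim, hmem⟩ := exists_seq_tendsto_sInf hne hbdd
  choose hpos Xs hXs using fun n => (mem_closedGeodesicLengths_confMetric hv).1 (hmem n)
  have hle : m ≤ sInf S := le_csInf hne hlb
  obtain ⟨X, hX⟩ := exists_isClosedOrbit_of_tendsto hv hXs hlim
  exact ⟨sInf S, ⟨(mem_closedGeodesicLengths_confMetric hv).2 ⟨hm.trans_le hle, X, hX⟩,
    fun L hL => csInf_le hbdd hL⟩, hle⟩

end ClosedOrbit

/-! ### Geodesics in the caps -/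

theorem inner_pole (i j : Fin 3) (hij : i ≠ j) :
    inner ℝ (pole i) (pole j) = 0 ∨ inner ℝ (pole i) (pole j) = (-1 : ℝ) := by
  fin_cases i <;> fin_cases j <;> simp [pole, inner_E3] at hij ⊢

/-- Near the pole `p` the vector `p` is almost normal to the sphere, while the correction is
tangential; so its component along `p` is small. -/
theorem abs_inner_connTerm_le {p q x y : E3} (hp : ‖p‖ = 1) (hq : ‖q‖ = 1) (hx : ‖x‖ = 1)
    (hxy : inner ℝ x y = 0) {s : ℝ} (hs0 : 0 ≤ s) (hs : 2 - 2 * inner ℝ p x ≤ s ^ 2) :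
    |inner ℝ p (connTerm q x y)| ≤ 3 * s * ‖y‖ ^ 2 := by
  have e1 : inner ℝ p y = inner ℝ (p - x) y := by rw [inner_sub_left, hxy, sub_zero]
  have hpx : ‖p - x‖ ≤ s := by
    refine le_of_sq_le_sq ?_ hs0
    rw [norm_sub_sq_real, hp, hx]
    linarith
  have hpx2 : ‖p - inner ℝ p x • x‖ ≤ s := by
    refine le_of_sq_le_sq ?_ hs0
    rw [norm_sub_sq_real, hp, norm_smul, hx, real_inner_smul_right, Real.norm_eq_abs,
      mul_one, sq_abs]
    nlinarith [sq_nonneg (inner ℝ p x - 1)]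
  have h1 : |inner ℝ p y| ≤ s * ‖y‖ := by
    rw [e1]
    refine (abs_real_inner_le_norm _ _).trans ?_
    gcongr
  have h2 : |inner ℝ q y| ≤ ‖y‖ := by
    have := abs_real_inner_le_norm q y
    rwa [hq, one_mul] at this
  have h3 : |inner ℝ q p - inner ℝ q x * inner ℝ p x| ≤ s := by
    have e : inner ℝ q p - inner ℝ q x * inner ℝ p x = inner ℝ q (p - inner ℝ p x • x) := by
      rw [inner_sub_right, real_inner_smul_right]; ring
    rw [e]
    refine (abs_real_inner_le_norm _ _).trans ?_
    rw [hq, one_mul]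
    exact hpx2
  have e : inner ℝ p (connTerm q x y) = -(2 * inner ℝ q y * inner ℝ p y)
      + ‖y‖ ^ 2 * (inner ℝ q p - inner ℝ q x * inner ℝ p x) := by
    simp only [connTerm, inner_add_right, inner_sub_right, real_inner_smul_right]
    rw [real_inner_comm p q]
    ring
  rw [e]
  refine (abs_add_le _ _).trans ?_
  rw [abs_neg, abs_mul, abs_mul, abs_mul, abs_of_pos (two_pos : (0 : ℝ) < 2),
    abs_of_nonneg (sq_nonneg ‖y‖)]
  have h4 : |inner ℝ q y| * |inner ℝ p y| ≤ ‖y‖ * (s * ‖y‖) := by gcongr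
  have h5 := mul_le_mul_of_nonneg_left h3 (sq_nonneg ‖y‖)
  nlinarith

/-- The correction caused by the pole of the cap itself, along that pole. -/
theorem inner_connTerm_self_le {p x y : E3} (hp : ‖p‖ = 1) :
    inner ℝ p (connTerm p x y) ≤ (2 - 2 * inner ℝ p x) * ‖y‖ ^ 2 := by
  have e : inner ℝ p (connTerm p x y) = -(2 * inner ℝ p y ^ 2)
      + ‖y‖ ^ 2 * (1 - inner ℝ p x ^ 2) := by
    simp only [connTerm, inner_add_right, inner_sub_right, real_inner_smul_right]
    rw [real_inner_self_eq_norm_sq, hp]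
    ring
  rw [e]
  nlinarith [sq_nonneg (inner ℝ p y), mul_nonneg (sq_nonneg ‖y‖) (sq_nonneg (1 - inner ℝ p x))]

/-- Two different caps are disjoint, with a definite distance. -/
theorem one_le_chord_of_chord_le {i j : Fin 3} (hij : i ≠ j) {x : E3} (hx : ‖x‖ = 1)
    (h : chord i x ≤ 1 / 200) : 1 ≤ chord j x := by
  have h1 : ‖x - pole i‖ ≤ 1 / 10 := by
    refine le_of_sq_le_sq ?_ (by norm_num)
    rw [← chord_eq_norm_sq i hx]
    linarith
  have h2 : (2 : ℝ) ≤ ‖pole i - pole j‖ ^ 2 := by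
    rw [norm_sub_sq_real, norm_pole, norm_pole]
    rcases inner_pole i j hij with h | h <;> rw [h] <;> norm_num
  have h3 : ‖pole i - pole j‖ ≤ ‖x - pole i‖ + ‖x - pole j‖ := by
    have := norm_sub_le (x - pole j) (x - pole i)
    rw [sub_sub_sub_cancel_left] at this
    linarith
  rw [chord_eq_norm_sq j hx]
  by_contra! hlt
  have h4 : ‖x - pole j‖ < 1 := by
    rwa [sq_lt_one_iff₀ (norm_nonneg _)] at hlt
  have h5 : ‖pole i - pole j‖ ≤ 11 / 10 := by linarith
  have h6 := pow_le_pow_left₀ (norm_nonneg _) h5 2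
  norm_num at h6
  linarith

/-- The caps are convex: the squared distance to the pole is strictly convex along geodesics. -/
theorem neg_two_inner_geoField_ge {ε : ℝ} (hε : 0 < ε) {i : Fin 3} {x y : E3} (hx : ‖x‖ = 1)
    (hxy : inner ℝ x y = 0) (hi : chord i x ≤ 1 / 200) :
    1 / 100 * ‖y‖ ^ 2 ≤ -(2 * inner ℝ (pole i) (geoField (potential ε) x y)) := by
  have hL : ∀ j, 0 ≤ chord j x → 0 ≤ deriv (smoothLog ε) (chord j x) := fun j hj => by
    rw [deriv_smoothLog hε]
    exact div_nonneg (cutoff_nonneg _ _) hj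
  have hc : ∀ j, 0 ≤ chord j x := fun j => by rw [chord_eq_norm_sq j hx]; positivity
  have hy := sq_nonneg ‖y‖
  -- the contribution of the pole of the cap
  have hi1 : deriv (smoothLog ε) (chord i x) * inner ℝ (pole i) (connTerm (pole i) x y) ≤
      ‖y‖ ^ 2 := by
    have h1 := mul_le_mul_of_nonneg_left (inner_connTerm_self_le (x := x) (y := y) (norm_pole i))
      (hL i (hc i))
    refine h1.trans ?_
    change deriv (smoothLog ε) (chord i x) * (chord i x * ‖y‖ ^ 2) ≤ _
    have h2 := mul_deriv_smoothLog hε (chord i x)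
    have h3 := cutoff_le_one ε (chord i x)
    have : deriv (smoothLog ε) (chord i x) * (chord i x * ‖y‖ ^ 2) =
        cutoff ε (chord i x) * ‖y‖ ^ 2 := by rw [← h2]; ring
    rw [this]
    exact mul_le_of_le_one_left hy h3
  -- the contributions of the other two poles
  -- the radius of the cap is below `71/1000`, the square root of `1/200` being slightly smaller
  have hs : 2 - 2 * inner ℝ (pole i) x ≤ (71 / 1000) ^ 2 := by
    change chord i x ≤ _
    refine hi.trans (by norm_num)
  have hj1 : ∀ j, i ≠ j → deriv (smoothLog ε) (chord j x) *
      inner ℝ (pole i) (connTerm (pole j) x y) ≤ 213 / 1000 * ‖y‖ ^ 2 := by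
    intro j hij
    have h1 := one_le_chord_of_chord_le hij hx hi
    have h2 : deriv (smoothLog ε) (chord j x) ≤ 1 := by
      rw [deriv_smoothLog hε]
      exact div_le_one_of_le₀ ((cutoff_le_one _ _).trans h1) (hc j)
    have h3 := abs_inner_connTerm_le (norm_pole i) (norm_pole j) hx hxy (by norm_num) hs
    calc _ ≤ deriv (smoothLog ε) (chord j x) * |inner ℝ (pole i) (connTerm (pole j) x y)| :=
          mul_le_mul_of_nonneg_left (le_abs_self _) (hL j (hc j))
      _ ≤ 1 * (3 * (71 / 1000) * ‖y‖ ^ 2) :=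
          mul_le_mul h2 h3 (abs_nonneg _) zero_le_one
      _ = _ := by ring
  have hsum : ∑ j, deriv (smoothLog ε) (chord j x) * inner ℝ (pole i) (connTerm (pole j) x y) ≤
      (1 + 426 / 1000) * ‖y‖ ^ 2 := by
    rw [Fin.sum_univ_three]
    obtain rfl | rfl | rfl : i = 0 ∨ i = 1 ∨ i = 2 := by fin_cases i <;> simp
    · linarith [hi1, hj1 1 (by decide), hj1 2 (by decide)]
    · linarith [hi1, hj1 0 (by decide), hj1 2 (by decide)]
    · linarith [hi1, hj1 0 (by decide), hj1 1 (by decide)]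
  have e : inner ℝ (pole i) (geoField (potential ε) x y) =
      -‖y‖ ^ 2 * inner ℝ (pole i) x + 2 / 3 * ∑ j, deriv (smoothLog ε) (chord j x) *
        inner ℝ (pole i) (connTerm (pole j) x y) := by
    rw [geoField_eq, gradient_potential hε, connTerm_smul, inner_add_right, real_inner_smul_right,
      real_inner_smul_right]
    simp only [Fin.sum_univ_three, connTerm_add, connTerm_smul, inner_add_right,
      real_inner_smul_right]
  rw [e]
  have h5 : 1 - 1 / 400 ≤ inner ℝ (pole i) x := by
    rw [chord] at hi
    linarith
  nlinarith [mul_le_mul_of_nonneg_left h5 hy]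

/-- A closed geodesic does not stay in a cap. -/
theorem IsClosedOrbit.exists_lt_chord {ε L : ℝ} (hε : 0 < ε) {X : ℝ → E3 × E3}
    (h : IsClosedOrbit (potential ε) L X) (hL : 0 < L) (i : Fin 3) :
    ∃ t, 1 / 200 < chord i (X t).1 := by
  by_contra! hcap
  have h1 : ∀ t, HasDerivAt (fun t => -(2 * inner ℝ (pole i) (X t).2))
      (-(2 * inner ℝ (pole i) (geoField (potential ε) (X t).1 (X t).2))) t := by
    intro t
    have := ((innerSL ℝ (pole i)).hasFDerivAt.comp_hasDerivAt t (h.hasDerivAt_snd t))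
    exact (this.const_mul 2).neg
  have hpos : ∀ t, 0 < -(2 * inner ℝ (pole i) (geoField (potential ε) (X t).1 (X t).2)) := by
    intro t
    refine lt_of_lt_of_le ?_ (neg_two_inner_geoField_ge hε (h.norm_fst t) (h.inner_eq_zero t)
      (hcap t))
    have := norm_pos_iff.2 (h.snd_ne_zero t)
    positivity
  have hmono : StrictMono fun t => -(2 * inner ℝ (pole i) (X t).2) :=
    strictMono_of_deriv_pos fun t => by rw [(h1 t).deriv]; exact hpos t
  have := hmono (show (0 : ℝ) < 0 + L by linarith)
  simp only [h.periodic 0, lt_irrefl] at this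

/-! ### Straight lines as geodesics -/

theorem dstereo_injective (W : ℂ) : Function.Injective (dstereo W) := by
  intro v w h
  have h1 : dstereo W (v + (-1 : ℝ) * w) = 0 := by
    rw [dstereo_add, dstereo_smul, h]
    module
  have h2 := inner_dstereo W (v + (-1 : ℝ) * w) (v + (-1 : ℝ) * w)
  rw [h1, inner_zero_left] at h2
  have h3 := one_add_sq_pos W
  have h4 := (mul_eq_zero.1 h2.symm).resolve_left (by positivity)
  rw [inner_self_eq_zero] at h4
  push_cast at h4
  linear_combination h4

theorem unif'_ne_zero {z : ℂ} (hz : z ∉ coneSet) : unif' z ≠ 0 := by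
  intro h
  have h1 := four_mul_wp_pow_three (notMem_lattice_of_notMem_coneSet hz)
  have h2 : PeriodPair.weierstrassP hexPeriods z = 0 := by
    rw [unif', div_eq_zero_iff] at h
    have := h.resolve_right coneValue_ne_zero
    simpa using this
  rw [h2] at h1
  have h5 := (mul_eq_zero.1 (h1.symm.trans (by simp))).resolve_left
    (pow_ne_zero 2 coneValue_ne_zero)
  exact unif_sq_ne_one hz (sub_eq_zero.1 h5)

/-- Position and velocity of the image of a straight line in the plane. -/
noncomputable def lineState (z₀ w : ℂ) (t : ℝ) : E3 × E3 :=
  (devMap (z₀ + t * w), dstereo (unif (z₀ + t * w)) (unif' (z₀ + t * w) * w))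

theorem HasDerivAt.comp_line {f : ℂ → ℂ} {f' z₀ w : ℂ} {t : ℝ} (h : HasDerivAt f f' (z₀ + t * w)) :
    HasDerivAt (fun t : ℝ => f (z₀ + t * w)) (f' * w) t := by
  have hline : HasDerivAt (fun t : ℝ => z₀ + t * w) w t := by
    simpa using ((Complex.ofRealCLM.hasDerivAt (x := t)).mul_const w).const_add z₀
  exact (h.scomp t hline).congr_deriv (by simp [mul_comm])

open Filter Topology in
/-- In the flat region, images of straight lines solve the geodesic equation. -/
theorem hasDerivAt_lineState {ε : ℝ} (hε : 0 < ε) {z₀ w : ℂ} {t : ℝ} (hz : z₀ + t * w ∉ coneSet)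
    (hf : (devMap (z₀ + t * w) : E3) ∈ flatRegion ε) :
    HasDerivAt (lineState z₀ w) (stateField (potential ε) (lineState z₀ w t)) t := by
  have hl := notMem_lattice_of_notMem_coneSet hz
  have hW := HasDerivAt.comp_line (hasDerivAt_unif hl)
  have hw : HasDerivAt (fun t : ℝ => unif' (z₀ + t * w) * w)
      (4 / 3 * (unif (z₀ + t * w) / (unif (z₀ + t * w) ^ 2 - 1)) *
        (unif' (z₀ + t * w) * w) ^ 2) t := by
    refine ((HasDerivAt.comp_line (hasDerivAt_unif' hl (unif_sq_ne_one hz))).mul_const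
      w).congr_deriv ?_
    generalize unif' (z₀ + t * w) = a
    ring
  have h1 := hasDerivAt_stereo hW
  have h2 := hasDerivAt_dstereo_of_flat (W := fun t : ℝ => unif (z₀ + t * w))
    (w := fun t : ℝ => unif' (z₀ + t * w) * w) hW hw (unif_ne_one hz) (unif_ne_neg_one hz)
  have h3 : (fun t : ℝ => (devMap (z₀ + t * w) : E3)) =ᶠ[𝓝 t]
      fun t : ℝ => stereo (unif (z₀ + t * w)) := by
    have hc : Continuous fun t : ℝ => z₀ + t * w := by fun_prop
    filter_upwards [hc.continuousAt.eventually_mem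
      (isClosed_lattice.isOpen_compl.mem_nhds hl)] with s hs
    exact coe_devMap hs
  have h4 := (h1.congr_of_eventuallyEq h3).prodMk h2
  rw [← coe_devMap hl, ← geoField_of_mem_flatRegion hε hf] at h4
  exact h4

/-- In the flat region, images of straight lines have the speed of the line. -/
theorem norm_lineState_snd {ε : ℝ} (hε : 0 < ε) {z₀ w : ℂ} {t : ℝ} (hz : z₀ + t * w ∉ coneSet)
    (hf : (devMap (z₀ + t * w) : E3) ∈ flatRegion ε) :
    Real.exp (potential ε (lineState z₀ w t).1) * ‖(lineState z₀ w t).2‖ = ‖w‖ := by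
  have h := exp_potential_mul hε hz hf w w
  rw [real_inner_self_eq_norm_sq, real_inner_self_eq_norm_sq, two_mul, Real.exp_add] at h
  refine (pow_left_inj₀ (by positivity) (by positivity) two_ne_zero).1 ?_
  rw [← h, lineState]
  ring

/-- The differential of inverse stereographic projection is onto the tangent plane. -/
theorem exists_dstereo_eq {W : ℂ} {y : E3} (hy : inner ℝ (stereo W) y = 0) :
    ∃ w, dstereo W w = y := by
  have := Fact.mk (@finrank_euclideanSpace_fin ℝ _ (2 + 1))
  let T : ℂ →ₗ[ℝ] E3 := ⟨⟨dstereo W, dstereo_add W⟩, fun c w =>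
    (congrArg (dstereo W) Complex.real_smul).trans (dstereo_smul W c w)⟩
  have hle : LinearMap.range T ≤ (ℝ ∙ stereo W)ᗮ := by
    rintro _ ⟨w, rfl⟩
    rw [Submodule.mem_orthogonal_singleton_iff_inner_right]
    have h0 := (one_add_sq_pos W).ne'
    change inner ℝ (stereo W) (dstereo W w) = 0
    rw [inner_E3]
    simp [stereo, dstereo]
    field_simp
    ring
  have hne : stereo W ≠ 0 := fun h => by simpa [h] using norm_stereo W
  have heq := Submodule.eq_of_le_of_finrank_eq hle (by
    rw [LinearMap.finrank_range_of_inj (dstereo_injective W), Complex.finrank_real_complex,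
      Submodule.finrank_orthogonal_span_singleton (n := 2) hne])
  exact heq.ge (Submodule.mem_orthogonal_singleton_iff_inner_right.2 hy)

/-- Every unit tangent vector of the flat region is tangent to the image of a straight line. -/
theorem exists_lineState_eq {ε : ℝ} (hε : 0 < ε) {z : ℂ} (hz : z ∉ coneSet)
    (hf : (devMap z : E3) ∈ flatRegion ε) {y : E3} (hy : inner ℝ (devMap z : E3) y = 0) (t₀ : ℝ)
    (hn : Real.exp (potential ε (devMap z)) * ‖y‖ = 1) :
    ∃ z₀ w : ℂ, ‖w‖ = 1 ∧ z₀ + t₀ * w = z ∧ lineState z₀ w t₀ = ((devMap z : E3), y) := by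
  have hl := notMem_lattice_of_notMem_coneSet hz
  rw [coe_devMap hl] at hy
  obtain ⟨w', hw'⟩ := exists_dstereo_eq hy
  have h1 : z - t₀ * (w' / unif' z) + t₀ * (w' / unif' z) = z := by ring
  have h2 : lineState (z - t₀ * (w' / unif' z)) (w' / unif' z) t₀ = ((devMap z : E3), y) := by
    rw [lineState, h1, mul_div_cancel₀ _ (unif'_ne_zero hz), hw']
  refine ⟨z - t₀ * (w' / unif' z), w' / unif' z, ?_, h1, h2⟩
  have h3 := norm_lineState_snd hε (z₀ := z - t₀ * (w' / unif' z)) (w := w' / unif' z) (t := t₀)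
    (by rwa [h1]) (by rwa [h1])
  rw [← h3, h2]
  exact hn

/-! ### The geometry of the cone points in the plane -/

theorem zeta_mul_re_im (z : ℂ) : (zeta * z).re = -(z.re / 2) - √3 / 2 * z.im ∧
    (zeta * z).im = √3 / 2 * z.re - z.im / 2 := by
  rw [zeta_eq]
  constructor <;> simp <;> ring

/-- The cone points form a hexagonal lattice of side `2`. -/
theorem exists_int_of_mem_coneSet {z : ℂ} (hz : z ∈ coneSet) :
    ∃ m n : ℤ, z.re = 2 * m - n ∧ z.im = √3 * n := by
  have h3 : √3 * √3 = 3 := Real.mul_self_sqrt (by norm_num)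
  have hl : ∀ {l : ℂ}, l ∈ lattice → ∃ m n : ℤ, l.re = 2 * m - n ∧ l.im = √3 * n := by
    intro l hl
    obtain ⟨m, n, h1, h2⟩ := int_coords_of_mem_lattice hl
    exact ⟨m + 2 * n, n - m, by push_cast; linarith, by push_cast; linarith⟩
  have hrot : ∀ (k : ℕ) {w : ℂ}, (∃ m n : ℤ, w.re = 2 * m - n ∧ w.im = √3 * n) →
      ∃ m n : ℤ, (zeta ^ k * w).re = 2 * m - n ∧ (zeta ^ k * w).im = √3 * n := by
    intro k
    induction k with
    | zero => intro w h; simpa using h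
    | succ k ih =>
      intro w h
      obtain ⟨m, n, h1, h2⟩ := ih h
      obtain ⟨e1, e2⟩ := zeta_mul_re_im (zeta ^ k * w)
      rw [pow_succ', mul_assoc]
      refine ⟨-n, m - n, ?_, ?_⟩
      · rw [e1, h1, h2]; push_cast; linear_combination -(n / 2 : ℝ) * h3
      · rw [e2, h1, h2]; push_cast; ring
  have horb : ∀ {c : ℂ}, (∃ m n : ℤ, c.re = 2 * m - n ∧ c.im = √3 * n) → proj z = proj c →
      ∃ m n : ℤ, z.re = 2 * m - n ∧ z.im = √3 * n := by
    intro c hc h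
    obtain ⟨k, -, hk⟩ := proj_eq_iff.1 h
    obtain ⟨m, n, h1, h2⟩ := hrot k hc
    obtain ⟨m', n', h1', h2'⟩ := hl hk
    rw [Complex.sub_re] at h1'
    rw [Complex.sub_im] at h2'
    exact ⟨m - m', n - n', by push_cast; linarith, by push_cast; linarith⟩
  rcases mem_coneSet_iff.1 hz with h | h | h
  · exact hl h
  · exact horb ⟨1, 0, by simp, by simp⟩ h
  · exact horb ⟨-1, 0, by simp, by simp⟩ h

/-- The form `4 (m² - m n + n²)` takes no nonzero value below `4` on integers. -/
theorem two_le_dist_of_mem_coneSet {c d : ℂ} (hc : c ∈ coneSet) (hd : d ∈ coneSet) (h : c ≠ d) :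
    2 ≤ dist c d := by
  obtain ⟨m, n, h1, h2⟩ := exists_int_of_mem_coneSet hc
  obtain ⟨m', n', h1', h2'⟩ := exists_int_of_mem_coneSet hd
  have h3 : √3 * √3 = 3 := Real.mul_self_sqrt (by norm_num)
  have hint : 1 ≤ (m - m') ^ 2 - (m - m') * (n - n') + (n - n') ^ 2 := by
    by_contra! hlt
    have e1 : n - n' = 0 := by nlinarith [sq_nonneg (2 * (m - m') - (n - n'))]
    have e2 : m - m' = 0 := by
      rw [e1] at hlt
      nlinarith
    apply h
    have e1' : n = n' := by omega
    have e2' : m = m' := by omega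
    exact Complex.ext (by rw [h1, h1', e1', e2']) (by rw [h2, h2', e1'])
  have hreal : (1 : ℝ) ≤ ((m : ℝ) - m') ^ 2 - (m - m') * (n - n') + (n - n') ^ 2 := by
    exact_mod_cast hint
  have e : dist c d ^ 2 = 4 * (((m : ℝ) - m') ^ 2 - (m - m') * (n - n') + (n - n') ^ 2) := by
    rw [dist_eq_norm, Complex.sq_norm, Complex.normSq_apply, Complex.sub_re, Complex.sub_im, h1, h2,
      h1', h2']
    linear_combination ((n : ℝ) - n') ^ 2 * h3
  exact le_of_sq_le_sq (by rw [e]; linarith) dist_nonneg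

/-- The form `12 (m² + m n + n²)` takes no nonzero value below `12` on integers. -/
theorem two_sqrt_three_le_norm {l : ℂ} (hl : l ∈ lattice) (h : l ≠ 0) : 2 * √3 ≤ ‖l‖ := by
  obtain ⟨m, n, h1, h2⟩ := int_coords_of_mem_lattice hl
  have h3 : √3 * √3 = 3 := Real.mul_self_sqrt (by norm_num)
  have hint : 1 ≤ m ^ 2 + m * n + n ^ 2 := by
    by_contra! hlt
    have e1 : n = 0 := by nlinarith [sq_nonneg (2 * m + n)]
    have e2 : m = 0 := by
      rw [e1] at hlt
      nlinarith
    apply h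
    exact Complex.ext (by rw [h1, e1, e2]; simp) (by rw [h2, e1, e2]; simp)
  have hreal : (1 : ℝ) ≤ (m : ℝ) ^ 2 + m * n + n ^ 2 := by exact_mod_cast hint
  have e : ‖l‖ ^ 2 = 12 * ((m : ℝ) ^ 2 + m * n + n ^ 2) := by
    rw [Complex.sq_norm, Complex.normSq_apply, h1, h2]
    linear_combination ((n : ℝ) - m) ^ 2 * h3
  refine le_of_sq_le_sq ?_ (norm_nonneg l)
  rw [e]
  nlinarith

/-- The points over the cone points are fixed by the rotations modulo the lattice. -/
theorem zeta_pow_mul_sub_mem_lattice {c : ℂ} (hc : c ∈ coneSet) (k : ℕ) :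
    zeta ^ k * c - c ∈ lattice := by
  have h1 : zeta * c - c ∈ lattice := by
    have hfix : ∀ a : ℂ, zeta * a - a ∈ lattice → proj c = proj a → zeta * c - c ∈ lattice := by
      intro a ha h
      obtain ⟨k, -, hk⟩ := proj_eq_iff.1 h
      have e : zeta * c - c = zeta ^ k * (zeta * a - a) -
          (zeta * (zeta ^ k * a - c) - (zeta ^ k * a - c)) := by ring
      rw [e]
      exact lattice.sub_mem ((zeta_pow_mul_mem_lattice k).2 ha)
        (lattice.sub_mem (zeta_mul_mem_lattice.2 hk) hk)
    have h2 : zeta * 2 - 2 ∈ lattice := by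
      have : zeta * 2 - 2 = -omega₁ := by rw [zeta_eq, omega₁_eq]; ring
      rw [this]
      exact lattice.neg_mem omega₁_mem
    rcases mem_coneSet_iff.1 hc with h | h | h
    · exact lattice.sub_mem (zeta_mul_mem_lattice.2 h) h
    · exact hfix 2 h2 h
    · refine hfix (-2) ?_ h
      have := lattice.neg_mem h2
      have e : zeta * -2 - -2 = -(zeta * 2 - 2) := by ring
      rwa [e]
  induction k with
  | zero => simp [lattice.zero_mem]
  | succ k ih =>
    have e : zeta ^ (k + 1) * c - c = zeta ^ k * (zeta * c - c) + (zeta ^ k * c - c) := by ring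
    rw [e]
    exact lattice.add_mem ((zeta_pow_mul_mem_lattice k).2 h1) ih

/-- Two points over the same cone point differ by an element of the lattice. -/
theorem two_sqrt_three_le_dist {c d : ℂ} (hd : d ∈ coneSet) (h : c ≠ d)
    (hp : proj c = proj d) : 2 * √3 ≤ dist c d := by
  obtain ⟨k, -, hk⟩ := proj_eq_iff.1 hp
  rw [dist_comm, dist_eq_norm]
  refine two_sqrt_three_le_norm ?_ (sub_ne_zero.2 h.symm)
  have := lattice.sub_mem hk (zeta_pow_mul_sub_mem_lattice hd k)
  have e : zeta ^ k * d - c - (zeta ^ k * d - d) = d - c := by ring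
  rwa [e] at this

theorem unif'_affine (k : ℕ) (z : ℂ) {l : ℂ} (hl : l ∈ lattice) :
    unif' (zeta ^ k * z + l) = (zeta ^ k) ^ 2 * unif' z := by
  rw [unif', unif', wp_add_lattice _ hl, wp_zeta_pow_mul]
  ring

/-! ### Lengths of closed geodesics -/

theorem infDist_coneSet_pos_iff {z : ℂ} : 0 < Metric.infDist z coneSet ↔ z ∉ coneSet :=
  (isClosed_coneSet.notMem_iff_infDist_pos ⟨0, zero_mem_coneSet⟩).symm

/-- A straight line whose image closes up smoothly after time `L` moves by a lattice vector. -/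
theorem two_sqrt_three_le_of_lineState_eq {z₀ w : ℂ} {t L : ℝ} (hL : 0 < L) (hw : ‖w‖ = 1)
    (hz : z₀ + t * w ∉ coneSet) (h : lineState z₀ w (t + L) = lineState z₀ w t) :
    2 * √3 ≤ L := by
  have hw0 : w ≠ 0 := by
    intro h0
    rw [h0] at hw
    simp at hw
  have h1 : devMap (z₀ + (t + L : ℝ) * w) = devMap (z₀ + t * w) :=
    Subtype.ext (congrArg Prod.fst h)
  obtain ⟨k, hk3, hl⟩ := proj_eq_iff.1 (devMap_eq_iff.1 h1)
  set z := z₀ + t * w with hzdef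
  have e : z₀ + (t + L : ℝ) * w = z + L * w := by rw [hzdef]; push_cast; ring
  rw [e] at hl h1
  have e2 : z + L * w = zeta ^ k * z + -(zeta ^ k * z - (z + L * w)) := by ring
  have h2 := congrArg Prod.snd h
  simp only [lineState] at h2
  rw [← hzdef, e, unif_eq_of_proj_eq (devMap_eq_iff.1 h1)] at h2
  have h3 := dstereo_injective _ h2
  rw [e2, unif'_affine k z (lattice.neg_mem hl)] at h3
  have h4 : (zeta ^ k) ^ 2 = 1 := by
    refine mul_right_cancel₀ (mul_ne_zero (unif'_ne_zero hz) hw0) ?_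
    rw [one_mul, ← mul_assoc]
    exact h3
  have hk : k = 0 := by
    by_contra hk0
    refine zeta_pow_ne_one (Nat.pos_of_ne_zero hk0) hk3 ?_
    have h5 : (zeta ^ k) ^ 3 = 1 := by rw [← pow_mul, mul_comm, pow_mul, zeta_pow_three, one_pow]
    linear_combination h5 - zeta ^ k * h4
  rw [hk, pow_zero, one_mul, sub_add_cancel_left] at hl
  have := two_sqrt_three_le_norm hl (neg_ne_zero.2 (mul_ne_zero (by exact_mod_cast hL.ne') hw0))
  rwa [norm_neg, norm_mul, hw, mul_one, Complex.norm_of_nonneg hL.le] at this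

/-- A continuous function which exceeds `r` at time `t₀` either does so ever after, or there is a
first time at which it equals `r`. -/
theorem first_exit {g : ℝ → ℝ} (hg : Continuous g) {t₀ r : ℝ} (h0 : r < g t₀) :
    (∀ t ≥ t₀, r < g t) ∨ ∃ b > t₀, g b = r ∧ ∀ t ∈ Ico t₀ b, r < g t := by
  by_cases h : ∀ t ≥ t₀, r < g t
  · exact Or.inl h
  · right
    push Not at h
    obtain ⟨t₁, ht₁, hgt⟩ := h
    set S := {t | t₀ ≤ t ∧ g t ≤ r} with hS
    have hcl : IsClosed S :=
      (isClosed_le continuous_const continuous_id).inter (isClosed_le hg continuous_const)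
    have hbdd : BddBelow S := ⟨t₀, fun t ht => ht.1⟩
    have hmem : sInf S ∈ S := hcl.csInf_mem ⟨t₁, ht₁, hgt⟩ hbdd
    have hlt : ∀ t ∈ Ico t₀ (sInf S), r < g t := by
      intro t ht
      by_contra! hle
      exact absurd (csInf_le hbdd (show t ∈ S from ⟨ht.1, hle⟩)) (not_le.2 ht.2)
    have hb : t₀ < sInf S := by
      refine lt_of_le_of_ne hmem.1 fun heq => ?_
      have := hmem.2
      rw [← heq] at this
      linarith
    refine ⟨sInf S, hb, le_antisymm hmem.2 ?_, hlt⟩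
    refine ge_of_tendsto (hg.continuousWithinAt (s := Iio (sInf S)) (x := sInf S)) ?_
    filter_upwards [Ico_mem_nhdsLT hb] with t ht
    exact (hlt t ht).le

theorem first_exit_left {g : ℝ → ℝ} (hg : Continuous g) {t₀ r : ℝ} (h0 : r < g t₀) :
    (∀ t ≤ t₀, r < g t) ∨ ∃ a < t₀, g a = r ∧ ∀ t ∈ Ioc a t₀, r < g t := by
  rcases first_exit (g := fun t => g (-t)) (by fun_prop) (t₀ := -t₀) (r := r)
    (by simpa using h0) with h | ⟨b, hb, hgb, h⟩
  · left
    intro t ht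
    simpa using h (-t) (by linarith)
  · right
    refine ⟨-b, by linarith, hgb, fun t ht => ?_⟩
    simpa using h (-t) ⟨by linarith [ht.2], by linarith [ht.1]⟩

/-- A connected set which lies in the union of the three caps lies in one of them. -/
theorem chord_lt_of_isPreconnected {α : Type*} [TopologicalSpace α] {f : α → S2}
    (hf : Continuous f) {K : Set α} (hK : IsPreconnected K)
    (h : ∀ x ∈ K, ∃ i, chord i (f x) < 1 / 200) {x₀ : α} (hx₀ : x₀ ∈ K) {i : Fin 3}
    (hi : chord i (f x₀) < 1 / 200) : ∀ x ∈ K, chord i (f x) < 1 / 200 := by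
  have hopen : ∀ j, IsOpen {x | chord j (f x) < 1 / 200} := fun j =>
    isOpen_lt ((continuous_chord j).comp hf) continuous_const
  have hsub := hK.subset_left_of_subset_union (u := {x | chord i (f x) < 1 / 200})
    (v := ⋃ j ∈ {j | j ≠ i}, {x | chord j (f x) < 1 / 200}) (hopen i)
    (isOpen_biUnion fun j _ => hopen j) ?_ ?_ ⟨x₀, hx₀, hi⟩
  · exact fun x hx => hsub hx
  · rw [Set.disjoint_left]
    intro x hx hx2
    simp only [mem_iUnion, mem_ofPred_eq] at hx hx2
    obtain ⟨j, hj, hx2⟩ := hx2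
    have := one_le_chord_of_chord_le (Ne.symm hj) (norm_eq_of_mem_sphere (f x)) hx.le
    linarith
  · intro x hx
    obtain ⟨j, hj⟩ := h x hx
    by_cases hji : j = i
    · left; rw [hji] at hj; exact hj
    · right
      exact mem_biUnion (show j ∈ {j | j ≠ i} from hji) hj

/-- The point of the sphere occupied at time `t`. -/
def IsClosedOrbit.point {v : E3 → ℝ} {L : ℝ} {X : ℝ → E3 × E3} (h : IsClosedOrbit v L X)
    (t : ℝ) : S2 := ⟨(X t).1, by simp [h.norm_fst t]⟩

theorem IsClosedOrbit.continuous_point {v : E3 → ℝ} {L : ℝ} {X : ℝ → E3 × E3}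
    (h : IsClosedOrbit v L X) : Continuous h.point :=
  Continuous.subtype_mk
    (continuous_iff_continuousAt.2 fun t => (h.hasDerivAt_fst t).continuousAt) _

theorem IsClosedOrbit.point_add {v : E3 → ℝ} {L : ℝ} {X : ℝ → E3 × E3}
    (h : IsClosedOrbit v L X) (t : ℝ) : h.point (t + L) = h.point t :=
  Subtype.ext (congrArg Prod.fst (h.periodic t))

section Excursion

variable {ε ρ L : ℝ} {X : ℝ → E3 × E3}

/-- Outside the caps a closed orbit is the image of a straight line. -/
theorem IsClosedOrbit.exists_eq_lineState (h : IsClosedOrbit (potential ε) L X) (hε : 0 < ε)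
    (hρ : 0 < ρ) (hA : ∀ x : S2, ρ ≤ poleDist x → ∀ i, ε ≤ chord i x) {t₀ : ℝ}
    (ht₀ : ρ < poleDist (h.point t₀)) :
    ∃ z₀ w : ℂ, ‖w‖ = 1 ∧ ρ < Metric.infDist (z₀ + t₀ * w) coneSet ∧
      ∀ a b, t₀ ∈ Ioo a b → (∀ t ∈ Icc a b, ρ ≤ Metric.infDist (z₀ + t * w) coneSet) →
        EqOn X (lineState z₀ w) (Icc a b) := by
  obtain ⟨z, hz⟩ := devMap_surjective (h.point t₀)
  have hg : ∀ {x : ℂ}, ρ ≤ Metric.infDist x coneSet →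
      x ∉ coneSet ∧ (devMap x : E3) ∈ flatRegion ε := fun {x} hx =>
    ⟨infDist_coneSet_pos_iff.1 (hρ.trans_le hx), hA _ (by rwa [poleDist_devMap])⟩
  have hz1 : (devMap z : E3) = (X t₀).1 := congrArg Subtype.val hz
  have hzρ : ρ < Metric.infDist z coneSet := by rwa [← poleDist_devMap, hz]
  obtain ⟨hz2, hz3⟩ := hg hzρ.le
  obtain ⟨z₀, w, hw, e1, e2⟩ := exists_lineState_eq hε hz2 hz3 (y := (X t₀).2)
    (by rw [hz1]; exact h.inner_eq_zero t₀) t₀ (by rw [hz1]; exact h.exp_mul_norm_snd t₀)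
  refine ⟨z₀, w, hw, by rwa [e1], fun a b ht hab => ?_⟩
  refine eqOn_of_hasDerivAt_stateField (contDiff_potential hε) ht (fun t _ => h.hasDerivAt t)
    (fun t ht => ?_) ?_
  · obtain ⟨h1, h2⟩ := hg (hab t ht)
    exact hasDerivAt_lineState hε h1 h2
  · rw [e2, hz1]

theorem IsClosedOrbit.point_eq_devMap (h : IsClosedOrbit (potential ε) L X) {z₀ w : ℂ} {t : ℝ}
    (ht : X t = lineState z₀ w t) : h.point t = devMap (z₀ + t * w) :=
  Subtype.ext (congrArg Prod.fst ht)

/-- The discs of radius `ρ` about the points over a cone point lie over one cap. -/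
theorem chord_devMap_lt (hB : ∀ x : S2, poleDist x ≤ ρ → ∃ i, chord i x < 1 / 200) {c z : ℂ}
    (hρ : 0 ≤ ρ) (hc : c ∈ coneSet) (hz : dist z c ≤ ρ) {i : Fin 3}
    (hi : devMap c = poleSphere i) : chord i (devMap z) < 1 / 200 := by
  refine chord_lt_of_isPreconnected continuous_devMap
    (convex_closedBall c ρ).isPreconnected (fun x hx => hB _ ?_)
    (Metric.mem_closedBall_self hρ) ?_ z hz
  · rw [poleDist_devMap]
    exact (Metric.infDist_le_dist_of_mem hc).trans hx
  · rw [chord_eq_zero_iff.2 hi]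
    norm_num

/-- A closed orbit which is outside the caps at time `t₀` either has length at least `2√3`, or
runs there along a straight segment from the disc about one cone point to the disc about a
different one. -/
theorem IsClosedOrbit.exists_excursion (h : IsClosedOrbit (potential ε) L X) (hL : 0 < L)
    (hε : 0 < ε) (hρ : 0 < ρ) (hA : ∀ x : S2, ρ ≤ poleDist x → ∀ i, ε ≤ chord i x)
    (hB : ∀ x : S2, poleDist x ≤ ρ → ∃ i, chord i x < 1 / 200) {t₀ : ℝ}
    (ht₀ : ρ < poleDist (h.point t₀)) :
    2 * √3 ≤ L ∨ ∃ a b : ℝ, ∃ c ∈ coneSet, ∃ d ∈ coneSet, t₀ ∈ Ioo a b ∧ c ≠ d ∧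
      dist c d ≤ b - a + 2 * ρ ∧ poleDist (h.point a) = ρ ∧ poleDist (h.point b) = ρ ∧
      (∀ t ∈ Ioo a b, ρ < poleDist (h.point t)) ∧
      (∀ i, devMap c = poleSphere i → chord i (h.point a) < 1 / 200) ∧
      (∀ i, devMap d = poleSphere i → chord i (h.point b) < 1 / 200) := by
  obtain ⟨z₀, w, hw, hg0, hline⟩ := h.exists_eq_lineState hε hρ hA ht₀
  set g : ℝ → ℝ := fun t => Metric.infDist (z₀ + t * w) coneSet with hgdef
  have hgc : Continuous g := (Metric.continuous_infDist_pt coneSet).comp (by fun_prop)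
  have hright : ∃ b > t₀, (∀ t ∈ Icc t₀ b, ρ ≤ g t) ∧
      (t₀ + L ≤ b ∨ g b = ρ ∧ ∀ t ∈ Ico t₀ b, ρ < g t) := by
    rcases first_exit hgc hg0 with h1 | ⟨b, hb, h1, h2⟩
    · exact ⟨t₀ + L, by linarith, fun t ht => (h1 t ht.1).le, Or.inl le_rfl⟩
    · refine ⟨b, hb, fun t ht => ?_, Or.inr ⟨h1, h2⟩⟩
      rcases eq_or_lt_of_le ht.2 with rfl | hlt
      · exact h1.ge
      · exact (h2 t ⟨ht.1, hlt⟩).le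
  have hleft : ∃ a < t₀, (∀ t ∈ Icc a t₀, ρ ≤ g t) ∧
      (a ≤ t₀ - L ∨ g a = ρ ∧ ∀ t ∈ Ioc a t₀, ρ < g t) := by
    rcases first_exit_left hgc hg0 with h1 | ⟨a, ha, h1, h2⟩
    · exact ⟨t₀ - L, by linarith, fun t ht => (h1 t ht.2).le, Or.inl le_rfl⟩
    · refine ⟨a, ha, fun t ht => ?_, Or.inr ⟨h1, h2⟩⟩
      rcases eq_or_lt_of_le ht.1 with rfl | hlt
      · exact h1.ge
      · exact (h2 t ⟨hlt, ht.2⟩).le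
  obtain ⟨b, hb, hgb, hb'⟩ := hright
  obtain ⟨a, ha, hga, ha'⟩ := hleft
  have hab : ∀ t ∈ Icc a b, ρ ≤ g t := fun t ht => by
    rcases le_total t t₀ with h1 | h1
    · exact hga t ⟨ht.1, h1⟩
    · exact hgb t ⟨h1, ht.2⟩
  have hX := hline a b ⟨ha, hb⟩ hab
  have hclose : ∀ t, t ∈ Icc a b → t + L ∈ Icc a b → 2 * √3 ≤ L := fun t h1 h2 => by
    refine two_sqrt_three_le_of_lineState_eq hL hw
      (infDist_coneSet_pos_iff.1 (hρ.trans_le (hab t h1))) ?_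
    rw [← hX h1, ← hX h2, h.periodic]
  rcases hb' with hb' | ⟨hb1, hb2⟩
  · exact Or.inl (hclose t₀ ⟨ha.le, hb.le⟩ ⟨by linarith, hb'⟩)
  rcases ha' with ha' | ⟨ha1, ha2⟩
  · exact Or.inl (hclose (t₀ - L) ⟨ha', by linarith⟩ ⟨by linarith, by linarith⟩)
  right
  have hp : ∀ t ∈ Icc a b, h.point t = devMap (z₀ + t * w) := fun t ht =>
    h.point_eq_devMap (hX ht)
  have hma : a ∈ Icc a b := ⟨le_rfl, by linarith⟩
  have hmb : b ∈ Icc a b := ⟨by linarith, le_rfl⟩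
  obtain ⟨c, hc, hca⟩ := isClosed_coneSet.exists_infDist_eq_dist ⟨0, zero_mem_coneSet⟩ (z₀ + a * w)
  obtain ⟨d, hd, hdb⟩ := isClosed_coneSet.exists_infDist_eq_dist ⟨0, zero_mem_coneSet⟩ (z₀ + b * w)
  have hca' : dist (z₀ + a * w) c = ρ := hca.symm.trans ha1
  have hdb' : dist (z₀ + b * w) d = ρ := hdb.symm.trans hb1
  refine ⟨a, b, c, hc, d, hd, ⟨ha, hb⟩, ?_, ?_, ?_, ?_, ?_, ?_, ?_⟩
  · -- the disc about a cone point is convex, and the segment leaves it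
    rintro rfl
    have hseg : z₀ + t₀ * w ∈ segment ℝ (z₀ + a * w) (z₀ + b * w) := by
      have hba : b - a ≠ 0 := by linarith
      refine ⟨(b - t₀) / (b - a), (t₀ - a) / (b - a), div_nonneg (by linarith) (by linarith),
        div_nonneg (by linarith) (by linarith), by field_simp; ring, ?_⟩
      have hba' : (b : ℂ) - a ≠ 0 := by exact_mod_cast hba
      simp only [Complex.real_smul]
      push_cast
      field_simp
      ring
    have hmem := (convex_closedBall c ρ).segment_subset (Metric.mem_closedBall.2 hca'.le)
      (Metric.mem_closedBall.2 hdb'.le) hseg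
    have := (Metric.infDist_le_dist_of_mem hc).trans (Metric.mem_closedBall.1 hmem)
    linarith
  · have h1 : dist (z₀ + a * w) (z₀ + b * w) = b - a := by
      rw [dist_comm, dist_eq_norm]
      have : z₀ + b * w - (z₀ + a * w) = ((b - a : ℝ) : ℂ) * w := by push_cast; ring
      rw [this, norm_mul, hw, mul_one, Complex.norm_of_nonneg (by linarith)]
    have h2 := dist_triangle4 c (z₀ + a * w) (z₀ + b * w) d
    rw [dist_comm c (z₀ + a * w)] at h2
    linarith
  · rw [hp a hma, poleDist_devMap]; exact ha1
  · rw [hp b hmb, poleDist_devMap]; exact hb1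
  · intro t ht
    rw [hp t ⟨ht.1.le, ht.2.le⟩, poleDist_devMap]
    rcases le_total t t₀ with h1 | h1
    · exact ha2 t ⟨ht.1, h1⟩
    · exact hb2 t ⟨h1, ht.2⟩
  · intro i hi
    rw [hp a hma]
    exact chord_devMap_lt hB hρ.le hc hca'.le hi
  · intro i hi
    rw [hp b hmb]
    exact chord_devMap_lt hB hρ.le hd hdb'.le hi

/-- A closed orbit makes an excursion between two different points over the same cone point, which
are at distance at least `2√3`, or else at least two excursions of length almost `2`. -/
theorem IsClosedOrbit.le_length (h : IsClosedOrbit (potential ε) L X) (hL : 0 < L)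
    (hε : 0 < ε) (hρ : 0 < ρ) (hρ4 : ρ ≤ 1 / 4)
    (hA : ∀ x : S2, ρ ≤ poleDist x → ∀ i, ε ≤ chord i x)
    (hB : ∀ x : S2, poleDist x ≤ ρ → ∃ i, chord i x < 1 / 200) :
    2 * √3 - 2 * ρ ≤ L := by
  -- an orbit which never leaves the caps would stay in a single one
  obtain ⟨t₀, ht₀⟩ : ∃ t₀, ρ < poleDist (h.point t₀) := by
    by_contra! hle
    obtain ⟨i, hi⟩ := hB _ (hle 0)
    obtain ⟨t, ht⟩ := h.exists_lt_chord hε hL i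
    have := chord_lt_of_isPreconnected h.continuous_point isPreconnected_univ
      (fun t _ => hB _ (hle t)) (mem_univ 0) hi t (mem_univ t)
    exact absurd ht (not_lt.2 this.le)
  rcases h.exists_excursion hL hε hρ hA hB ht₀ with hlong |
    ⟨a, b, c, hc, d, hd, ht, hcd, hdist, hpa, hpb, hab, hca, hdb⟩
  · linarith
  -- the excursion ends within one period, as the orbit is on the edge of a disc at time `a + L`
  have hbL : b ≤ a + L := by
    by_contra! hlt
    have := hab (a + L) ⟨by linarith, hlt⟩
    rw [h.point_add] at this
    linarith
  obtain ⟨i, hi⟩ := mem_coneSet_iff_devMap.1 hc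
  obtain ⟨j, hj⟩ := mem_coneSet_iff_devMap.1 hd
  -- an excursion which returns to the same cone point has length almost `2√3`
  by_cases hij : i = j
  · have := two_sqrt_three_le_dist hd hcd (devMap_eq_iff.1 (by rw [hi, hj, hij]))
    linarith
  -- the excursion leads to a different cone point, so the orbit cannot stay in one cap afterwards
  obtain ⟨t₁, ht₁, hρ₁⟩ : ∃ t₁ ∈ Ioo b (a + L), ρ < poleDist (h.point t₁) := by
    by_contra! hle
    have hle' : ∀ t ∈ Icc b (a + L), poleDist (h.point t) ≤ ρ := by
      intro t ht
      rcases eq_or_lt_of_le ht.1 with rfl | h1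
      · exact hpb.le
      rcases eq_or_lt_of_le ht.2 with rfl | h2
      · rw [h.point_add]; exact hpa.le
      exact hle t ⟨h1, h2⟩
    have h1 := chord_lt_of_isPreconnected h.continuous_point isPreconnected_Icc
      (fun t ht => hB _ (hle' t ht)) (left_mem_Icc.2 hbL) (hdb j hj) (a + L) (right_mem_Icc.2 hbL)
    rw [h.point_add] at h1
    have h2 := one_le_chord_of_chord_le hij (norm_eq_of_mem_sphere _) (hca i hi).le
    linarith
  rcases h.exists_excursion hL hε hρ hA hB hρ₁ with hlong |
    ⟨a', b', c', hc', d', hd', ht', hcd', hdist', -, -, hab', -, -⟩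
  · linarith
  have h1 : b ≤ a' := by
    by_contra! hlt
    have := hab' b ⟨hlt, ht₁.1.trans ht'.2⟩
    linarith
  have h2 : b' ≤ a + L := by
    by_contra! hlt
    have := hab' (a + L) ⟨ht'.1.trans ht₁.2, hlt⟩
    rw [h.point_add] at this
    linarith
  have h3 := two_le_dist_of_mem_coneSet hc hd hcd
  have h4 := two_le_dist_of_mem_coneSet hc' hd' hcd'
  have h5 : √3 ≤ 7 / 4 := by
    rw [Real.sqrt_le_left (by norm_num)]
    norm_num
  linarith

end Excursion

/-- The straight line through `-1` with direction `ω₂` stays at distance `1/2` from the cone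
points: a linear form of norm one is an integer at the cone points and `1/2` on the line. -/
theorem half_le_infDist_line (t : ℝ) :
    1 / 2 ≤ Metric.infDist (-1 + t * (omega₂ / (2 * √3 : ℝ))) coneSet := by
  have h3 : √3 * √3 = 3 := Real.mul_self_sqrt (by norm_num)
  have h30 : (0 : ℝ) < √3 := by positivity
  refine (Metric.le_infDist ⟨0, zero_mem_coneSet⟩).2 fun c hc => ?_
  obtain ⟨m, n, h1, h2⟩ := exists_int_of_mem_coneSet hc
  have e : omega₂ / (2 * √3 : ℝ) = ⟨√3 / 2, 1 / 2⟩ := by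
    rw [div_eq_iff (by exact_mod_cast (by positivity : (2 * √3 : ℝ) ≠ 0)), omega₂_eq]
    apply Complex.ext
    · simp; linear_combination -h3
    · simp
  rw [e]
  set z : ℂ := -1 + t * ⟨√3 / 2, 1 / 2⟩ with hz
  have hre : z.re = -1 + t * (√3 / 2) := by simp [hz]
  have him : z.im = t / 2 := by simp [hz]; ring
  have hint : (1 / 4 : ℝ) ≤ (1 / 2 - (2 * n - m : ℤ)) ^ 2 := by
    generalize (2 * n - m : ℤ) = N
    rcases le_or_gt N 0 with h | h
    · have : (N : ℝ) ≤ 0 := by exact_mod_cast h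
      nlinarith
    · have : (1 : ℝ) ≤ N := by exact_mod_cast h
      nlinarith
  have hform : -(z.re - c.re) / 2 + √3 / 2 * (z.im - c.im) = 1 / 2 - (2 * n - m : ℤ) := by
    rw [hre, him, h1, h2]
    push_cast
    linear_combination -(n / 2 : ℝ) * h3
  rw [← hform] at hint
  refine le_of_sq_le_sq ?_ dist_nonneg
  rw [dist_eq_norm, Complex.sq_norm, Complex.normSq_apply, Complex.sub_re, Complex.sub_im]
  nlinarith [sq_nonneg (√3 / 2 * (z.re - c.re) + (z.im - c.im) / 2)]

/-- The line of `half_le_infDist_line` closes up after the period `ω₂`, of length `2√3`. -/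
theorem nonempty_closedGeodesicLengths {ε ρ : ℝ} (hε : 0 < ε) (hρ : ρ ≤ 1 / 2)
    (hA : ∀ x : S2, ρ ≤ poleDist x → ∀ i, ε ≤ chord i x) :
    (closedGeodesicLengths (cappedMetric hε)).Nonempty := by
  have h30 : (0 : ℝ) < 2 * √3 := by positivity
  have h3c : ((2 * √3 : ℝ) : ℂ) ≠ 0 := by exact_mod_cast h30.ne'
  have hz : ∀ t : ℝ, (-1 + t * (omega₂ / (2 * √3 : ℝ))) ∉ coneSet := fun t =>
    infDist_coneSet_pos_iff.1 (by linarith [half_le_infDist_line t])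
  have hf : ∀ t : ℝ, (devMap (-1 + t * (omega₂ / (2 * √3 : ℝ))) : E3) ∈ flatRegion ε := fun t =>
    hA _ (by rw [poleDist_devMap]; linarith [half_le_infDist_line t])
  refine ⟨2 * √3, (mem_closedGeodesicLengths_confMetric (contDiff_potential hε)).2 ⟨h30,
    lineState (-1) (omega₂ / (2 * √3 : ℝ)), fun t => hasDerivAt_lineState hε (hz t) (hf t),
    fun t => norm_eq_of_mem_sphere _, fun t => ?_, fun t => ?_⟩⟩
  · rw [norm_lineState_snd hε (hz t) (hf t), norm_div, Complex.norm_of_nonneg h30.le]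
    have : ‖omega₂‖ = 2 * √3 := by
      rw [omega₂, show (Real.pi * Complex.I / 6 : ℂ) = ((Real.pi / 6 : ℝ) : ℂ) * Complex.I by
        push_cast; ring, norm_mul, norm_mul, Complex.norm_exp_ofReal_mul_I, mul_one,
        Complex.norm_of_nonneg (Real.sqrt_nonneg 3)]
      simp
    rw [this, div_self h30.ne']
  · have e : -1 + (t + 2 * √3 : ℝ) * (omega₂ / (2 * √3 : ℝ)) =
        -1 + t * (omega₂ / (2 * √3 : ℝ)) + omega₂ := by
      rw [Complex.ofReal_add]
      field_simp
      ring
    have e1 := unif'_affine 0 (-1 + t * (omega₂ / (2 * √3 : ℝ))) omega₂_mem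
    rw [pow_zero, one_mul, one_pow, one_mul] at e1
    rw [lineState, lineState, e, devMap_add_mem _ omega₂_mem, e1,
      unif_eq_of_proj_eq (proj_add_mem _ omega₂_mem)]

/-- The capped metric has a shortest closed geodesic, of length almost `2√3`. -/
theorem exists_isLeast_cappedMetric {ε ρ : ℝ} (hε : 0 < ε) (hρ : 0 < ρ) (hρ4 : ρ ≤ 1 / 4)
    (hA : ∀ x : S2, ρ ≤ poleDist x → ∀ i, ε ≤ chord i x)
    (hB : ∀ x : S2, poleDist x ≤ ρ → ∃ i, chord i x < 1 / 200) :
    ∃ ℓ, IsLeast (closedGeodesicLengths (cappedMetric hε)) ℓ ∧ 2 * √3 - 2 * ρ ≤ ℓ := by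
  refine exists_isLeast_closedGeodesicLengths (contDiff_potential hε) ?_
    (nonempty_closedGeodesicLengths hε (by linarith) hA) fun L hL => ?_
  · have : (1 : ℝ) ≤ √3 := Real.one_le_sqrt.2 (by norm_num)
    linarith
  · obtain ⟨hpos, X, hX⟩ := (mem_closedGeodesicLengths_confMetric _).1 hL
    exact hX.le_length hpos hε hρ hρ4 hA hB

/-! ### Cone angles -/

/-- Distances between orbits can be measured from any given representative. -/
theorem exists_proj_eq_dist_eq {z z' : ℂ} (h : proj z' = proj z) (w : ℂ) :
    ∃ w', proj w' = proj w ∧ dist z w' = dist z' w := by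
  obtain ⟨k, -, hk⟩ := proj_eq_iff.1 h.symm
  refine ⟨zeta ^ k * w + -(zeta ^ k * z' - z), proj_affine k (lattice.neg_mem hk) w, ?_⟩
  rw [← (isometry_affine k (-(zeta ^ k * z' - z))).dist_eq z' w]
  congr 1
  ring

theorem crokeDist_proj_eq {z w : ℂ} {d : ℝ} (h : ∀ w', proj w' = proj w → d ≤ dist z w')
    (h' : ∃ w', proj w' = proj w ∧ dist z w' = d) : crokeDist (proj z) (proj w) = d := by
  refine IsLeast.csInf_eq ⟨?_, ?_⟩
  · obtain ⟨w', h1, h2⟩ := h'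
    exact ⟨z, w', rfl, h1, h2.symm⟩
  · rintro _ ⟨z', w', h1, h2, rfl⟩
    obtain ⟨w'', h3, h4⟩ := exists_proj_eq_dist_eq h1 w'
    exact h4 ▸ h w'' (h3.trans h2)

theorem exists_dist_lt_of_crokeDist_lt {z : ℂ} {q : CrokeSphere} {r : ℝ}
    (h : crokeDist (proj z) q < r) : ∃ w, proj w = q ∧ dist z w < r := by
  obtain ⟨w₀, hw₀⟩ := proj_surjective q
  obtain ⟨_, ⟨z', w', h1, h2, rfl⟩, hlt⟩ :=
    exists_lt_of_csInf_lt (by exact ⟨_, z, w₀, rfl, hw₀, rfl⟩) h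
  obtain ⟨w'', h3, h4⟩ := exists_proj_eq_dist_eq h1 w'
  exact ⟨w'', h3.trans h2, h4 ▸ hlt⟩

/-- The law of cosines. -/
theorem norm_polar_sub_polar (ρ ρ' s t : ℝ) :
    ‖(ρ * Complex.exp (s * Complex.I) - ρ' * Complex.exp (t * Complex.I) : ℂ)‖ =
      √(ρ ^ 2 + ρ' ^ 2 - 2 * ρ * ρ' * Real.cos (s - t)) := by
  rw [← Real.sqrt_sq (norm_nonneg _), Complex.sq_norm, Complex.normSq_apply]
  congr 1
  simp only [Complex.sub_re, Complex.sub_im, Complex.re_ofReal_mul, Complex.im_ofReal_mul,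
    Complex.exp_ofReal_mul_I_re, Complex.exp_ofReal_mul_I_im, Real.cos_sub]
  linear_combination ρ ^ 2 * Real.sin_sq_add_cos_sq s + ρ' ^ 2 * Real.sin_sq_add_cos_sq t

section ConeAngle

variable {N : ℕ}

/-- For the cone angles `2π/N` an angle modulo the cone angle never exceeds `π`. -/
theorem min_pi_norm_eq (hN : 0 < N) (x : ℝ) :
    min Real.pi ‖(x : AddCircle (2 * Real.pi / N))‖ = ‖(x : AddCircle (2 * Real.pi / N))‖ := by
  have hN' : (1 : ℝ) ≤ N := by exact_mod_cast hN
  have hθ : 0 < 2 * Real.pi / N := by have := Real.pi_pos; positivity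
  refine min_eq_right ((AddCircle.norm_le_half_period _ hθ.ne').trans ?_)
  rw [abs_of_pos hθ, div_div, div_le_iff₀ (by positivity)]
  nlinarith [Real.pi_pos]

/-- Among the angles congruent to `x` modulo `2π/N`, the cosine is largest at the smallest one. -/
theorem cos_sub_le_cos_norm (hN : 0 < N) (x : ℝ) (n : ℤ) :
    Real.cos (x - n * (2 * Real.pi / N)) ≤
      Real.cos (min Real.pi ‖(x : AddCircle (2 * Real.pi / N))‖) := by
  rw [min_pi_norm_eq hN]
  set y := x - n * (2 * Real.pi / N) with hy
  set m := round ((2 * Real.pi)⁻¹ * y) with hm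
  have h1 := AddCircle.norm_eq (2 * Real.pi) (x := y)
  rw [← hm] at h1
  have hpi : |y - m * (2 * Real.pi)| ≤ Real.pi := by
    rw [← h1]
    have := AddCircle.norm_le_half_period (2 * Real.pi) (x := (y : AddCircle (2 * Real.pi)))
      (by positivity)
    rwa [abs_of_pos (by positivity), mul_div_cancel_left₀ _ two_ne_zero] at this
  have h2 : Real.cos y = Real.cos |y - m * (2 * Real.pi)| := by
    rw [Real.cos_abs, Real.cos_sub_int_mul_two_pi]
  rw [h2]
  refine Real.cos_le_cos_of_nonneg_of_le_pi (norm_nonneg _) hpi ?_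
  have hN' : (N : ℝ) ≠ 0 := by positivity
  have h3 : (x : AddCircle (2 * Real.pi / N)) =
      ((y - m * (2 * Real.pi) : ℝ) : AddCircle (2 * Real.pi / N)) := by
    rw [← sub_eq_zero, ← AddCircle.coe_sub, AddCircle.coe_eq_zero_iff]
    refine ⟨n + m * N, ?_⟩
    rw [zsmul_eq_mul, hy]
    push_cast
    field_simp
    ring
  rw [h3]
  exact QuotientAddGroup.norm_mk_le_norm

theorem exists_cos_sub_eq_cos_norm (hN : 0 < N) (x : ℝ) : ∃ n : ℤ,
    Real.cos (x - n * (2 * Real.pi / N)) =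
      Real.cos (min Real.pi ‖(x : AddCircle (2 * Real.pi / N))‖) :=
  ⟨_, by rw [min_pi_norm_eq hN, AddCircle.norm_eq, Real.cos_abs]⟩

theorem coneDist_le_add {θ ρ ρ' s t : ℝ} (hρ : 0 ≤ ρ) (hρ' : 0 ≤ ρ') :
    coneDist θ ρ s ρ' t ≤ ρ + ρ' := by
  refine Real.sqrt_le_iff.2 ⟨by positivity, ?_⟩
  nlinarith [mul_nonneg hρ hρ', Real.neg_one_le_cos (min Real.pi ‖((s - t : ℝ) : AddCircle θ)‖)]

/-- If the points near `c` which are identified in the quotient are exactly those which differ by a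
rotation about `c` of order `N`, then the cone angle at the image of `c` is `2π/N`. -/
theorem hasConeAngle_of_rotation (hN : 0 < N) {c : ℂ} {r : ℝ} (hr : 0 < r)
    (hrot : ∀ (u : ℂ) (n : ℤ),
      proj (c + Complex.exp ((n * (2 * Real.pi / N) : ℝ) * Complex.I) * u) = proj (c + u))
    (hsep : ∀ u u' : ℂ, ‖u‖ < r → ‖u'‖ < 3 * r → proj (c + u') = proj (c + u) →
      ∃ n : ℤ, u' = Complex.exp ((n * (2 * Real.pi / N) : ℝ) * Complex.I) * u) :
    HasConeAngle (proj c) (2 * Real.pi / N) := by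
  have hpolar : ∀ (ρ t α : ℝ), Complex.exp (α * Complex.I) * (ρ * Complex.exp (t * Complex.I)) =
      ρ * Complex.exp ((t + α : ℝ) * Complex.I) := by
    intro ρ t α
    rw [Complex.ofReal_add, add_mul, Complex.exp_add]
    ring
  have hnorm : ∀ {ρ : ℝ}, 0 ≤ ρ → ∀ s : ℝ, ‖(ρ * Complex.exp (s * Complex.I) : ℂ)‖ = ρ :=
    fun hρ s => by
      rw [norm_mul, Complex.norm_exp_ofReal_mul_I, mul_one, Complex.norm_of_nonneg hρ]
  refine ⟨r, hr, fun ρ s => proj (c + ρ * Complex.exp (s * Complex.I)), fun s => by simp,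
    fun ρ hρ ρ' hρ' s t => crokeDist_proj_eq (fun w' hw' => ?_) ?_, fun q hq => ?_⟩
  · obtain ⟨u', rfl⟩ : ∃ u', w' = c + u' := ⟨w' - c, by ring⟩
    rw [dist_add_left, dist_eq_norm]
    rcases le_or_gt (3 * r) ‖u'‖ with hbig | hsmall
    · have h1 := norm_sub_norm_le u' (ρ * Complex.exp (s * Complex.I))
      rw [hnorm hρ.1, norm_sub_rev] at h1
      linarith [coneDist_le_add (θ := 2 * Real.pi / N) (s := s) (t := t) hρ.1 hρ'.1, hρ.2, hρ'.2]
    · obtain ⟨n, rfl⟩ := hsep _ u' ((hnorm hρ'.1 t).trans_lt hρ'.2) hsmall hw'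
      rw [hpolar, norm_polar_sub_polar]
      refine Real.sqrt_le_sqrt ?_
      have := cos_sub_le_cos_norm hN (s - t) n
      rw [← sub_sub]
      have := mul_le_mul_of_nonneg_left this (mul_nonneg hρ.1 hρ'.1)
      linarith
  · obtain ⟨n, hn⟩ := exists_cos_sub_eq_cos_norm hN (s - t)
    refine ⟨_, hrot _ n, ?_⟩
    rw [dist_add_left, dist_eq_norm, hpolar, norm_polar_sub_polar, ← sub_sub, hn, coneDist]
  · obtain ⟨w, rfl, hw⟩ := exists_dist_lt_of_crokeDist_lt hq
    rw [dist_comm, dist_eq_norm] at hw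
    refine ⟨‖w - c‖, ⟨norm_nonneg _, hw⟩, Complex.arg (w - c), ?_⟩
    change proj (c + _) = _
    rw [Complex.norm_mul_exp_arg_mul_I, add_sub_cancel]

end ConeAngle

theorem exp_int_mul_eq_zeta_zpow (n : ℤ) :
    Complex.exp ((n * (2 * Real.pi / (3 : ℕ)) : ℝ) * Complex.I) = zeta ^ n := by
  rw [zeta, ← Complex.exp_int_mul]
  congr 1
  push_cast
  ring

/-- Over a cone point, the points identified in the quotient differ by a rotation of order three. -/
theorem hasConeAngle_of_mem_coneSet {c : ℂ} (hc : c ∈ coneSet) :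
    HasConeAngle (proj c) (2 * Real.pi / 3) := by
  have hnat : ∀ (k : ℕ) (u : ℂ), proj (c + zeta ^ k * u) = proj (c + u) := fun k u => by
    rw [← proj_affine k (lattice.neg_mem (zeta_pow_mul_sub_mem_lattice hc k)) (c + u)]
    congr 1
    ring
  have h3 : (1 : ℝ) < √3 := Real.lt_sqrt_of_sq_lt (by norm_num)
  have := hasConeAngle_of_rotation (N := 3) (by norm_num) (c := c) (r := 1 / 2) (by norm_num)
    (fun u n => ?_) fun u u' hu hu' h => ?_
  · exact_mod_cast this
  · rw [exp_int_mul_eq_zeta_zpow]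
    have : zeta ^ n = zeta ^ (n % 3).toNat := by
      rw [← zpow_natCast, Int.toNat_of_nonneg (Int.emod_nonneg _ (by norm_num))]
      conv_lhs => rw [← Int.mul_ediv_add_emod n 3, zpow_add₀ zeta_ne_zero, zpow_mul]
      have : zeta ^ (3 : ℤ) = 1 := by exact_mod_cast zeta_pow_three
      rw [this, one_zpow, one_mul]
    rw [this]
    exact hnat _ u
  · obtain ⟨k, -, hk⟩ := proj_eq_iff.1 h
    refine ⟨k, ?_⟩
    rw [exp_int_mul_eq_zeta_zpow, zpow_natCast]
    by_contra hne
    have h1 := lattice.sub_mem hk (zeta_pow_mul_sub_mem_lattice hc k)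
    have e : zeta ^ k * (c + u) - (c + u') - (zeta ^ k * c - c) = zeta ^ k * u - u' := by ring
    rw [e] at h1
    have h2 := two_sqrt_three_le_norm h1 (sub_ne_zero.2 (Ne.symm hne))
    have h4 := norm_sub_le (zeta ^ k * u) u'
    rw [norm_mul, norm_pow, norm_zeta, one_pow, one_mul] at h4
    linarith

/-- Over a point which is not a cone point, points close to each other are not identified. -/
theorem hasConeAngle_of_notMem_coneSet {c : ℂ} (hc : c ∉ coneSet) :
    HasConeAngle (proj c) (2 * Real.pi) := by
  have hpos : ∀ k, 0 < k → k < 3 → 0 < Metric.infDist (zeta ^ k * c - c) lattice :=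
    fun k h1 h2 => (isClosed_lattice.notMem_iff_infDist_pos ⟨0, lattice.zero_mem⟩).1
      fun hmem => hc (mem_coneSet_of_fixed h1 h2 hmem)
  obtain ⟨r, hr, hr1, hr2, hr3⟩ : ∃ r > 0, 4 * r ≤ 1 ∧
      4 * r ≤ Metric.infDist (zeta ^ 1 * c - c) lattice ∧
      4 * r ≤ Metric.infDist (zeta ^ 2 * c - c) lattice := by
    have h1 := hpos 1 (by norm_num) (by norm_num)
    have h2 := hpos 2 (by norm_num) (by norm_num)
    refine ⟨min 1 (min (Metric.infDist (zeta ^ 1 * c - c) lattice)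
      (Metric.infDist (zeta ^ 2 * c - c) lattice)) / 4, by positivity, ?_, ?_, ?_⟩ <;>
      rw [mul_div_cancel₀ _ (by norm_num)]
    · exact min_le_left _ _
    · exact (min_le_right _ _).trans (min_le_left _ _)
    · exact (min_le_right _ _).trans (min_le_right _ _)
  have h3 : (1 : ℝ) < √3 := Real.lt_sqrt_of_sq_lt (by norm_num)
  have hone : ∀ n : ℤ, Complex.exp ((n * (2 * Real.pi / (1 : ℕ)) : ℝ) * Complex.I) = 1 := by
    intro n
    rw [← Complex.exp_int_mul_two_pi_mul_I n]
    congr 1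
    push_cast
    ring
  have := hasConeAngle_of_rotation (N := 1) (by norm_num) (c := c) hr
    (fun u n => by rw [hone, one_mul]) fun u u' hu hu' h => ?_
  · simpa using this
  · obtain ⟨k, hk3, hk⟩ := proj_eq_iff.1 h
    have hn := norm_sub_le u' (zeta ^ k * u)
    rw [norm_mul, norm_pow, norm_zeta, one_pow, one_mul] at hn
    have hfar : ¬ 4 * r ≤ Metric.infDist (zeta ^ k * c - c) lattice := by
      intro hle
      have h1 := Metric.infDist_le_dist_of_mem (x := zeta ^ k * c - c) (s := lattice) hk
      rw [dist_eq_norm] at h1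
      have e : zeta ^ k * c - c - (zeta ^ k * (c + u) - (c + u')) = u' - zeta ^ k * u := by ring
      rw [e] at h1
      linarith
    refine ⟨0, ?_⟩
    rw [hone, one_mul]
    interval_cases k
    · by_contra hne
      have e : zeta ^ 0 * (c + u) - (c + u') = u - u' := by ring
      rw [e] at hk
      have h1 := two_sqrt_three_le_norm hk (sub_ne_zero.2 (Ne.symm hne))
      rw [pow_zero, one_mul, norm_sub_rev] at hn
      linarith
    · exact absurd hr2 hfar
    · exact absurd hr3 hfar

theorem hasConeAngle_conePoint (i : Fin 3) : HasConeAngle (conePoint i) (2 * Real.pi / 3) := by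
  obtain ⟨c, hc⟩ := proj_surjective (conePoint i)
  rw [← hc]
  exact hasConeAngle_of_mem_coneSet ⟨i, hc.symm⟩

theorem hasConeAngle_of_notMem_range {p : CrokeSphere} (hp : p ∉ range conePoint) :
    HasConeAngle p (2 * Real.pi) := by
  obtain ⟨c, rfl⟩ := proj_surjective p
  exact hasConeAngle_of_notMem_coneSet hp

end Croke

theorem mainTheorem7 :
    Croke.HasArea (2 * Real.sqrt 3) ∧
    Function.Injective Croke.conePoint ∧
    (∀ i, Croke.HasConeAngle (Croke.conePoint i) (2 * Real.pi / 3)) ∧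
    (∀ p, p ∉ range Croke.conePoint → Croke.HasConeAngle p (2 * Real.pi)) ∧
    ∃ Φ : Croke.CrokeSphere ≃ₜ Croke.S2,
      ContMDiffOn 𝓘(ℝ, ℂ) (𝓡 2) ∞ (fun z => Φ (Croke.proj z)) Croke.coneSetᶜ ∧
      ∀ δ : ℝ, 0 < δ → ∃ g : Croke.SphereMetric,
        Croke.AgreesOutside Φ g δ ∧
        (∀ p, 0 ≤ Croke.gaussCurvature g p) ∧
        0 < Croke.firstEigenvalue g ∧
        Croke.area g ≤ ENNReal.ofReal (2 * Real.sqrt 3 + δ) ∧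
        ∃ ℓ : ℝ, IsLeast (Croke.closedGeodesicLengths g) ℓ ∧ 2 * Real.sqrt 3 - δ ≤ ℓ := by
  obtain ⟨Φ, hΦ⟩ := Croke.exists_homeomorph_comp_proj
  refine ⟨Croke.hasArea_crokeSphere, Croke.conePoint_injective, Croke.hasConeAngle_conePoint,
    fun p hp => Croke.hasConeAngle_of_notMem_range hp, Φ, ?_, fun δ hδ => ?_⟩
  · rw [funext hΦ]
    exact Croke.contMDiffOn_devMap.mono fun z hz => Croke.notMem_lattice_of_notMem_coneSet hz
  -- the discs of radius `ρ` about the cone points lie in convex caps; `ε` is the height below which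
  -- the metric is changed, so that it is flat outside these discs
  obtain ⟨r, hr, hB⟩ := Croke.exists_chord_lt (s := 1 / 200) (by norm_num)
  set ρ := min r (min (1 / 4) (δ / 2)) with hρdef
  have hρ : 0 < ρ := by positivity
  have hρr : ρ ≤ r := min_le_left _ _
  have hρ4 : ρ ≤ 1 / 4 := (min_le_right _ _).trans (min_le_left _ _)
  have hρδ : ρ ≤ δ / 2 := (min_le_right _ _).trans (min_le_right _ _)
  obtain ⟨ε, hε, hA⟩ := Croke.exists_le_chord hρ
  obtain ⟨ℓ, hℓ, hle⟩ := Croke.exists_isLeast_cappedMetric hε hρ hρ4 hA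
    fun x hx => hB x (hx.trans hρr)
  refine ⟨Croke.cappedMetric hε, ?_, Croke.gaussCurvature_cappedMetric_nonneg hε,
    Croke.firstEigenvalue_cappedMetric_pos hε, ?_, ℓ, hℓ, by linarith⟩
  · exact Croke.agreesOutside_cappedMetric hε hδ (fun x hx => hA x (by linarith)) Φ hΦ
  · exact (Croke.area_cappedMetric_le hε).trans (ENNReal.ofReal_le_ofReal (by linarith))
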